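/- Let $\Bbbk$ be a field and let $(V,c)$ be a braided vector space over $\Bbbk$, i.e. $V$ is a vector space (of any dimension) and $c: V\otimes V\to V\otimes V$ is a linear isomorphism with $(c\otimes \mathrm{id})(\mathrm{id}\otimes c)(c\otimes \mathrm{id})=(\mathrm{id}\otimes c)(c\otimes \mathrm{id})(\mathrm{id}\otimes c)$. Let $GL(V,c)$ be the group of all $g\in GL(V)$ such that $g\otimes g$ commutes with $c$. A braided Hopf algebra is a vector space $R$ with a braiding $c_R$, an associative unital product $m$ and a coassociative counital coproduct $\Delta$, with unit $1$ and counit $\varepsilon$, such that $m,1,\Delta,\varepsilon$ commute with $c_R$ (that is, $c_R(m\otimes\mathrm{id})=(\mathrm{id}\otimes m)(c_R\otimes\mathrm{id})(\mathrm{id}\otimes c_R)$, $(\mathrm{id}\otimes\Delta)c_R=(c_R\otimes\mathrm{id})(\mathrm{id}\otimes c_R)(\Delta\otimes\mathrm{id})$, $c_R(1\otimes x)=x\otimes 1$, $(\mathrm{id}\otimes\varepsilon)c_R=\varepsilon\otimes\mathrm{id}$, and the mirror images of these identities), such that $\Delta m=(m\otimes m)(\mathrm{id}\otimes c_R\otimes\mathrm{id})(\Delta\otimes\Delta)$,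 $\Delta(1)=1\otimes 1$ and $\varepsilon$ is an algebra map, and such that $\mathrm{id}_R$ has an inverse for the convolution product of $\operatorname{End}R$. Its group of automorphisms $\mathrm{Aut}_{\mathrm{Hopf}}\,R$ consists of the linear automorphisms of $R$ that preserve $m$, $\Delta$ and $c_R$. A Nichols algebra of $(V,c)$ is a braided Hopf algebra $\mathfrak B(V)$ with an $\mathbb N$-grading $\mathfrak B(V)=\bigoplus_{n\ge 0}\mathfrak B^n(V)$ compatible with product, coproduct, counit and braiding, and with an identification of $(V,c)$ with $\mathfrak B^1(V)$ as braided vector spaces, such that $\mathfrak B^0(V)=\Bbbk 1$, the space of primitive elements $\{x : \Delta(x)=x\otimes 1+1\otimes x\}$ equals $\mathfrak B^1(V)$, and $\mathfrak B(V)$ is generated as an algebra by $\mathfrak B^1(V)$. **Theorem.** Every braided vector space $(V,c)$ has a Nichols algebra, and for every Nichols algebra $\mathfrak B(V)$ of $(V,c)$ there is a group isomorphism $$\mathfrak B: GL(V,c)\longrightarrow \mathrm{Aut}_{\mathrm{Hopf}}\,\mathfrak B(V)$$ such that $\mathfrak B(g)$ extends $g$, i.e. $\mathfrak B(g)(v)=g(v)$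 for all $g\in GL(V,c)$ and $v\in V=\mathfrak B^1(V)$. -/

import Mathlib

open scoped TensorProduct

universe u v w

/-- For an endomorphism `c` of `V ⊗ V`, the endomorphism `c ⊗ id` of `V ⊗ V ⊗ V`. -/
def braidLeft {k : Type u} {V : Type v} [Field k] [AddCommGroup V] [Module k V]
    (c : V ⊗[k] V →ₗ[k] V ⊗[k] V) : (V ⊗[k] V) ⊗[k] V →ₗ[k] (V ⊗[k] V) ⊗[k] V :=
  LinearMap.rTensor V c

/-- For an endomorphism `c` of `V ⊗ V`, the endomorphism `id ⊗ c` of `V ⊗ V ⊗ V`. -/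
def braidRight {k : Type u} {V : Type v} [Field k] [AddCommGroup V] [Module k V]
    (c : V ⊗[k] V →ₗ[k] V ⊗[k] V) : (V ⊗[k] V) ⊗[k] V →ₗ[k] (V ⊗[k] V) ⊗[k] V :=
  (TensorProduct.assoc k V V V).symm.toLinearMap ∘ₗ LinearMap.lTensor V c ∘ₗ
    (TensorProduct.assoc k V V V).toLinearMap

/-- For an endomorphism `c` of `V ⊗ V`, the endomorphism `id ⊗ c ⊗ id` of
`(V ⊗ V) ⊗ (V ⊗ V)`. -/
def braidMiddle {k : Type u} {V : Type v} [Field k] [AddCommGroup V] [Module k V]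
    (c : V ⊗[k] V →ₗ[k] V ⊗[k] V) :
    (V ⊗[k] V) ⊗[k] (V ⊗[k] V) →ₗ[k] (V ⊗[k] V) ⊗[k] (V ⊗[k] V) :=
  (TensorProduct.assoc k V V (V ⊗[k] V)).symm.toLinearMap ∘ₗ
    LinearMap.lTensor V ((TensorProduct.assoc k V V V).toLinearMap ∘ₗ
      LinearMap.rTensor V c ∘ₗ (TensorProduct.assoc k V V V).symm.toLinearMap) ∘ₗ
    (TensorProduct.assoc k V V (V ⊗[k] V)).toLinearMap

/-- A braiding on a vector space `V`: a linear automorphism `c` of `V ⊗ V` solving the braid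
equation `(c ⊗ id)(id ⊗ c)(c ⊗ id) = (id ⊗ c)(c ⊗ id)(id ⊗ c)`. A vector space together with a
braiding is a braided vector space. -/
structure Braiding (k : Type u) (V : Type v) [Field k] [AddCommGroup V] [Module k V] where
  /-- The underlying linear automorphism of `V ⊗ V`. -/
  c : V ⊗[k] V ≃ₗ[k] V ⊗[k] V
  braid_eq :
    braidLeft c.toLinearMap ∘ₗ braidRight c.toLinearMap ∘ₗ braidLeft c.toLinearMap =
      braidRight c.toLinearMap ∘ₗ braidLeft c.toLinearMap ∘ₗ braidRight c.toLinearMap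

/-- The group `GL(V, c)` of automorphisms of a braided vector space: all linear automorphisms `g`
of `V` such that `g ⊗ g` commutes with `c`. -/
def Braiding.GL {k : Type u} {V : Type v} [Field k] [AddCommGroup V] [Module k V]
    (B : Braiding k V) : Subgroup (V ≃ₗ[k] V) where
  carrier := {g | ∀ x : V ⊗[k] V,
    TensorProduct.map g.toLinearMap g.toLinearMap (B.c x) =
      B.c (TensorProduct.map g.toLinearMap g.toLinearMap x)}
  one_mem' := by
    intro x
    change TensorProduct.map LinearMap.id LinearMap.id _ =
      B.c (TensorProduct.map LinearMap.id LinearMap.id x)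
    simp
  mul_mem' := by
    intro g h hg hh x
    change TensorProduct.map (g.toLinearMap ∘ₗ h.toLinearMap) (g.toLinearMap ∘ₗ h.toLinearMap) _ =
      B.c (TensorProduct.map (g.toLinearMap ∘ₗ h.toLinearMap) (g.toLinearMap ∘ₗ h.toLinearMap) x)
    simp only [TensorProduct.map_comp, LinearMap.comp_apply]
    rw [hh x, hg]
  inv_mem' := by
    intro g hg x
    change (TensorProduct.congr g g).symm (B.c x) = B.c ((TensorProduct.congr g g).symm x)
    rw [LinearEquiv.symm_apply_eq]
    have h := hg ((TensorProduct.congr g g).symm x)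
    change TensorProduct.congr g g _ = B.c (TensorProduct.congr g g _) at h
    rw [h, LinearEquiv.apply_symm_apply]

/-- A braided Hopf algebra structure on an associative unital algebra `R` that is also a
coassociative counital coalgebra: a braiding `c` of `R` with which product, unit, coproduct and
counit commute, such that coproduct and counit are multiplicative and unital (for the product
of `R ⊗ R` twisted by `c`), and such that the identity is invertible for the convolution
product. -/
structure BraidedHopfAlgebra (k : Type u) (R : Type w) [Field k] [Ring R] [Algebra k R]
    [Coalgebra k R] extends Braiding k R where
  /-- `c (m ⊗ id) = (id ⊗ m)(c ⊗ id)(id ⊗ c)` -/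
  mul_left :
    c.toLinearMap ∘ₗ LinearMap.rTensor R (LinearMap.mul' k R) =
      LinearMap.lTensor R (LinearMap.mul' k R) ∘ₗ (TensorProduct.assoc k R R R).toLinearMap ∘ₗ
        braidLeft c.toLinearMap ∘ₗ braidRight c.toLinearMap
  /-- `c (id ⊗ m) = (m ⊗ id)(id ⊗ c)(c ⊗ id)` -/
  mul_right :
    c.toLinearMap ∘ₗ LinearMap.lTensor R (LinearMap.mul' k R) ∘ₗ
        (TensorProduct.assoc k R R R).toLinearMap =
      LinearMap.rTensor R (LinearMap.mul' k R) ∘ₗ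
        braidRight c.toLinearMap ∘ₗ braidLeft c.toLinearMap
  one_left : ∀ x : R, c (1 ⊗ₜ[k] x) = x ⊗ₜ[k] 1
  one_right : ∀ x : R, c (x ⊗ₜ[k] 1) = 1 ⊗ₜ[k] x
  /-- `(id ⊗ Δ) c = (c ⊗ id)(id ⊗ c)(Δ ⊗ id)` -/
  comul_left :
    (TensorProduct.assoc k R R R).symm.toLinearMap ∘ₗ
        LinearMap.lTensor R (Coalgebra.comul (R := k) (A := R)) ∘ₗ c.toLinearMap =
      braidLeft c.toLinearMap ∘ₗ braidRight c.toLinearMap ∘ₗ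
        LinearMap.rTensor R (Coalgebra.comul (R := k) (A := R))
  /-- `(Δ ⊗ id) c = (id ⊗ c)(c ⊗ id)(id ⊗ Δ)` -/
  comul_right :
    LinearMap.rTensor R (Coalgebra.comul (R := k) (A := R)) ∘ₗ c.toLinearMap =
      braidRight c.toLinearMap ∘ₗ braidLeft c.toLinearMap ∘ₗ
        (TensorProduct.assoc k R R R).symm.toLinearMap ∘ₗ
        LinearMap.lTensor R (Coalgebra.comul (R := k) (A := R))
  /-- `(id ⊗ ε) c = ε ⊗ id` -/
  counit_left :
    (TensorProduct.rid k R).toLinearMap ∘ₗ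
        LinearMap.lTensor R (Coalgebra.counit (R := k) (A := R)) ∘ₗ c.toLinearMap =
      (TensorProduct.lid k R).toLinearMap ∘ₗ
        LinearMap.rTensor R (Coalgebra.counit (R := k) (A := R))
  /-- `(ε ⊗ id) c = id ⊗ ε` -/
  counit_right :
    (TensorProduct.lid k R).toLinearMap ∘ₗ
        LinearMap.rTensor R (Coalgebra.counit (R := k) (A := R)) ∘ₗ c.toLinearMap =
      (TensorProduct.rid k R).toLinearMap ∘ₗ
        LinearMap.lTensor R (Coalgebra.counit (R := k) (A := R))
  /-- `Δ m = (m ⊗ m)(id ⊗ c ⊗ id)(Δ ⊗ Δ)` -/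
  comul_mul :
    Coalgebra.comul (R := k) (A := R) ∘ₗ LinearMap.mul' k R =
      TensorProduct.map (LinearMap.mul' k R) (LinearMap.mul' k R) ∘ₗ
        braidMiddle c.toLinearMap ∘ₗ
        TensorProduct.map (Coalgebra.comul (R := k) (A := R)) (Coalgebra.comul (R := k) (A := R))
  comul_one : Coalgebra.comul (R := k) (1 : R) = 1 ⊗ₜ[k] 1
  counit_mul : ∀ x y : R,
    Coalgebra.counit (R := k) (x * y) = Coalgebra.counit (R := k) x * Coalgebra.counit (R := k) y
  counit_one : Coalgebra.counit (R := k) (1 : R) = 1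
  /-- Existence of an antipode. -/
  exists_antipode : ∃ S : R →ₗ[k] R,
    LinearMap.mul' k R ∘ₗ LinearMap.rTensor R S ∘ₗ Coalgebra.comul =
        Algebra.linearMap k R ∘ₗ Coalgebra.counit ∧
      LinearMap.mul' k R ∘ₗ LinearMap.lTensor R S ∘ₗ Coalgebra.comul =
        Algebra.linearMap k R ∘ₗ Coalgebra.counit

/-- The group of braided Hopf algebra automorphisms of `R`: the linear automorphisms of `R` that
preserve the product, the coproduct and the braiding. -/
def BraidedHopfAlgebra.Aut {k : Type u} {R : Type w} [Field k] [Ring R] [Algebra k R]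
    [Coalgebra k R] (H : BraidedHopfAlgebra k R) : Subgroup (R ≃ₗ[k] R) where
  carrier := {f | (∀ x y : R, f (x * y) = f x * f y) ∧
    (∀ x : R, TensorProduct.map f.toLinearMap f.toLinearMap (Coalgebra.comul (R := k) x) =
      Coalgebra.comul (R := k) (f x)) ∧
    f ∈ H.toBraiding.GL}
  one_mem' := by
    refine ⟨fun _ _ => rfl, fun x => ?_, one_mem _⟩
    change TensorProduct.map LinearMap.id LinearMap.id _ = Coalgebra.comul (R := k) x
    simp
  mul_mem' := by
    rintro f g ⟨hf, hf', hf''⟩ ⟨hg, hg', hg''⟩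
    refine ⟨fun x y => ?_, fun x => ?_, mul_mem hf'' hg''⟩
    · change f (g (x * y)) = f (g x) * f (g y)
      rw [hg, hf]
    · change TensorProduct.map (f.toLinearMap ∘ₗ g.toLinearMap) (f.toLinearMap ∘ₗ g.toLinearMap) _ =
        Coalgebra.comul (R := k) (f (g x))
      rw [TensorProduct.map_comp, LinearMap.comp_apply, hg', hf']
  inv_mem' := by
    rintro f ⟨hf, hf', hf''⟩
    refine ⟨fun x y => ?_, fun x => ?_, inv_mem hf''⟩
    · change f.symm (x * y) = f.symm x * f.symm y
      rw [LinearEquiv.symm_apply_eq, hf, LinearEquiv.apply_symm_apply, LinearEquiv.apply_symm_apply]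
    · change (TensorProduct.congr f f).symm _ = Coalgebra.comul (R := k) (f.symm x)
      rw [LinearEquiv.symm_apply_eq]
      have h := hf' (f.symm x)
      rw [LinearEquiv.apply_symm_apply] at h
      exact h.symm

/-- For subspaces `P`, `Q` of `R`, the subspace `P ⊗ Q` of `R ⊗ R`. -/
def tensorSubmodule {k : Type u} {R : Type w} [Field k] [AddCommGroup R] [Module k R]
    (P Q : Submodule k R) : Submodule k (R ⊗[k] R) :=
  LinearMap.range (TensorProduct.map P.subtype Q.subtype)

/-- The braided Hopf algebra `R` with the `ℕ`-grading `𝒜` is a Nichols algebra of the braided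
vector space `(V, B)`, where `ι` is the identification of `V` with the degree one part of `R`. -/
structure IsNicholsAlgebra {k : Type u} {V : Type v} {R : Type w} [Field k] [AddCommGroup V]
    [Module k V] [Ring R] [Algebra k R] [Coalgebra k R] (B : Braiding k V)
    (H : BraidedHopfAlgebra k R) (𝒜 : ℕ → Submodule k R) (ι : V →ₗ[k] R) : Prop where
  /-- `R` is the direct sum of the `𝒜 n`. -/
  isInternal : DirectSum.IsInternal 𝒜
  mul_mem : ∀ (i j : ℕ) (x y : R), x ∈ 𝒜 i → y ∈ 𝒜 j → x * y ∈ 𝒜 (i + j)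
  comul_mem : ∀ (n : ℕ) (x : R), x ∈ 𝒜 n →
    Coalgebra.comul (R := k) x ∈
      ⨆ (i : ℕ) (j : ℕ) (_ : i + j = n), tensorSubmodule (𝒜 i) (𝒜 j)
  counit_eq_zero : ∀ (n : ℕ) (x : R), n ≠ 0 → x ∈ 𝒜 n → Coalgebra.counit (R := k) x = 0
  braiding_mem : ∀ (i j : ℕ) (t : R ⊗[k] R), t ∈ tensorSubmodule (𝒜 i) (𝒜 j) →
    H.c t ∈ tensorSubmodule (𝒜 j) (𝒜 i)
  /-- The degree zero part consists of the scalars. -/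
  degree_zero : 𝒜 0 = LinearMap.range (Algebra.linearMap k R)
  /-- `ι` is an isomorphism of braided vector spaces from `V` onto the degree one part. -/
  injective : Function.Injective ι
  range_eq : LinearMap.range ι = 𝒜 1
  braiding_eq : ∀ t : V ⊗[k] V,
    H.c (TensorProduct.map ι ι t) = TensorProduct.map ι ι (B.c t)
  /-- The degree one part is the space of primitive elements. -/
  primitive_iff : ∀ x : R,
    Coalgebra.comul (R := k) x = x ⊗ₜ[k] 1 + 1 ⊗ₜ[k] x ↔ x ∈ 𝒜 1
  /-- `R` is generated as an algebra by its degree one part. -/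
  adjoin_eq : Algebra.adjoin k (𝒜 1 : Set R) = ⊤

/-!
A linear isomorphism `c` satisfying the braid equation lets the positive braids act on the tensor
powers of `V`. In the ring of these operators, sums of lifted shuffles define the quantum shuffle
product on `T(V)`, which together with deconcatenation is a braided Hopf algebra, and the quantum
symmetrizers assemble into a morphism to it from `T(V)` with the concatenation product and the
unshuffle coproduct. The image of this morphism is a Nichols algebra: it is generated by `V`, and a
primitive element of degree at least two would vanish, as deconcatenation has no such elements.

Conversely, let `R` be any Nichols algebra and let `∂ : R → R ⊗ V` be the component of the
coproduct in bidegree `(*, 1)`. It is a braided derivation, so its pullback to `T(V)` is determined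
by `(V, c)` alone. Since primitive elements have degree one, a subspace of the augmentation ideal
that is stable under the components of `∂` vanishes. Hence for Nichols algebras `R` and `R'` of
`(V, c)` the image in `R'` of the kernel of `T(V) → R` vanishes, so the two kernels agree and the
identity of `V` extends to an isomorphism `R ≃ R'`. Applied to `R` along `V → R` and along its
composite with `g ∈ GL(V, c)`, this gives the automorphism extending `g`; every automorphism arises
in this way because it preserves the primitive elements.
-/

/-! ### Braids, shuffles and symmetrizers -/

theorem semiconjBy_of_mem_closure {R S : Type*} [Ring R] [Ring S] {a : S} {φ ψ : R →+* S}
    {s : Set R} (h : ∀ x ∈ s, SemiconjBy a (φ x) (ψ x)) {x : R} (hx : x ∈ Subring.closure s) :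
    SemiconjBy a (φ x) (ψ x) := by
  induction hx using Subring.closure_induction with
  | mem x hx => exact h x hx
  | zero => simp
  | one => simp
  | add x y _ _ hx hy => simpa only [map_add] using hx.add_right hy
  | neg x _ hx => simpa only [map_neg] using hx.neg_right
  | mul x y _ _ hx hy => simpa only [map_mul] using hx.mul_right hy

/-- A ring `E` with a shift endomorphism `σ` and an element `s` satisfying the braid relation and
commuting with everything shifted twice. Elements of `E` stand for linear combinations of positive
braids on infinitely many strands, the crossing of strands `i` and `i + 1` being `σ ^ i s`. -/
structure BraidShift (E : Type*) [Ring E] where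
  /-- The shift, which adds one strand on the left. -/
  σ : E →+* E
  /-- The crossing of the first two strands. -/
  s : E
  braid : s * σ s * s = σ s * s * σ s
  comm : ∀ f, Commute s (σ (σ f))

namespace BraidShift

variable {E : Type*} [Ring E] (A : BraidShift E)

/-- The braid in which the first strand crosses the next `n` strands. -/
def cross : ℕ → E
  | 0 => 1
  | n + 1 => A.σ (cross n) * A.s

/-- The braid in which the first `m` strands cross the next `n` strands. -/
def swap : ℕ → ℕ → E
  | 0, _ => 1
  | m + 1, n => A.cross n * A.σ (swap m n)

/-- The sum of all braided shuffles of the first `m` with the next `n` strands; the two summands of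
the recursion collect the shuffles putting a strand of the first, respectively of the second,
bundle in front. -/
def shuffle : ℕ → ℕ → E
  | 0, _ => 1
  | _ + 1, 0 => 1
  | m + 1, n + 1 => A.σ (shuffle m (n + 1)) + A.σ (shuffle (m + 1) n) * A.swap (m + 1) 1

/-- The sum of all braided unshuffles of `m + n` strands into bundles of `m` and `n` strands. -/
def unshuffle : ℕ → ℕ → E
  | 0, _ => 1
  | _ + 1, 0 => 1
  | m + 1, n + 1 => A.σ (unshuffle m (n + 1)) + A.cross (m + 1) * A.σ (unshuffle (m + 1) n)

/-- The quantum symmetrizer on the first `n` strands. -/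
def symmetrizer : ℕ → E
  | 0 => 1
  | n + 1 => A.shuffle 1 n * A.σ (symmetrizer n)

/-- The subring of braids that only involve the first `n` strands. -/
def strands (n : ℕ) : Subring E :=
  Subring.closure {x | ∃ i, i + 2 ≤ n ∧ (A.σ ^ i) A.s = x}

lemma σ_pow_succ_apply (i : ℕ) (f : E) : (A.σ ^ (i + 1)) f = A.σ ((A.σ ^ i) f) := by
  rw [pow_succ', RingHom.mul_def, RingHom.comp_apply]

lemma σ_pow_succ_apply' (i : ℕ) (f : E) : (A.σ ^ (i + 1)) f = (A.σ ^ i) (A.σ f) := by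
  rw [pow_succ, RingHom.mul_def, RingHom.comp_apply]

lemma σ_pow_add_apply (i j : ℕ) (f : E) : (A.σ ^ (i + j)) f = (A.σ ^ i) ((A.σ ^ j) f) := by
  rw [pow_add, RingHom.mul_def, RingHom.comp_apply]

lemma strands_mono {m n : ℕ} (h : m ≤ n) : A.strands m ≤ A.strands n :=
  Subring.closure_mono fun _ ⟨i, hi, hx⟩ => ⟨i, hi.trans h, hx⟩

lemma σ_mem_strands {n : ℕ} {f : E} (hf : f ∈ A.strands n) : A.σ f ∈ A.strands (n + 1) := by
  suffices A.strands n ≤ (A.strands (n + 1)).comap A.σ from this hf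
  refine Subring.closure_le.2 ?_
  rintro _ ⟨i, hi, rfl⟩
  exact Subring.subset_closure ⟨i + 1, by omega, A.σ_pow_succ_apply i A.s⟩

lemma σ_pow_mem_strands {n : ℕ} {f : E} (hf : f ∈ A.strands n) (i : ℕ) :
    (A.σ ^ i) f ∈ A.strands (i + n) := by
  induction i with
  | zero => rwa [pow_zero, zero_add]
  | succ i ih =>
    rw [σ_pow_succ_apply, add_right_comm]
    exact A.σ_mem_strands ih

lemma s_mem_strands : A.s ∈ A.strands 2 := Subring.subset_closure ⟨0, le_rfl, rfl⟩

lemma cross_mem_strands (n : ℕ) : A.cross n ∈ A.strands (n + 1) := by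
  induction n with
  | zero => exact one_mem _
  | succ n ih => exact mul_mem (A.σ_mem_strands ih) (A.strands_mono (by omega) A.s_mem_strands)

lemma swap_mem_strands (m n : ℕ) : A.swap m n ∈ A.strands (m + n) := by
  induction m with
  | zero => exact one_mem _
  | succ m ih =>
    exact mul_mem (A.strands_mono (by omega) (A.cross_mem_strands n))
      (A.strands_mono (by omega) (A.σ_mem_strands ih))

lemma shuffle_mem_strands (m n : ℕ) : A.shuffle m n ∈ A.strands (m + n) := by
  fun_induction shuffle with
  | case1 => exact one_mem _
  | case2 => exact one_mem _
  | case3 m n ih₁ ih₂ =>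
    exact add_mem (A.strands_mono (by omega) (A.σ_mem_strands ih₁)) (mul_mem
      (A.strands_mono (by omega) (A.σ_mem_strands ih₂))
      (A.strands_mono (by omega) (A.swap_mem_strands _ _)))

lemma unshuffle_mem_strands (m n : ℕ) : A.unshuffle m n ∈ A.strands (m + n) := by
  fun_induction unshuffle with
  | case1 => exact one_mem _
  | case2 => exact one_mem _
  | case3 m n ih₁ ih₂ =>
    exact add_mem (A.strands_mono (by omega) (A.σ_mem_strands ih₁)) (mul_mem
      (A.strands_mono (by omega) (A.cross_mem_strands _))
      (A.strands_mono (by omega) (A.σ_mem_strands ih₂)))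

lemma symmetrizer_mem_strands (n : ℕ) : A.symmetrizer n ∈ A.strands n := by
  induction n with
  | zero => exact one_mem _
  | succ n ih =>
    exact mul_mem (A.strands_mono (by omega) (A.shuffle_mem_strands 1 n)) (A.σ_mem_strands ih)

lemma s_commute_σ_pow (i : ℕ) (f : E) : Commute A.s ((A.σ ^ (i + 2)) f) := by
  rw [σ_pow_succ_apply, σ_pow_succ_apply]
  exact A.comm _

lemma commute_σ_pow_of_mem_strands {n : ℕ} {f : E} (hf : f ∈ A.strands n) (g : E) :
    Commute f ((A.σ ^ n) g) := by
  refine (semiconjBy_of_mem_closure (φ := .id E) (ψ := .id E) ?_ hf).symm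
  rintro _ ⟨i, hi, rfl⟩
  obtain ⟨j, rfl⟩ := Nat.exists_eq_add_of_le hi
  rw [show i + 2 + j = i + (j + 2) by omega, σ_pow_add_apply]
  exact ((A.s_commute_σ_pow j g).map (A.σ ^ i)).symm

@[simp] lemma swap_zero_left (n : ℕ) : A.swap 0 n = 1 := by rw [swap]

@[simp] lemma swap_zero_right (m : ℕ) : A.swap m 0 = 1 := by
  induction m with
  | zero => rw [swap]
  | succ m ih => rw [swap, ih, map_one, cross, mul_one]

@[simp] lemma shuffle_zero_left (n : ℕ) : A.shuffle 0 n = 1 := by rw [shuffle]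

@[simp] lemma shuffle_zero_right (m : ℕ) : A.shuffle m 0 = 1 := by cases m <;> rw [shuffle]

lemma shuffle_succ_succ (m n : ℕ) : A.shuffle (m + 1) (n + 1) =
    A.σ (A.shuffle m (n + 1)) + A.σ (A.shuffle (m + 1) n) * A.swap (m + 1) 1 := by rw [shuffle]

lemma cross_succ (n : ℕ) : A.cross (n + 1) = A.σ (A.cross n) * A.s := rfl

lemma symmetrizer_succ (n : ℕ) :
    A.symmetrizer (n + 1) = A.shuffle 1 n * A.σ (A.symmetrizer n) := rfl

lemma swap_one_left (n : ℕ) : A.swap 1 n = A.cross n := by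
  rw [swap, swap, map_one, mul_one]

lemma cross_one : A.cross 1 = A.s := by rw [cross, cross, map_one, one_mul]

lemma swap_one_one : A.swap 1 1 = A.s := by rw [swap_one_left, cross_one]

lemma swap_add_left (m m' n : ℕ) :
    A.swap (m + m') n = A.swap m n * (A.σ ^ m) (A.swap m' n) := by
  induction m with
  | zero => simp
  | succ m ih =>
    rw [show m + 1 + m' = m + m' + 1 by omega, swap, ih, map_mul, swap, σ_pow_succ_apply, mul_assoc]

lemma cross_add (n n' : ℕ) : A.cross (n + n') = (A.σ ^ n) (A.cross n') * A.cross n := by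
  induction n with
  | zero => simp [cross]
  | succ n ih =>
    rw [show n + 1 + n' = n + n' + 1 by omega, cross, ih, map_mul, cross, σ_pow_succ_apply,
      mul_assoc]

lemma swap_add_right (m n n' : ℕ) :
    A.swap m (n + n') = (A.σ ^ n) (A.swap m n') * A.swap m n := by
  induction m with
  | zero => simp
  | succ m ih =>
    have h := A.commute_σ_pow_of_mem_strands (A.cross_mem_strands n) (A.swap m n')
    calc A.swap (m + 1) (n + n')
        = (A.σ ^ n) (A.cross n') * (A.cross n * (A.σ ^ n) (A.σ (A.swap m n'))) *
            A.σ (A.swap m n) := by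
          rw [swap, ih, cross_add, map_mul, ← σ_pow_succ_apply, σ_pow_succ_apply']
          simp only [mul_assoc]
      _ = (A.σ ^ n) (A.swap (m + 1) n') * A.swap (m + 1) n := by
          rw [← σ_pow_succ_apply', h.eq, σ_pow_succ_apply', swap, swap, map_mul]
          simp only [mul_assoc]

lemma cross_semiconj_generator (i r : ℕ) :
    SemiconjBy (A.cross (i + 2 + r)) (A.σ ((A.σ ^ i) A.s)) ((A.σ ^ i) A.s) := by
  induction i with
  | zero =>
    have h : SemiconjBy (A.σ A.s * A.s) (A.σ A.s) A.s := by
      rw [SemiconjBy, ← A.braid, mul_assoc]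
    rw [zero_add, cross_add, cross, cross_one]
    exact (A.s_commute_σ_pow 0 (A.cross r)).symm.semiconjBy.mul_left h
  | succ i ih =>
    rw [show i + 1 + 2 + r = (i + 2 + r) + 1 by omega, cross, σ_pow_succ_apply]
    exact (ih.map A.σ).mul_left (A.comm _)

lemma cross_semiconj {n : ℕ} {f : E} (hf : f ∈ A.strands n) :
    SemiconjBy (A.cross n) (A.σ f) f := by
  refine semiconjBy_of_mem_closure (φ := A.σ) (ψ := .id E) ?_ hf
  rintro _ ⟨i, hi, rfl⟩
  obtain ⟨r, rfl⟩ := Nat.exists_eq_add_of_le hi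
  exact A.cross_semiconj_generator i r

lemma swap_semiconj_right {n : ℕ} {f : E} (hf : f ∈ A.strands n) (p : ℕ) :
    SemiconjBy (A.swap p n) ((A.σ ^ p) f) f := by
  induction p with
  | zero => simp [SemiconjBy]
  | succ p ih =>
    rw [swap, σ_pow_succ_apply]
    exact (A.cross_semiconj hf).mul_left (ih.map A.σ)

lemma swap_one_semiconj_generator (i r : ℕ) :
    SemiconjBy (A.swap (i + 2 + r) 1) ((A.σ ^ i) A.s) (A.σ ((A.σ ^ i) A.s)) := by
  have hs : SemiconjBy (A.swap (2 + r) 1) A.s (A.σ A.s) := by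
    have h : SemiconjBy (A.s * A.σ A.s) A.s (A.σ A.s) := by
      rw [SemiconjBy, A.braid, mul_assoc]
    have h₂ : A.swap 2 1 = A.s * A.σ A.s := by rw [swap, swap_one_one, cross_one]
    rw [swap_add_left, h₂]
    exact h.mul_left (A.s_commute_σ_pow 0 (A.swap r 1)).symm.semiconjBy
  rw [add_assoc, swap_add_left, ← σ_pow_succ_apply, σ_pow_succ_apply']
  exact SemiconjBy.mul_left (A.commute_σ_pow_of_mem_strands (A.swap_mem_strands i 1) A.s)
    (hs.map (A.σ ^ i))

lemma swap_semiconj_left {n : ℕ} {f : E} (hf : f ∈ A.strands n) (p : ℕ) :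
    SemiconjBy (A.swap n p) f ((A.σ ^ p) f) := by
  have hone : SemiconjBy (A.swap n 1) f (A.σ f) := by
    refine semiconjBy_of_mem_closure (φ := .id E) (ψ := A.σ) ?_ hf
    rintro _ ⟨i, hi, rfl⟩
    obtain ⟨r, rfl⟩ := Nat.exists_eq_add_of_le hi
    exact A.swap_one_semiconj_generator i r
  induction p with
  | zero => simp [SemiconjBy]
  | succ p ih =>
    rw [swap_add_right, σ_pow_succ_apply']
    exact (hone.map (A.σ ^ p)).mul_left ih

lemma shuffle_succ_mul_shuffle_succ (m n p : ℕ) :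
    A.shuffle (m + 1 + (n + 1)) (p + 1) * A.shuffle (m + 1) (n + 1) =
      A.σ (A.shuffle (m + (n + 1)) (p + 1) * A.shuffle m (n + 1)) +
      A.σ (A.shuffle (m + 1 + n) (p + 1) * A.shuffle (m + 1) n) * A.swap (m + 1) 1 +
      A.σ (A.shuffle (m + 1 + (n + 1)) p * A.shuffle (m + 1) (n + 1)) *
        A.swap (m + 1 + (n + 1)) 1 := by
  have hrec : A.shuffle (m + 1 + (n + 1)) (p + 1) = A.σ (A.shuffle (m + (n + 1)) (p + 1)) +
      A.σ (A.shuffle (m + 1 + (n + 1)) p) * A.swap (m + 1 + (n + 1)) 1 := by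
    rw [show m + 1 + (n + 1) = m + (n + 1) + 1 by omega, shuffle]
  have hnat := A.swap_semiconj_left (A.shuffle_mem_strands (m + 1) (n + 1)) 1
  rw [pow_one] at hnat
  rw [hrec, add_mul, mul_assoc _ (A.swap _ 1), hnat.eq, A.shuffle_succ_succ m n,
    show m + 1 + n = m + (n + 1) by omega]
  simp only [map_add, map_mul, mul_add, add_mul, mul_assoc]

lemma shuffle_succ_mul_σ_shuffle_succ (m n p : ℕ) :
    A.shuffle (m + 1) (n + 1 + (p + 1)) * (A.σ ^ (m + 1)) (A.shuffle (n + 1) (p + 1)) =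
      A.σ (A.shuffle m (n + 1 + (p + 1)) * (A.σ ^ m) (A.shuffle (n + 1) (p + 1))) +
      A.σ (A.shuffle (m + 1) (n + (p + 1)) * (A.σ ^ (m + 1)) (A.shuffle n (p + 1))) *
        A.swap (m + 1) 1 +
      A.σ (A.shuffle (m + 1) (n + 1 + p) * (A.σ ^ (m + 1)) (A.shuffle (n + 1) p)) *
        A.swap (m + 1 + (n + 1)) 1 := by
  have hcomm (g : E) : A.swap (m + 1) 1 * A.σ ((A.σ ^ (m + 1)) g) =
      A.σ ((A.σ ^ (m + 1)) g) * A.swap (m + 1) 1 := by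
    rw [← σ_pow_succ_apply]
    exact A.commute_σ_pow_of_mem_strands (A.swap_mem_strands (m + 1) 1) g
  have hswap : A.swap (m + 1) 1 * (A.σ ^ (m + 1)) (A.shuffle (n + 1) (p + 1)) =
      A.σ ((A.σ ^ (m + 1)) (A.shuffle n (p + 1))) * A.swap (m + 1) 1 +
      A.σ ((A.σ ^ (m + 1)) (A.shuffle (n + 1) p)) * A.swap (m + 1 + (n + 1)) 1 := by
    rw [shuffle, map_add, map_mul, ← σ_pow_succ_apply', ← σ_pow_succ_apply',
      σ_pow_succ_apply _ (m + 1), σ_pow_succ_apply _ (m + 1), mul_add, hcomm, ← mul_assoc, hcomm,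
      mul_assoc, ← swap_add_left]
  rw [show n + 1 + (p + 1) = n + (p + 1) + 1 by omega, A.shuffle_succ_succ m, add_mul, mul_assoc,
    show n + (p + 1) + 1 = n + 1 + (p + 1) by omega, hswap, σ_pow_succ_apply,
    show n + 1 + p = n + (p + 1) by omega]
  simp only [map_mul, mul_add, add_assoc, mul_assoc]

theorem shuffle_assoc (m n p : ℕ) :
    A.shuffle (m + n) p * A.shuffle m n = A.shuffle m (n + p) * (A.σ ^ m) (A.shuffle n p) := by
  induction h : m + n + p using Nat.strong_induction_on generalizing m n p with
  | _ N ih =>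
    obtain _ | m := m
    · simp
    obtain _ | n := n
    · simp
    obtain _ | p := p
    · simp
    rw [shuffle_succ_mul_shuffle_succ, shuffle_succ_mul_σ_shuffle_succ,
      ih _ (by omega) m (n + 1) (p + 1) rfl, ih _ (by omega) (m + 1) n (p + 1) rfl,
      ih _ (by omega) (m + 1) (n + 1) p rfl]

/-- The sum of the braided shuffles putting a strand of the first bundle in front. -/
def shuffleLeft : ℕ → ℕ → E
  | 0, _ => 0
  | m + 1, n => A.σ (A.shuffle m n)

/-- The sum of the braided shuffles putting a strand of the second bundle in front. -/
def shuffleRight : ℕ → ℕ → E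
  | _, 0 => 0
  | m, n + 1 => A.σ (A.shuffle m n) * A.swap m 1

lemma shuffle_eq_shuffleLeft_add_shuffleRight {m n : ℕ} (h : m + n ≠ 0) :
    A.shuffle m n = A.shuffleLeft m n + A.shuffleRight m n := by
  obtain _ | m := m <;> obtain _ | n := n
  · contradiction
  · simp [shuffleLeft, shuffleRight]
  · simp [shuffleLeft, shuffleRight]
  · exact A.shuffle_succ_succ m n

/-- For bundles of `p.1 + p.2` and `q.1 + q.2` strands, the braids that first collect `p.1` and
`q.1` strands of the two bundles in front and then shuffle the remaining `p.2` and `q.2` strands. -/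
def cutTail (p q : ℕ × ℕ) : E :=
  (A.σ ^ (p.1 + q.1)) (A.shuffle p.2 q.2) * (A.σ ^ p.1) (A.swap p.2 q.1)

lemma cutTail_succ_left (i j : ℕ) (q : ℕ × ℕ) :
    A.cutTail (i + 1, j) q = A.σ (A.cutTail (i, j) q) := by
  simp only [cutTail, map_mul, ← σ_pow_succ_apply, Nat.add_right_comm i 1]

lemma swap_mul_cutTail_succ_right (p : ℕ × ℕ) (k l : ℕ) :
    A.swap p.1 1 * A.cutTail p (k + 1, l) = A.σ (A.cutTail p (k, l)) * A.swap (p.1 + p.2) 1 := by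
  obtain ⟨i, j⟩ := p
  have h₁ := A.commute_σ_pow_of_mem_strands
    (A.strands_mono (show i + 1 ≤ i + (k + 1) by omega) (A.swap_mem_strands i 1)) (A.shuffle j l)
  have h₂ := A.commute_σ_pow_of_mem_strands (A.swap_mem_strands i 1) (A.swap j k)
  calc A.swap i 1 * A.cutTail (i, j) (k + 1, l)
      = (A.σ ^ (i + (k + 1))) (A.shuffle j l) *
          (A.swap i 1 * (A.σ ^ (i + 1)) (A.swap j k)) * (A.σ ^ i) (A.swap j 1) := by
        rw [cutTail, ← mul_assoc, h₁.eq, add_comm k 1, swap_add_right, pow_one, map_mul,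
          ← σ_pow_succ_apply']
        simp only [mul_assoc]
    _ = A.σ (A.cutTail (i, j) (k, l)) * A.swap (i + j) 1 := by
        rw [h₂.eq, swap_add_left, cutTail, map_mul, ← σ_pow_succ_apply, ← σ_pow_succ_apply,
          add_assoc i k 1]
        simp only [mul_assoc]

section Cut

open Finset

lemma sum_shuffleLeft_mul_cutTail (a m n : ℕ) :
    ∑ p ∈ antidiagonal (m + 1), ∑ q ∈ antidiagonal n,
        (if p.1 + q.1 = a + 1 then A.shuffleLeft p.1 q.1 * A.cutTail p q else 0) =
      A.σ (∑ p ∈ antidiagonal m, ∑ q ∈ antidiagonal n,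
        if p.1 + q.1 = a then A.shuffle p.1 q.1 * A.cutTail p q else 0) := by
  rw [Nat.sum_antidiagonal_succ]
  simp [shuffleLeft, cutTail_succ_left, Nat.add_right_comm _ 1, apply_ite A.σ]

lemma sum_shuffleRight_mul_cutTail (a m n : ℕ) :
    ∑ p ∈ antidiagonal m, ∑ q ∈ antidiagonal (n + 1),
        (if p.1 + q.1 = a + 1 then A.shuffleRight p.1 q.1 * A.cutTail p q else 0) =
      A.σ (∑ p ∈ antidiagonal m, ∑ q ∈ antidiagonal n,
        if p.1 + q.1 = a then A.shuffle p.1 q.1 * A.cutTail p q else 0) * A.swap m 1 := by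
  simp only [map_sum, sum_mul, Nat.sum_antidiagonal_succ]
  refine sum_congr rfl fun p hp => ?_
  obtain rfl := mem_antidiagonal.1 hp
  simp [shuffleRight, ← add_assoc, mul_assoc, swap_mul_cutTail_succ_right, apply_ite A.σ, ite_mul]

theorem shuffle_eq_sum_cutTail {a m n : ℕ} (h : a ≤ m + n) :
    A.shuffle m n = ∑ p ∈ antidiagonal m, ∑ q ∈ antidiagonal n,
      if p.1 + q.1 = a then A.shuffle p.1 q.1 * A.cutTail p q else 0 := by
  induction a generalizing m n with
  | zero =>
    simp [Nat.sum_antidiagonal_eq_sum_range_succ_mk, cutTail, ite_and]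
  | succ a ih =>
    have hsplit (p q : ℕ × ℕ) :
        (if p.1 + q.1 = a + 1 then A.shuffle p.1 q.1 * A.cutTail p q else 0) =
          (if p.1 + q.1 = a + 1 then A.shuffleLeft p.1 q.1 * A.cutTail p q else 0) +
          (if p.1 + q.1 = a + 1 then A.shuffleRight p.1 q.1 * A.cutTail p q else 0) := by
      split_ifs with hpq
      · rw [A.shuffle_eq_shuffleLeft_add_shuffleRight (by omega), add_mul]
      · rw [add_zero]
    simp only [hsplit, sum_add_distrib]
    rw [A.shuffle_eq_shuffleLeft_add_shuffleRight (by omega)]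
    congr 1
    · cases m with
      | zero => simp [shuffleLeft]
      | succ m => rw [sum_shuffleLeft_mul_cutTail, ← ih (by omega), shuffleLeft]
    · cases n with
      | zero => simp [shuffleRight]
      | succ n => rw [sum_shuffleRight_mul_cutTail, ← ih (by omega), shuffleRight]

end Cut

lemma shuffle_one_succ (n : ℕ) : A.shuffle 1 (n + 1) = 1 + A.σ (A.shuffle 1 n) * A.s := by
  rw [shuffle_succ_succ, shuffle_zero_left, map_one, swap_one_one]

lemma shuffle_one_add (a b : ℕ) : A.shuffle 1 (a + 1 + b) =
    A.shuffle 1 a + (A.σ ^ (a + 1)) (A.shuffle 1 b) * A.cross (a + 1) := by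
  induction a with
  | zero => rw [zero_add, add_comm, shuffle_one_succ, pow_one, cross_one, shuffle_zero_right]
  | succ a ih =>
    rw [show a + 1 + 1 + b = a + 1 + b + 1 by omega, shuffle_one_succ, ih, shuffle_one_succ,
      map_add, map_mul, add_mul, mul_assoc, ← σ_pow_succ_apply, A.cross_succ (a + 1),
      add_assoc (1 : E)]

theorem symmetrizer_add_eq_mul_unshuffle (a b : ℕ) : A.symmetrizer (a + b) =
    A.symmetrizer a * (A.σ ^ a) (A.symmetrizer b) * A.unshuffle a b := by
  induction a, b using unshuffle.induct with
  | case1 => simp [symmetrizer, unshuffle]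
  | case2 => simp [symmetrizer, unshuffle]
  | case3 a b iha ihb =>
    have hleft : A.shuffle 1 a * A.σ (A.symmetrizer (a + (b + 1))) =
        A.symmetrizer (a + 1) * (A.σ ^ (a + 1)) (A.symmetrizer (b + 1)) *
          A.σ (A.unshuffle a (b + 1)) := by
      rw [iha, A.symmetrizer_succ a, map_mul, map_mul, ← σ_pow_succ_apply]
      simp only [mul_assoc]
    have hcross : A.cross (a + 1) * A.σ (A.symmetrizer (a + 1 + b)) =
        A.symmetrizer (a + 1) * (A.σ ^ (a + 1)) (A.σ (A.symmetrizer b)) *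
          (A.cross (a + 1) * A.σ (A.unshuffle (a + 1) b)) := by
      have h := (A.cross_semiconj (A.symmetrizer_mem_strands (a + 1))).mul_right
        (A.commute_σ_pow_of_mem_strands (A.cross_mem_strands (a + 1)) (A.symmetrizer b))
      rw [ihb, map_mul, map_mul, ← σ_pow_succ_apply, ← mul_assoc, h.eq, σ_pow_succ_apply',
        mul_assoc]
    have hcomm := A.commute_σ_pow_of_mem_strands (A.symmetrizer_mem_strands (a + 1)) (A.shuffle 1 b)
    have hright : (A.σ ^ (a + 1)) (A.shuffle 1 b) *
          (A.cross (a + 1) * A.σ (A.symmetrizer (a + 1 + b))) =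
        A.symmetrizer (a + 1) * (A.σ ^ (a + 1)) (A.symmetrizer (b + 1)) *
          (A.cross (a + 1) * A.σ (A.unshuffle (a + 1) b)) := by
      rw [hcross, A.symmetrizer_succ b, map_mul]
      simp only [← mul_assoc]
      rw [hcomm.eq]
    rw [unshuffle, mul_add, ← hleft, ← hright, show a + 1 + (b + 1) = a + 1 + b + 1 by omega,
      symmetrizer_succ, shuffle_one_add, add_mul, mul_assoc, show a + 1 + b = a + (b + 1) by omega]

theorem symmetrizer_add_eq_shuffle_mul (m n : ℕ) : A.symmetrizer (m + n) =
    A.shuffle m n * (A.symmetrizer m * (A.σ ^ m) (A.symmetrizer n)) := by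
  induction m with
  | zero => simp [symmetrizer]
  | succ m ih =>
    have h := A.shuffle_assoc 1 m n
    rw [pow_one] at h
    rw [show m + 1 + n = m + n + 1 by omega, symmetrizer, ih, map_mul, ← mul_assoc, ← h, map_mul,
      ← σ_pow_succ_apply, symmetrizer, add_comm 1 m]
    simp only [mul_assoc]

lemma swap_semiconj_symmetrizer (m n : ℕ) :
    SemiconjBy (A.swap m n) (A.symmetrizer m * (A.σ ^ m) (A.symmetrizer n))
      (A.symmetrizer n * (A.σ ^ n) (A.symmetrizer m)) := by
  rw [(A.commute_σ_pow_of_mem_strands (A.symmetrizer_mem_strands n) _).eq]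
  exact (A.swap_semiconj_left (A.symmetrizer_mem_strands m) n).mul_right
    (A.swap_semiconj_right (A.symmetrizer_mem_strands n) m)

end BraidShift

/-! ### Operators on the tensor algebra -/

open TensorAlgebra (ι)

namespace QuantumShuffle

variable {k : Type u} {V : Type v} [Field k] [AddCommGroup V] [Module k V]
variable {M : Type*} [AddCommGroup M] [Module k M]

local notation "𝕋" => TensorAlgebra k V

theorem induction_cons {C : 𝕋 → Prop} (one : C 1) (smul : ∀ (a : k) x, C x → C (a • x))
    (add : ∀ x y, C x → C y → C (x + y)) (cons : ∀ v x, C x → C (ι k v * x)) (x : 𝕋) : C x := by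
  suffices ∀ y, C y → C (x * y) by simpa using this 1 one
  induction x using TensorAlgebra.induction with
  | algebraMap r => exact fun y hy => by simpa only [← Algebra.smul_def] using smul r y hy
  | ι v => exact cons v
  | mul a b ha hb => exact fun y hy => by simpa only [mul_assoc] using ha _ (hb _ hy)
  | add a b ha hb => exact fun y hy => by simpa only [add_mul] using add _ _ (ha _ hy) (hb _ hy)

theorem linearMap_ext_cons {f g : 𝕋 →ₗ[k] M} (one : f 1 = g 1)
    (cons : ∀ v x, f (ι k v * x) = g (ι k v * x)) : f = g := by
  ext x
  induction x using induction_cons with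
  | one => exact one
  | smul a x hx => simp only [map_smul, hx]
  | add x y hx hy => simp only [map_add, hx, hy]
  | cons v x _ => exact cons v x

theorem linearMap_ext_cons₂ {f g : 𝕋 →ₗ[k] M} (one : f 1 = g 1)
    (letter : ∀ v, f (ι k v) = g (ι k v))
    (cons : ∀ v w x, f (ι k v * (ι k w * x)) = g (ι k v * (ι k w * x))) : f = g :=
  linearMap_ext_cons one fun v => DFunLike.congr_fun <|
    linearMap_ext_cons (f := f ∘ₗ LinearMap.mulLeft k (ι k v))
      (g := g ∘ₗ LinearMap.mulLeft k (ι k v)) (by simpa using letter v) (cons v)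

theorem linearMap_ext_cons₃ {f g : 𝕋 →ₗ[k] M} (one : f 1 = g 1)
    (letter : ∀ v, f (ι k v) = g (ι k v)) (letters : ∀ v w, f (ι k v * ι k w) = g (ι k v * ι k w))
    (cons : ∀ v w y x, f (ι k v * (ι k w * (ι k y * x))) = g (ι k v * (ι k w * (ι k y * x)))) :
    f = g :=
  linearMap_ext_cons one fun v => DFunLike.congr_fun <|
    linearMap_ext_cons₂ (f := f ∘ₗ LinearMap.mulLeft k (ι k v))
      (g := g ∘ₗ LinearMap.mulLeft k (ι k v)) (by simpa using letter v) (letters v)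
      (cons v)

variable (k V) in
/-- Left multiplication by a vector, as a linear map on `V ⊗ T(V)`. -/
def cons : V ⊗[k] 𝕋 →ₗ[k] 𝕋 := TensorProduct.lift (LinearMap.mul k 𝕋 ∘ₗ ι k)

@[simp] lemma cons_tmul (v : V) (x : 𝕋) : cons k V (v ⊗ₜ x) = ι k v * x := rfl

variable (k V) in
/-- The inverse of the linear isomorphism `k ⊕ V ⊗ T(V) → T(V)`. It is evaluation at `(1, 0)` of
the action of `T(V)` on `k ⊕ V ⊗ T(V)` in which a vector acts by left multiplication. -/
def uncons : 𝕋 →ₗ[k] k × (V ⊗[k] 𝕋) :=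
  LinearMap.applyₗ (R := k) ((1, 0) : k × (V ⊗[k] 𝕋)) ∘ₗ
    (TensorAlgebra.lift k (LinearMap.llcomp k _ _ _ (LinearMap.inr k k (V ⊗[k] 𝕋)) ∘ₗ
      LinearMap.lcomp k (V ⊗[k] 𝕋) ((Algebra.linearMap k 𝕋).coprod (cons k V)) ∘ₗ
      TensorProduct.mk k V 𝕋 : V →ₗ[k] Module.End k (k × (V ⊗[k] 𝕋)))).toLinearMap

lemma uncons_one : uncons k V 1 = (1, 0) := by simp [uncons]

lemma coprod_uncons (x : 𝕋) : (Algebra.linearMap k 𝕋).coprod (cons k V) (uncons k V x) = x := by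
  induction x using induction_cons with
  | one => simp [uncons_one]
  | smul a x hx => rw [map_smul, map_smul, hx]
  | add x y hx hy => rw [map_add, map_add, hx, hy]
  | cons v x hx =>
    have h : uncons k V (ι k v * x) =
        (0, v ⊗ₜ (Algebra.linearMap k 𝕋).coprod (cons k V) (uncons k V x)) := by simp [uncons]
    simp [h, hx]

lemma uncons_cons (v : V) (x : 𝕋) : uncons k V (ι k v * x) = (0, v ⊗ₜ x) := by
  conv_rhs => rw [← coprod_uncons x]
  simp [uncons]

variable (k V) in
/-- Splits off the first letter of a word, killing the scalars. -/
def tail : 𝕋 →ₗ[k] V ⊗[k] 𝕋 := LinearMap.snd k _ _ ∘ₗ uncons k V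

@[simp] lemma tail_one : tail k V 1 = 0 := by simp [tail, uncons_one]

@[simp] lemma tail_cons (v : V) (x : 𝕋) : tail k V (ι k v * x) = v ⊗ₜ x := by
  simp [tail, uncons_cons]

@[simp] lemma tail_ι (v : V) : tail k V (ι k v) = v ⊗ₜ 1 := by rw [← mul_one (ι k v), tail_cons]

variable (k V) in
/-- The degree zero component of a tensor. -/
def augmentation : 𝕋 →ₗ[k] k := LinearMap.fst k _ _ ∘ₗ uncons k V

@[simp] lemma augmentation_one : augmentation k V 1 = 1 := by simp [augmentation, uncons_one]

@[simp] lemma augmentation_cons (v : V) (x : 𝕋) : augmentation k V (ι k v * x) = 0 := by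
  simp [augmentation, uncons_cons]

variable (k V) in
/-- The algebra of linear endomorphisms of the tensor algebra that preserve the scalars. The value
at `1` is unaffected by shifting, and this condition makes the shift multiplicative. -/
def scalarEnd : Subalgebra k (Module.End k 𝕋) where
  carrier := {f | ∃ a : k, f 1 = a • 1}
  mul_mem' := by
    rintro f g ⟨a, ha⟩ ⟨b, hb⟩
    exact ⟨b * a, by rw [Module.End.mul_apply, hb, map_smul, ha, smul_smul]⟩
  add_mem' := by
    rintro f g ⟨a, ha⟩ ⟨b, hb⟩
    exact ⟨a + b, by rw [LinearMap.add_apply, ha, hb, add_smul]⟩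
  algebraMap_mem' r := ⟨r, rfl⟩

@[simp] lemma coe_scalarEnd_apply (f : scalarEnd k V) (x : 𝕋) :
    (f : Module.End k 𝕋) x = f • x := rfl

/-- The operator `1 ↦ f 1`, `v x ↦ v f(x)`. -/
def shiftFun (f : Module.End k 𝕋) : Module.End k 𝕋 :=
  LinearMap.toSpanSingleton k _ (f 1) ∘ₗ augmentation k V +
    cons k V ∘ₗ LinearMap.lTensor V f ∘ₗ tail k V

@[simp] lemma shiftFun_one (f : Module.End k 𝕋) : shiftFun f 1 = f 1 := by simp [shiftFun]

@[simp] lemma shiftFun_cons (f : Module.End k 𝕋) (v : V) (x : 𝕋) :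
    shiftFun f (ι k v * x) = ι k v * f x := by simp [shiftFun]

variable (k V) in
/-- The shift of operators on the tensor algebra by one tensor factor. -/
def shift : scalarEnd k V →+* scalarEnd k V where
  toFun f := ⟨shiftFun f.1, f.2.imp fun a ha => by rw [shiftFun_one, ha]⟩
  map_one' := Subtype.ext <| linearMap_ext_cons (by simp) (by simp)
  map_zero' := Subtype.ext <| linearMap_ext_cons (by simp) (by simp)
  map_add' f g := Subtype.ext <| linearMap_ext_cons (by simp) (by simp [mul_add])
  map_mul' f g := by
    obtain ⟨a, ha⟩ := g.2
    exact Subtype.ext <| linearMap_ext_cons (by simp [ha]) (by simp)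

@[simp] lemma shift_smul_one (f : scalarEnd k V) : shift k V f • (1 : 𝕋) = f • (1 : 𝕋) :=
  shiftFun_one f.1

@[simp] lemma shift_smul_cons (f : scalarEnd k V) (v : V) (x : 𝕋) :
    shift k V f • (ι k v * x) = ι k v * f • x := shiftFun_cons f.1 v x

@[simp] lemma shift_smul_ι (f : scalarEnd k V) (v : V) :
    shift k V f • ι k v = ι k v * f • (1 : 𝕋) := by
  rw [← mul_one (ι k v), shift_smul_cons, mul_one]

/-- A linear endomorphism of `V ⊗ V` acting on the first two letters of a word, killing the words
with fewer letters. -/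
def crossingFun (c : V ⊗[k] V →ₗ[k] V ⊗[k] V) : Module.End k 𝕋 :=
  cons k V ∘ₗ LinearMap.lTensor V (cons k V) ∘ₗ (TensorProduct.assoc k V V _).toLinearMap ∘ₗ
    LinearMap.rTensor _ c ∘ₗ (TensorProduct.assoc k V V _).symm.toLinearMap ∘ₗ
    LinearMap.lTensor V (tail k V) ∘ₗ tail k V

/-- The operator `crossingFun c` as an element of `scalarEnd k V`. -/
def crossing (c : V ⊗[k] V →ₗ[k] V ⊗[k] V) : scalarEnd k V :=
  ⟨crossingFun c, 0, by simp [crossingFun]⟩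

variable (k V) in
/-- The product of two vectors, as a linear map on `V ⊗ V`. -/
def pair : V ⊗[k] V →ₗ[k] 𝕋 := LinearMap.mul' k _ ∘ₗ TensorProduct.map (ι k) (ι k)

variable (k V) in
/-- The product of three vectors, as a linear map on `(V ⊗ V) ⊗ V`. -/
def triple : (V ⊗[k] V) ⊗[k] V →ₗ[k] 𝕋 :=
  LinearMap.mul' k _ ∘ₗ TensorProduct.map (pair k V) (ι k)

@[simp] lemma pair_tmul (v w : V) : pair k V (v ⊗ₜ w) = ι k v * ι k w := rfl

@[simp] lemma triple_tmul (t : V ⊗[k] V) (v : V) : triple k V (t ⊗ₜ v) = pair k V t * ι k v := rfl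

lemma triple_assoc_symm_tmul (v : V) (t : V ⊗[k] V) :
    triple k V ((TensorProduct.assoc k V V V).symm (v ⊗ₜ t)) = ι k v * pair k V t := by
  induction t using TensorProduct.induction_on with
  | zero => simp
  | tmul a b => simp [mul_assoc]
  | add a b ha hb => simp only [TensorProduct.tmul_add, map_add, ha, hb, mul_add]

section Crossing

variable (c : V ⊗[k] V →ₗ[k] V ⊗[k] V)

@[simp] lemma crossing_smul_one : crossing c • (1 : 𝕋) = 0 := by
  simp [Subalgebra.smul_def, crossing, crossingFun]

@[simp] lemma crossing_smul_ι (v : V) : crossing c • ι k v = 0 := by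
  simp [Subalgebra.smul_def, crossing, crossingFun]

lemma cons_lTensor_cons (t : V ⊗[k] V) (x : 𝕋) :
    cons k V (LinearMap.lTensor V (cons k V) (TensorProduct.assoc k V V _ (t ⊗ₜ[k] x))) =
      pair k V t * x := by
  induction t using TensorProduct.induction_on with
  | zero => simp
  | tmul a b => simp [mul_assoc]
  | add a b ha hb => simp only [TensorProduct.add_tmul, map_add, ha, hb, add_mul]

@[simp] lemma crossing_smul_cons_cons (v w : V) (x : 𝕋) :
    crossing c • (ι k v * (ι k w * x)) = pair k V (c (v ⊗ₜ w)) * x := by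
  simp [Subalgebra.smul_def, crossing, crossingFun, cons_lTensor_cons]

@[simp] lemma crossing_smul_pair_mul (t : V ⊗[k] V) (x : 𝕋) :
    crossing c • (pair k V t * x) = pair k V (c t) * x := by
  induction t using TensorProduct.induction_on with
  | zero => simp
  | tmul a b => rw [pair_tmul, mul_assoc, crossing_smul_cons_cons]
  | add a b ha hb => simp only [map_add, add_mul, smul_add, ha, hb]

@[simp] lemma crossing_smul_pair (t : V ⊗[k] V) : crossing c • pair k V t = pair k V (c t) := by
  simpa using crossing_smul_pair_mul c t 1

@[simp] lemma shift_crossing_smul_pair (t : V ⊗[k] V) :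
    shift k V (crossing c) • pair k V t = 0 := by
  induction t using TensorProduct.induction_on with
  | zero => simp
  | tmul a b => simp
  | add a b ha hb => simp only [map_add, smul_add, ha, hb, add_zero]

lemma shift_shift_smul_pair_mul (f : scalarEnd k V) (t : V ⊗[k] V) (x : 𝕋) :
    shift k V (shift k V f) • (pair k V t * x) = pair k V t * f • x := by
  induction t using TensorProduct.induction_on with
  | zero => simp
  | tmul a b => simp [mul_assoc]
  | add a b ha hb => simp only [map_add, smul_add, add_mul, ha, hb]

lemma crossing_smul_triple_mul (t : (V ⊗[k] V) ⊗[k] V) (x : 𝕋) :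
    crossing c • (triple k V t * x) = triple k V (braidLeft c t) * x := by
  induction t using TensorProduct.induction_on with
  | zero => simp
  | tmul a b => simp [braidLeft, mul_assoc]
  | add a b ha hb => simp only [map_add, smul_add, add_mul, ha, hb]

lemma shift_crossing_smul_triple_mul (t : (V ⊗[k] V) ⊗[k] V) (x : 𝕋) :
    shift k V (crossing c) • (triple k V t * x) = triple k V (braidRight c t) * x := by
  obtain ⟨t, rfl⟩ := (TensorProduct.assoc k V V V).symm.surjective t
  induction t using TensorProduct.induction_on with
  | zero => simp
  | tmul v t => simp [braidRight, triple_assoc_symm_tmul, mul_assoc]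
  | add a b ha hb => simp only [map_add, smul_add, add_mul, ha, hb]

end Crossing

lemma crossing_braid (B : Braiding k V) :
    crossing B.c.toLinearMap * shift k V (crossing B.c.toLinearMap) * crossing B.c.toLinearMap =
      shift k V (crossing B.c.toLinearMap) * crossing B.c.toLinearMap *
        shift k V (crossing B.c.toLinearMap) := by
  set s := crossing B.c.toLinearMap with hs
  refine Subtype.ext <| linearMap_ext_cons₃ (by simp [hs]) (by simp [hs]) (fun v w => ?_)
    fun v w y x => ?_
  · simp [hs, ← pair_tmul]
  · have hvwy : ι k v * (ι k w * (ι k y * x)) = triple k V ((v ⊗ₜ w) ⊗ₜ y) * x := by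
      simp [mul_assoc]
    have hbraid := LinearMap.congr_fun B.braid_eq ((v ⊗ₜ w) ⊗ₜ y)
    simp only [LinearMap.comp_apply] at hbraid
    simp only [MulMemClass.coe_mul, Module.End.mul_apply, coe_scalarEnd_apply, hvwy, hs,
      crossing_smul_triple_mul, shift_crossing_smul_triple_mul, hbraid]

lemma crossing_commute_shift_shift (c : V ⊗[k] V →ₗ[k] V ⊗[k] V) (f : scalarEnd k V) :
    Commute (crossing c) (shift k V (shift k V f)) := by
  obtain ⟨a, ha : f • (1 : 𝕋) = a • 1⟩ := f.2
  exact Subtype.ext <| linearMap_ext_cons₂ (by simp [ha]) (by simp [ha])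
    (by simp [shift_shift_smul_pair_mul])

end QuantumShuffle

/-- The operators on the tensor algebra of a braided vector space, with `V ⊗ V ⊗ ⋯` standing for
the strands. -/
def Braiding.braidShift {k : Type u} {V : Type v} [Field k] [AddCommGroup V] [Module k V]
    (B : Braiding k V) : BraidShift (QuantumShuffle.scalarEnd k V) where
  σ := QuantumShuffle.shift k V
  s := QuantumShuffle.crossing B.c.toLinearMap
  braid := QuantumShuffle.crossing_braid B
  comm := QuantumShuffle.crossing_commute_shift_shift B.c.toLinearMap

/-! ### The quantum shuffle algebra -/

namespace QuantumShuffle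

open Finset

variable {k : Type u} {V : Type v} [Field k] [AddCommGroup V] [Module k V]
variable {M : Type*} [AddCommGroup M] [Module k M]

local notation "𝕋" => TensorAlgebra k V

variable (k V) in
/-- The homogeneous elements of degree `n` of the tensor algebra. -/
abbrev homog (n : ℕ) : Submodule k 𝕋 := LinearMap.range (ι k : V →ₗ[k] 𝕋) ^ n

lemma ι_mem_homog (v : V) : ι k v ∈ homog k V 1 := by
  rw [homog, pow_one]
  exact ⟨v, rfl⟩

lemma mul_mem_homog {a b : ℕ} {x y : 𝕋} (hx : x ∈ homog k V a) (hy : y ∈ homog k V b) :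
    x * y ∈ homog k V (a + b) := by
  rw [homog, pow_add]
  exact Submodule.mul_mem_mul hx hy

lemma cons_mem_homog {n : ℕ} {x : 𝕋} (v : V) (hx : x ∈ homog k V n) :
    ι k v * x ∈ homog k V (n + 1) := by
  rw [add_comm]
  exact mul_mem_homog (ι_mem_homog v) hx

lemma mem_homog_zero_iff {x : 𝕋} : x ∈ homog k V 0 ↔ ∃ a : k, x = a • 1 := by
  simp only [homog, pow_zero, Submodule.mem_one, Algebra.algebraMap_eq_smul_one, eq_comm]

lemma one_mem_homog : (1 : 𝕋) ∈ homog k V 0 := mem_homog_zero_iff.2 ⟨1, (one_smul _ _).symm⟩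

lemma homog_add_induction {a b : ℕ} {C : ∀ w : 𝕋, w ∈ homog k V (a + b) → Prop}
    (mul : ∀ x (hx : x ∈ homog k V a) y (hy : y ∈ homog k V b), C (x * y) (mul_mem_homog hx hy))
    (add : ∀ x y hx hy, C x hx → C y hy → C (x + y) (add_mem hx hy)) {w : 𝕋}
    (hw : w ∈ homog k V (a + b)) : C w hw :=
  have hpow : homog k V (a + b) = homog k V a * homog k V b := pow_add _ a b
  Submodule.mul_induction_on' (C := fun w hw => C w (hpow ▸ hw)) mul
    (fun x hx y hy => add x y (hpow ▸ hx) (hpow ▸ hy)) (hpow ▸ hw)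

lemma homog_succ_induction {n : ℕ} {C : ∀ w : 𝕋, w ∈ homog k V (n + 1) → Prop}
    (cons : ∀ v x (hx : x ∈ homog k V n), C (ι k v * x) (cons_mem_homog v hx))
    (add : ∀ x y hx hy, C x hx → C y hy → C (x + y) (add_mem hx hy)) {w : 𝕋}
    (hw : w ∈ homog k V (n + 1)) : C w hw := by
  have hpow : homog k V (n + 1) = LinearMap.range (ι k : V →ₗ[k] 𝕋) * homog k V n :=
    pow_succ' _ n
  refine Submodule.mul_induction_on' (C := fun w hw => C w (hpow ▸ hw)) ?_
    (fun x hx y hy => add x y (hpow ▸ hx) (hpow ▸ hy)) (hpow ▸ hw)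
  rintro _ ⟨v, rfl⟩ x hx
  exact cons v x hx

lemma pair_mem_homog (t : V ⊗[k] V) : pair k V t ∈ homog k V 2 := by
  induction t using TensorProduct.induction_on with
  | zero => simp
  | tmul v w => exact cons_mem_homog v (ι_mem_homog w)
  | add a b ha hb => simpa only [map_add] using add_mem ha hb

lemma exists_pair_eq {x : 𝕋} (hx : x ∈ homog k V 2) : ∃ t, pair k V t = x := by
  induction hx using homog_succ_induction with
  | cons v x hx =>
    rw [homog, pow_one] at hx
    obtain ⟨w, rfl⟩ := hx
    exact ⟨v ⊗ₜ w, rfl⟩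
  | add x y _ _ hx hy =>
    obtain ⟨s, rfl⟩ := hx
    obtain ⟨t, rfl⟩ := hy
    exact ⟨s + t, map_add _ s t⟩

/-- Combines the linear maps `f n` on the homogeneous components into one linear map. -/
def glue (f : ℕ → 𝕋 →ₗ[k] M) : 𝕋 →ₗ[k] M :=
  DirectSum.toModule k ℕ M (fun n => f n ∘ₗ (homog k V n).subtype) ∘ₗ
    (DirectSum.decomposeLinearEquiv (homog k V)).toLinearMap

lemma glue_apply (f : ℕ → 𝕋 →ₗ[k] M) {n : ℕ} {x : 𝕋} (hx : x ∈ homog k V n) :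
    glue f x = f n x := by
  rw [glue, LinearMap.comp_apply, LinearEquiv.coe_coe, DirectSum.decomposeLinearEquiv_apply,
    DirectSum.decompose_of_mem _ hx, ← DirectSum.lof_eq_of k, DirectSum.toModule_lof]
  rfl

lemma linearMap_ext_homog {f g : 𝕋 →ₗ[k] M} (h : ∀ n, ∀ x ∈ homog k V n, f x = g x) : f = g := by
  ext x
  induction x using DirectSum.Decomposition.inductionOn (homog k V) with
  | zero => simp only [map_zero]
  | homogeneous x => exact h _ _ x.2
  | add x y hx hy => rw [map_add, map_add, hx, hy]

lemma linearMap_ext_homog₂ {f g : 𝕋 ⊗[k] 𝕋 →ₗ[k] M}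
    (h : ∀ m, ∀ x ∈ homog k V m, ∀ n, ∀ y ∈ homog k V n, f (x ⊗ₜ y) = g (x ⊗ₜ y)) : f = g :=
  TensorProduct.ext <| linearMap_ext_homog fun m x hx =>
    linearMap_ext_homog fun n y hy => h m x hx n y hy

lemma linearMap_ext_homog₃ {f g : (𝕋 ⊗[k] 𝕋) ⊗[k] 𝕋 →ₗ[k] M}
    (h : ∀ m, ∀ x ∈ homog k V m, ∀ n, ∀ y ∈ homog k V n, ∀ p, ∀ z ∈ homog k V p,
      f ((x ⊗ₜ y) ⊗ₜ z) = g ((x ⊗ₜ y) ⊗ₜ z)) : f = g :=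
  TensorProduct.ext <| linearMap_ext_homog₂ fun m x hx n y hy =>
    linearMap_ext_homog fun p z hz => h m x hx n y hy p z hz

/-- Combines the linear maps `f m n` on the bihomogeneous components into one linear map. -/
def glue₂ (f : ℕ → ℕ → 𝕋 ⊗[k] 𝕋 →ₗ[k] M) : 𝕋 ⊗[k] 𝕋 →ₗ[k] M :=
  TensorProduct.lift <| glue fun m => LinearMap.flip <| glue fun n =>
    LinearMap.flip <| TensorProduct.curry (f m n)

lemma glue₂_tmul (f : ℕ → ℕ → 𝕋 ⊗[k] 𝕋 →ₗ[k] M) {m n : ℕ} {x y : 𝕋} (hx : x ∈ homog k V m)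
    (hy : y ∈ homog k V n) : glue₂ f (x ⊗ₜ y) = f m n (x ⊗ₜ y) := by
  simp [glue₂, glue_apply _ hx, glue_apply _ hy]

variable (k V) in
/-- Cuts a word after the first `a` letters, killing the words with fewer letters. -/
def splitAt : ℕ → (𝕋 →ₗ[k] 𝕋 ⊗[k] 𝕋)
  | 0 => TensorProduct.mk k _ _ 1
  | a + 1 => LinearMap.rTensor _ (cons k V) ∘ₗ (TensorProduct.assoc k V _ _).symm.toLinearMap ∘ₗ
      LinearMap.lTensor V (splitAt a) ∘ₗ tail k V

lemma splitAt_mul {a : ℕ} {x : 𝕋} (hx : x ∈ homog k V a) (y : 𝕋) :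
    splitAt k V a (x * y) = x ⊗ₜ y := by
  induction a generalizing x with
  | zero =>
    obtain ⟨r, rfl⟩ := mem_homog_zero_iff.1 hx
    simp [splitAt, TensorProduct.smul_tmul]
  | succ a ih =>
    induction hx using homog_succ_induction with
    | cons v x hx => simp [splitAt, mul_assoc, ih hx]
    | add x y _ _ hx hy => rw [add_mul, map_add, hx, hy, TensorProduct.add_tmul]

lemma splitAt_zero (x : 𝕋) : splitAt k V 0 x = 1 ⊗ₜ x := rfl

lemma splitAt_self {a : ℕ} {x : 𝕋} (hx : x ∈ homog k V a) : splitAt k V a x = x ⊗ₜ 1 := by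
  rw [← mul_one x, splitAt_mul hx, mul_one]

lemma mul'_splitAt {a N : ℕ} {w : 𝕋} (hw : w ∈ homog k V N) (h : a ≤ N) :
    LinearMap.mul' k _ (splitAt k V a w) = w := by
  obtain ⟨b, rfl⟩ := Nat.exists_eq_add_of_le h
  induction hw using homog_add_induction with
  | mul x hx y _ => rw [splitAt_mul hx, LinearMap.mul'_apply]
  | add x y _ _ hx hy => rw [map_add, map_add, hx, hy]

lemma glue₂_splitAt (f : ℕ → ℕ → 𝕋 ⊗[k] 𝕋 →ₗ[k] M) {a b N : ℕ} {w : 𝕋}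
    (hw : w ∈ homog k V N) (h : a + b = N) :
    glue₂ f (splitAt k V a w) = f a b (splitAt k V a w) := by
  subst h
  induction hw using homog_add_induction with
  | mul x hx y hy => rw [splitAt_mul hx, glue₂_tmul f hx hy]
  | add x y _ _ hx hy => simp only [map_add, hx, hy]

variable (k V) in
/-- Cuts a word after the first `a` and after the next `b` letters. -/
def splitAt₃ (a b : ℕ) : 𝕋 →ₗ[k] (𝕋 ⊗[k] 𝕋) ⊗[k] 𝕋 :=
  LinearMap.rTensor _ (splitAt k V a) ∘ₗ splitAt k V (a + b)

lemma splitAt₃_mul_right {a b : ℕ} {w : 𝕋} (hw : w ∈ homog k V (a + b)) (z : 𝕋) :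
    splitAt₃ k V a b (w * z) = splitAt k V a w ⊗ₜ z := by
  rw [splitAt₃, LinearMap.comp_apply, splitAt_mul hw, LinearMap.rTensor_tmul]

lemma splitAt₃_mul {a b : ℕ} {x y : 𝕋} (hx : x ∈ homog k V a) (hy : y ∈ homog k V b) (z : 𝕋) :
    splitAt₃ k V a b (x * y * z) = (x ⊗ₜ y) ⊗ₜ z := by
  rw [splitAt₃_mul_right (mul_mem_homog hx hy), splitAt_mul hx]

lemma splitAt₃_mul_left {a b d : ℕ} {x w : 𝕋} (hx : x ∈ homog k V a)
    (hw : w ∈ homog k V (b + d)) :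
    splitAt₃ k V a b (x * w) = (TensorProduct.assoc k _ _ _).symm (x ⊗ₜ splitAt k V b w) := by
  induction hw using homog_add_induction with
  | mul y hy z hz =>
    rw [← mul_assoc, splitAt₃_mul hx hy, splitAt_mul hy, TensorProduct.assoc_symm_tmul]
  | add y z _ _ hy hz => simp only [mul_add, map_add, TensorProduct.tmul_add, hy, hz]

variable (k V) in
/-- The operators that act on the first `n` letters of a word only. -/
def localEnd (n : ℕ) : Subring (scalarEnd k V) where
  carrier := {f | ∀ x ∈ homog k V n, f • x ∈ homog k V n ∧ ∀ y, f • (x * y) = f • x * y}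
  zero_mem' x _ := by simp only [zero_smul, zero_mem, zero_mul, implies_true, and_self]
  one_mem' x hx := by simp only [one_smul, hx, implies_true, and_self]
  add_mem' hf hg x hx := ⟨by rw [add_smul]; exact add_mem (hf x hx).1 (hg x hx).1, fun y => by
    rw [add_smul, add_smul, (hf x hx).2, (hg x hx).2, add_mul]⟩
  neg_mem' hf x hx := ⟨by rw [neg_smul]; exact neg_mem (hf x hx).1, fun y => by
    rw [neg_smul, neg_smul, (hf x hx).2, neg_mul]⟩
  mul_mem' hf hg x hx := ⟨by rw [mul_smul]; exact (hf _ (hg x hx).1).1, fun y => by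
    rw [mul_smul, mul_smul, (hg x hx).2, (hf _ (hg x hx).1).2]⟩

lemma localEnd_mono {n N : ℕ} (h : n ≤ N) : localEnd k V n ≤ localEnd k V N := by
  obtain ⟨r, rfl⟩ := Nat.exists_eq_add_of_le h
  intro f hf w hw
  induction hw using homog_add_induction with
  | mul x hx y hy =>
    obtain ⟨hmem, hmul⟩ := hf x hx
    exact ⟨hmul y ▸ mul_mem_homog hmem hy, fun z => by rw [mul_assoc, hmul, hmul, mul_assoc]⟩
  | add x y _ _ hx hy =>
    exact ⟨by simpa only [smul_add] using add_mem hx.1 hy.1, fun z => by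
      rw [add_mul, smul_add, hx.2, hy.2, smul_add, add_mul]⟩

lemma crossing_mem_localEnd (c : V ⊗[k] V →ₗ[k] V ⊗[k] V) : crossing c ∈ localEnd k V 2 := by
  intro x hx
  obtain ⟨t, rfl⟩ := exists_pair_eq hx
  exact ⟨by simpa only [crossing_smul_pair] using pair_mem_homog (c t), by simp⟩

lemma shift_pow_smul_mul {a : ℕ} {x : 𝕋} (hx : x ∈ homog k V a) (f : scalarEnd k V) (y : 𝕋) :
    (shift k V ^ a) f • (x * y) = x * f • y := by
  induction a generalizing x with
  | zero =>
    obtain ⟨r, rfl⟩ := mem_homog_zero_iff.1 hx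
    simpa using smul_comm f r y
  | succ a ih =>
    rw [pow_succ', RingHom.mul_def, RingHom.comp_apply]
    induction hx using homog_succ_induction with
    | cons v x hx => rw [mul_assoc, shift_smul_cons, ih hx, mul_assoc]
    | add x y _ _ hx hy => rw [add_mul, smul_add, hx, hy, add_mul]

lemma shift_pow_mem_localEnd {n : ℕ} {f : scalarEnd k V} (hf : f ∈ localEnd k V n) (i : ℕ) :
    (shift k V ^ i) f ∈ localEnd k V (i + n) := by
  intro w hw
  induction hw using homog_add_induction with
  | mul x hx y hy =>
    simp only [mul_assoc, shift_pow_smul_mul hx, (hf y hy).2, implies_true, and_true]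
    exact mul_mem_homog hx (hf y hy).1
  | add x y _ _ hx hy =>
    exact ⟨by simpa only [smul_add] using add_mem hx.1 hy.1, fun z => by
      rw [add_mul, smul_add, hx.2, hy.2, smul_add, add_mul]⟩

variable (k V) in
/-- The deconcatenation coproduct. -/
def deconcat : 𝕋 →ₗ[k] 𝕋 ⊗[k] 𝕋 := glue fun n => ∑ p ∈ antidiagonal n, splitAt k V p.1

lemma deconcat_apply {n : ℕ} {x : 𝕋} (hx : x ∈ homog k V n) :
    deconcat k V x = ∑ p ∈ antidiagonal n, splitAt k V p.1 x := by
  rw [deconcat, glue_apply _ hx, LinearMap.sum_apply]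

end QuantumShuffle

namespace Braiding

open QuantumShuffle

variable {k : Type u} {V : Type v} [Field k] [AddCommGroup V] [Module k V] (B : Braiding k V)

local notation "𝕋" => TensorAlgebra k V

lemma strands_le_localEnd (n : ℕ) : B.braidShift.strands n ≤ localEnd k V n := by
  refine Subring.closure_le.2 ?_
  rintro _ ⟨i, hi, rfl⟩
  exact localEnd_mono hi (shift_pow_mem_localEnd (crossing_mem_localEnd _) i)

lemma σ_pow_smul_mul {a : ℕ} {x : 𝕋} (hx : x ∈ homog k V a) (f : scalarEnd k V) (y : 𝕋) :
    (B.braidShift.σ ^ a) f • (x * y) = x * f • y := shift_pow_smul_mul hx f y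

lemma strands_smul_mul {n : ℕ} {f : scalarEnd k V} (hf : f ∈ B.braidShift.strands n) {x : 𝕋}
    (hx : x ∈ homog k V n) (y : 𝕋) : f • (x * y) = f • x * y :=
  (B.strands_le_localEnd n hf x hx).2 y

lemma strands_smul_mem {n N : ℕ} {f : scalarEnd k V} (hf : f ∈ B.braidShift.strands n)
    (h : n ≤ N) {x : 𝕋} (hx : x ∈ homog k V N) : f • x ∈ homog k V N :=
  (B.strands_le_localEnd N (B.braidShift.strands_mono h hf) x hx).1

/-- The braiding of the tensor algebra, as a linear map. -/
def tensorSwap : 𝕋 ⊗[k] 𝕋 →ₗ[k] 𝕋 ⊗[k] 𝕋 :=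
  glue₂ fun m n => splitAt k V n ∘ₗ (B.braidShift.swap m n).1 ∘ₗ LinearMap.mul' k _

/-- The quantum shuffle product. -/
def shuffleMul : 𝕋 ⊗[k] 𝕋 →ₗ[k] 𝕋 :=
  glue₂ fun m n => (B.braidShift.shuffle m n).1 ∘ₗ LinearMap.mul' k _

variable {a b d N : ℕ} {w : TensorAlgebra k V}

lemma tensorSwap_splitAt (hw : w ∈ homog k V N) (h : a + b = N) :
    B.tensorSwap (splitAt k V a w) = splitAt k V b (B.braidShift.swap a b • w) := by
  rw [tensorSwap, glue₂_splitAt _ hw h, LinearMap.comp_apply, LinearMap.comp_apply,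
    mul'_splitAt hw (Nat.le.intro h), coe_scalarEnd_apply]

lemma shuffleMul_splitAt (hw : w ∈ homog k V N) (h : a + b = N) :
    B.shuffleMul (splitAt k V a w) = B.braidShift.shuffle a b • w := by
  rw [shuffleMul, glue₂_splitAt _ hw h, LinearMap.comp_apply, mul'_splitAt hw (Nat.le.intro h),
    coe_scalarEnd_apply]

lemma braidLeft_splitAt₃ (hw : w ∈ homog k V N) (h : a + b ≤ N) :
    braidLeft B.tensorSwap (splitAt₃ k V a b w) =
      splitAt₃ k V b a (B.braidShift.swap a b • w) := by
  obtain ⟨d, rfl⟩ := Nat.exists_eq_add_of_le h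
  have hs := B.braidShift.swap_mem_strands a b
  induction hw using homog_add_induction with
  | mul x hx y _ =>
    have hswap : B.braidShift.swap a b • x ∈ homog k V (b + a) :=
      add_comm a b ▸ B.strands_smul_mem hs le_rfl hx
    rw [splitAt₃_mul_right hx, B.strands_smul_mul hs hx, splitAt₃_mul_right hswap, braidLeft,
      LinearMap.rTensor_tmul, B.tensorSwap_splitAt hx rfl]
  | add x y _ _ hx hy => simp only [map_add, smul_add, hx, hy]

lemma braidRight_splitAt₃ (hw : w ∈ homog k V N) (h : a + b + d = N) :
    braidRight B.tensorSwap (splitAt₃ k V a b w) =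
      splitAt₃ k V a d ((B.braidShift.σ ^ a) (B.braidShift.swap b d) • w) := by
  subst h
  rw [add_assoc] at hw
  induction hw using homog_add_induction with
  | mul x hx y hy =>
    have hswap : B.braidShift.swap b d • y ∈ homog k V (d + b) :=
      add_comm b d ▸ B.strands_smul_mem (B.braidShift.swap_mem_strands b d) le_rfl hy
    rw [splitAt₃_mul_left hx hy, B.σ_pow_smul_mul hx, splitAt₃_mul_left hx hswap]
    simp [braidRight, B.tensorSwap_splitAt hy rfl]
  | add x y _ _ hx hy => simp only [map_add, smul_add, hx, hy]

lemma rTensor_shuffleMul_splitAt₃ (hw : w ∈ homog k V N) (h : a + b ≤ N) :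
    LinearMap.rTensor _ B.shuffleMul (splitAt₃ k V a b w) =
      splitAt k V (a + b) (B.braidShift.shuffle a b • w) := by
  obtain ⟨d, rfl⟩ := Nat.exists_eq_add_of_le h
  have hs := B.braidShift.shuffle_mem_strands a b
  induction hw using homog_add_induction with
  | mul x hx y _ =>
    rw [splitAt₃_mul_right hx, B.strands_smul_mul hs hx,
      splitAt_mul (B.strands_smul_mem hs le_rfl hx), LinearMap.rTensor_tmul,
      B.shuffleMul_splitAt hx rfl]
  | add x y _ _ hx hy => simp only [map_add, smul_add, hx, hy]

lemma lTensor_shuffleMul_splitAt₃ (hw : w ∈ homog k V N) (h : a + b + d = N) :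
    LinearMap.lTensor _ B.shuffleMul (TensorProduct.assoc k _ _ _ (splitAt₃ k V a b w)) =
      splitAt k V a ((B.braidShift.σ ^ a) (B.braidShift.shuffle b d) • w) := by
  subst h
  rw [add_assoc] at hw
  induction hw using homog_add_induction with
  | mul x hx y hy =>
    rw [splitAt₃_mul_left hx hy, B.σ_pow_smul_mul hx, splitAt_mul hx, LinearEquiv.apply_symm_apply,
      LinearMap.lTensor_tmul, B.shuffleMul_splitAt hy rfl]
  | add x y _ _ hx hy => simp only [map_add, smul_add, hx, hy]

end Braiding

namespace QuantumShuffle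

open Finset

variable {k : Type u} {V : Type v} [Field k] [AddCommGroup V] [Module k V]

local notation "𝕋" => TensorAlgebra k V

variable {a b n N : ℕ} {w : TensorAlgebra k V}

lemma augmentation_of_pos (hn : n ≠ 0) (hw : w ∈ homog k V n) : augmentation k V w = 0 := by
  obtain ⟨n, rfl⟩ := Nat.exists_eq_succ_of_ne_zero hn
  induction hw using homog_succ_induction with
  | cons v x _ => exact augmentation_cons v x
  | add x y _ _ hx hy => rw [map_add, hx, hy, add_zero]

lemma rTensor_augmentation_splitAt (hw : w ∈ homog k V N) (h : a ≤ N) (ha : a ≠ 0) :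
    LinearMap.rTensor _ (augmentation k V) (splitAt k V a w) = 0 := by
  obtain ⟨b, rfl⟩ := Nat.exists_eq_add_of_le h
  induction hw using homog_add_induction with
  | mul x hx y _ =>
    rw [splitAt_mul hx, LinearMap.rTensor_tmul, augmentation_of_pos ha hx, TensorProduct.zero_tmul]
  | add x y _ _ hx hy => rw [map_add, map_add, hx, hy, add_zero]

lemma lTensor_augmentation_splitAt (hw : w ∈ homog k V N) (h : a < N) :
    LinearMap.lTensor _ (augmentation k V) (splitAt k V a w) = 0 := by
  obtain ⟨b, rfl⟩ := Nat.exists_eq_add_of_le h.le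
  induction hw using homog_add_induction with
  | mul x hx y hy =>
    rw [splitAt_mul hx, LinearMap.lTensor_tmul, augmentation_of_pos (by omega) hy,
      TensorProduct.tmul_zero]
  | add x y _ _ hx hy => rw [map_add, map_add, hx, hy, add_zero]

lemma rTensor_deconcat_splitAt (hw : w ∈ homog k V N) (h : a ≤ N) :
    LinearMap.rTensor _ (deconcat k V) (splitAt k V a w) =
      ∑ p ∈ antidiagonal a, splitAt₃ k V p.1 p.2 w := by
  obtain ⟨b, rfl⟩ := Nat.exists_eq_add_of_le h
  induction hw using homog_add_induction with
  | mul x hx y _ =>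
    rw [splitAt_mul hx, LinearMap.rTensor_tmul, deconcat_apply hx, TensorProduct.sum_tmul]
    refine sum_congr rfl fun p hp => ?_
    rw [splitAt₃_mul_right (mem_antidiagonal.1 hp ▸ hx)]
  | add x y _ _ hx hy => simp only [map_add, hx, hy, sum_add_distrib]

lemma lTensor_deconcat_splitAt (hw : w ∈ homog k V N) (h : a + b = N) :
    LinearMap.lTensor _ (deconcat k V) (splitAt k V a w) =
      ∑ p ∈ antidiagonal b, TensorProduct.assoc k _ _ _ (splitAt₃ k V a p.1 w) := by
  subst h
  induction hw using homog_add_induction with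
  | mul x hx y hy =>
    rw [splitAt_mul hx, LinearMap.lTensor_tmul, deconcat_apply hy, TensorProduct.tmul_sum]
    refine sum_congr rfl fun p hp => ?_
    rw [splitAt₃_mul_left hx (mem_antidiagonal.1 hp ▸ hy), LinearEquiv.apply_symm_apply]
  | add x y _ _ hx hy => simp only [map_add, hx, hy, sum_add_distrib]

lemma deconcat_coassoc :
    (TensorProduct.assoc k _ _ _).toLinearMap ∘ₗ LinearMap.rTensor _ (deconcat k V) ∘ₗ
      deconcat k V = LinearMap.lTensor _ (deconcat k V) ∘ₗ deconcat k V := by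
  refine linearMap_ext_homog fun n w hw => ?_
  calc TensorProduct.assoc k _ _ _ (LinearMap.rTensor _ (deconcat k V) (deconcat k V w))
      = ∑ p ∈ antidiagonal n, ∑ q ∈ antidiagonal p.1,
          TensorProduct.assoc k _ _ _ (splitAt₃ k V q.1 q.2 w) := by
        simp only [deconcat_apply hw, map_sum]
        refine sum_congr rfl fun p hp => ?_
        rw [rTensor_deconcat_splitAt hw (Nat.le.intro (mem_antidiagonal.1 hp)), map_sum]
    _ = ∑ p ∈ antidiagonal n, ∑ q ∈ antidiagonal p.2,
          TensorProduct.assoc k _ _ _ (splitAt₃ k V p.1 q.1 w) := by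
        rw [sum_sigma', sum_sigma']
        refine sum_nbij' (fun x => ⟨(x.2.1, x.2.2 + x.1.2), (x.2.2, x.1.2)⟩)
          (fun x => ⟨(x.1.1 + x.2.1, x.2.2), (x.1.1, x.2.1)⟩) ?_ ?_ ?_ ?_ ?_ <;>
        grind [HasAntidiagonal.mem_antidiagonal]
    _ = LinearMap.lTensor _ (deconcat k V) (deconcat k V w) := by
        simp only [deconcat_apply hw, map_sum]
        exact sum_congr rfl fun p hp => (lTensor_deconcat_splitAt hw (mem_antidiagonal.1 hp)).symm

lemma rTensor_augmentation_comp_deconcat :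
    LinearMap.rTensor _ (augmentation k V) ∘ₗ deconcat k V = TensorProduct.mk k _ _ 1 := by
  refine linearMap_ext_homog fun n w hw => ?_
  rw [LinearMap.comp_apply, deconcat_apply hw, map_sum, sum_eq_single (0, n)]
  · rw [splitAt_zero, LinearMap.rTensor_tmul, augmentation_one, TensorProduct.mk_apply]
  · rintro ⟨a, b⟩ hp hne
    refine rTensor_augmentation_splitAt hw (Nat.le.intro (mem_antidiagonal.1 hp)) ?_
    rintro rfl
    exact hne (by rw [← mem_antidiagonal.1 hp, zero_add])
  · simp

lemma lTensor_augmentation_comp_deconcat :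
    LinearMap.lTensor _ (augmentation k V) ∘ₗ deconcat k V = (TensorProduct.mk k _ _).flip 1 := by
  refine linearMap_ext_homog fun n w hw => ?_
  rw [LinearMap.comp_apply, deconcat_apply hw, map_sum, sum_eq_single (n, 0)]
  · rw [splitAt_self hw, LinearMap.lTensor_tmul, augmentation_one, LinearMap.flip_apply,
      TensorProduct.mk_apply]
  · rintro ⟨a, b⟩ hp hne
    refine lTensor_augmentation_splitAt hw ((Nat.le.intro (mem_antidiagonal.1 hp)).lt_of_ne ?_)
    rintro rfl
    exact hne (by simpa using mem_antidiagonal.1 hp)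
  · simp

lemma deconcat_one : deconcat k V 1 = 1 ⊗ₜ 1 := by
  rw [deconcat_apply one_mem_homog, Nat.antidiagonal_zero, sum_singleton, splitAt_zero]

variable (k V) in
/-- The operators that restrict to an automorphism of the homogeneous component of degree `n`. -/
def invertibleOn (n : ℕ) : Submonoid (scalarEnd k V) where
  carrier := {f | ∃ g : scalarEnd k V, ∀ x ∈ homog k V n,
    f • x ∈ homog k V n ∧ g • x ∈ homog k V n ∧ g • f • x = x ∧ f • g • x = x}
  one_mem' := ⟨1, fun x hx => by simp only [one_smul, hx, and_self]⟩
  mul_mem' := by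
    rintro f g ⟨f', hf⟩ ⟨g', hg⟩
    refine ⟨g' * f', fun x hx => ?_⟩
    obtain ⟨hgx, -, hg'gx, -⟩ := hg x hx
    obtain ⟨-, hf'x, -, hff'x⟩ := hf x hx
    simp only [mul_smul]
    exact ⟨(hf _ hgx).1, (hg _ hf'x).2.1, by rw [(hf _ hgx).2.2.1, hg'gx],
      by rw [(hg _ hf'x).2.2.2, hff'x]⟩

lemma shift_mem_invertibleOn {f : scalarEnd k V} (hf : f ∈ invertibleOn k V n) :
    shift k V f ∈ invertibleOn k V (n + 1) := by
  obtain ⟨g, hg⟩ := hf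
  refine ⟨shift k V g, fun x hx => ?_⟩
  induction hx using homog_succ_induction with
  | cons v x hx =>
    obtain ⟨hfx, hgx, hgfx, hfgx⟩ := hg x hx
    simp only [shift_smul_cons, hgfx, hfgx, and_true]
    exact ⟨cons_mem_homog v hfx, cons_mem_homog v hgx⟩
  | add x y _ _ hx hy =>
    simp only [smul_add, hx.2.2, hy.2.2, and_true]
    exact ⟨add_mem hx.1 hy.1, add_mem hx.2.1 hy.2.1⟩

lemma crossing_mem_invertibleOn (c : V ⊗[k] V ≃ₗ[k] V ⊗[k] V) :
    crossing c.toLinearMap ∈ invertibleOn k V (2 + n) := by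
  refine ⟨crossing c.symm.toLinearMap, fun x hx => ?_⟩
  induction hx using homog_add_induction with
  | mul x hx y hy =>
    obtain ⟨t, rfl⟩ := exists_pair_eq hx
    simp only [crossing_smul_pair_mul, LinearEquiv.coe_coe, LinearEquiv.symm_apply_apply,
      LinearEquiv.apply_symm_apply, and_true]
    exact ⟨mul_mem_homog (pair_mem_homog _) hy, mul_mem_homog (pair_mem_homog _) hy⟩
  | add x y _ _ hx hy =>
    simp only [smul_add, hx.2.2, hy.2.2, and_true]
    exact ⟨add_mem hx.1 hy.1, add_mem hx.2.1 hy.2.1⟩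

end QuantumShuffle

namespace Braiding

open QuantumShuffle Finset

variable {k : Type u} {V : Type v} [Field k] [AddCommGroup V] [Module k V] (B : Braiding k V)

local notation "𝕋" => TensorAlgebra k V

lemma cross_mem_invertibleOn {n N : ℕ} (h : n < N) :
    B.braidShift.cross n ∈ invertibleOn k V N := by
  induction n generalizing N with
  | zero => exact one_mem _
  | succ n ih =>
    obtain ⟨N, rfl⟩ := Nat.exists_eq_add_of_le h
    refine mul_mem ?_ ?_
    · rw [show n + 1 + 1 + N = n + 1 + N + 1 by omega]
      exact shift_mem_invertibleOn (ih (by omega))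
    · rw [show n + 1 + 1 + N = 2 + (n + N) by omega]
      exact crossing_mem_invertibleOn B.c

lemma swap_mem_invertibleOn (m n : ℕ) : B.braidShift.swap m n ∈ invertibleOn k V (m + n) := by
  induction m with
  | zero => exact one_mem _
  | succ m ih =>
    refine mul_mem (B.cross_mem_invertibleOn (by omega)) ?_
    rw [add_right_comm]
    exact shift_mem_invertibleOn ih

lemma tensorSwap_bijective : Function.Bijective B.tensorSwap := by
  choose g hg using B.swap_mem_invertibleOn
  let inv : 𝕋 ⊗[k] 𝕋 →ₗ[k] 𝕋 ⊗[k] 𝕋 :=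
    glue₂ fun n m => splitAt k V m ∘ₗ (g m n).1 ∘ₗ LinearMap.mul' k _
  have inv_splitAt {a b : ℕ} {w : 𝕋} (hw : w ∈ homog k V (b + a)) :
      inv (splitAt k V a w) = splitAt k V b (g b a • w) := by
    have hab := add_comm a b
    rw [glue₂_splitAt _ hw hab, LinearMap.comp_apply, LinearMap.comp_apply,
      mul'_splitAt hw (Nat.le.intro hab), coe_scalarEnd_apply]
  have left_inv : inv ∘ₗ B.tensorSwap = LinearMap.id := by
    refine linearMap_ext_homog₂ fun m x hx n y hy => ?_
    obtain ⟨hmem, -, hinv, -⟩ := hg m n _ (mul_mem_homog hx hy)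
    rw [LinearMap.comp_apply, ← splitAt_mul hx, B.tensorSwap_splitAt (mul_mem_homog hx hy) rfl,
      inv_splitAt hmem, hinv, LinearMap.id_apply]
  have right_inv : B.tensorSwap ∘ₗ inv = LinearMap.id := by
    refine linearMap_ext_homog₂ fun m x hx n y hy => ?_
    have hw : x * y ∈ homog k V (n + m) := add_comm m n ▸ mul_mem_homog hx hy
    obtain ⟨-, hmem, -, hinv⟩ := hg n m _ hw
    rw [LinearMap.comp_apply, ← splitAt_mul hx, inv_splitAt hw, B.tensorSwap_splitAt hmem rfl,
      hinv, LinearMap.id_apply]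
  exact ⟨Function.LeftInverse.injective (LinearMap.congr_fun left_inv),
    Function.RightInverse.surjective (LinearMap.congr_fun right_inv)⟩

section

variable {m n p N : ℕ} {w : TensorAlgebra k V}

lemma σ_pow_swap_smul_mem (hw : w ∈ homog k V N) (h : m + (n + p) ≤ N) :
    (B.braidShift.σ ^ m) (B.braidShift.swap n p) • w ∈ homog k V N :=
  B.strands_smul_mem (B.braidShift.σ_pow_mem_strands (B.braidShift.swap_mem_strands n p) m) h hw

lemma swap_smul_mem (hw : w ∈ homog k V N) (h : m + n ≤ N) :
    B.braidShift.swap m n • w ∈ homog k V N :=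
  B.strands_smul_mem (B.braidShift.swap_mem_strands m n) h hw

lemma shuffle_smul_mem (hw : w ∈ homog k V N) (h : m + n ≤ N) :
    B.braidShift.shuffle m n • w ∈ homog k V N :=
  B.strands_smul_mem (B.braidShift.shuffle_mem_strands m n) h hw

lemma σ_pow_shuffle_smul_mem (hw : w ∈ homog k V N) (h : m + (n + p) ≤ N) :
    (B.braidShift.σ ^ m) (B.braidShift.shuffle n p) • w ∈ homog k V N :=
  B.strands_smul_mem (B.braidShift.σ_pow_mem_strands (B.braidShift.shuffle_mem_strands n p) m) h hw

lemma braidLeft_braidRight_splitAt₃ (hw : w ∈ homog k V N) (h : m + n + p = N) :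
    braidLeft B.tensorSwap (braidRight B.tensorSwap (splitAt₃ k V m n w)) =
      splitAt₃ k V p m (B.braidShift.swap (m + n) p • w) := by
  rw [B.braidRight_splitAt₃ hw h,
    B.braidLeft_splitAt₃ (B.σ_pow_swap_smul_mem hw (by omega)) (by omega), smul_smul,
    BraidShift.swap_add_left]

lemma braidRight_braidLeft_splitAt₃ (hw : w ∈ homog k V N) (h : m + n + p = N) :
    braidRight B.tensorSwap (braidLeft B.tensorSwap (splitAt₃ k V m n w)) =
      splitAt₃ k V n p (B.braidShift.swap m (n + p) • w) := by
  rw [B.braidLeft_splitAt₃ hw (by omega),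
    B.braidRight_splitAt₃ (d := p) (B.swap_smul_mem hw (by omega)) (by omega), smul_smul,
    BraidShift.swap_add_right]

end

lemma tensorSwap_braid :
    braidLeft B.tensorSwap ∘ₗ braidRight B.tensorSwap ∘ₗ braidLeft B.tensorSwap =
      braidRight B.tensorSwap ∘ₗ braidLeft B.tensorSwap ∘ₗ braidRight B.tensorSwap := by
  refine linearMap_ext_homog₃ (M := (𝕋 ⊗[k] 𝕋) ⊗[k] 𝕋) fun m x hx n y hy p z hz => ?_
  have hw := mul_mem_homog (mul_mem_homog hx hy) hz
  simp only [LinearMap.comp_apply]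
  rw [← splitAt₃_mul hx hy, B.braidLeft_splitAt₃ hw (by omega),
    B.braidLeft_braidRight_splitAt₃ (p := p) (B.swap_smul_mem hw (by omega)) (by omega),
    B.braidLeft_braidRight_splitAt₃ hw rfl,
    B.braidRight_splitAt₃ (d := n) (B.swap_smul_mem hw le_rfl) (by omega), smul_smul, smul_smul,
    add_comm n m, (B.braidShift.swap_semiconj_left (B.braidShift.swap_mem_strands m n) p).eq]

lemma tensorSwap_mul_left : B.tensorSwap ∘ₗ LinearMap.rTensor _ B.shuffleMul =
    LinearMap.lTensor _ B.shuffleMul ∘ₗ (TensorProduct.assoc k _ _ _).toLinearMap ∘ₗ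
      braidLeft B.tensorSwap ∘ₗ braidRight B.tensorSwap := by
  refine linearMap_ext_homog₃ fun m x hx n y hy p z hz => ?_
  have hw := mul_mem_homog (mul_mem_homog hx hy) hz
  simp only [LinearMap.comp_apply, LinearEquiv.coe_coe]
  rw [← splitAt₃_mul hx hy, B.rTensor_shuffleMul_splitAt₃ hw (by omega),
    B.tensorSwap_splitAt (B.shuffle_smul_mem hw (by omega)) rfl,
    B.braidLeft_braidRight_splitAt₃ hw rfl,
    B.lTensor_shuffleMul_splitAt₃ (d := n) (B.swap_smul_mem hw le_rfl) (by omega), smul_smul,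
    smul_smul, (B.braidShift.swap_semiconj_left (B.braidShift.shuffle_mem_strands m n) p).eq]

lemma tensorSwap_mul_right :
    B.tensorSwap ∘ₗ LinearMap.lTensor _ B.shuffleMul ∘ₗ (TensorProduct.assoc k _ _ _).toLinearMap =
    LinearMap.rTensor _ B.shuffleMul ∘ₗ braidRight B.tensorSwap ∘ₗ braidLeft B.tensorSwap := by
  refine linearMap_ext_homog₃ fun m x hx n y hy p z hz => ?_
  have hw := mul_mem_homog (mul_mem_homog hx hy) hz
  simp only [LinearMap.comp_apply, LinearEquiv.coe_coe]
  rw [← splitAt₃_mul hx hy, B.lTensor_shuffleMul_splitAt₃ hw rfl,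
    B.tensorSwap_splitAt (b := n + p) (B.σ_pow_shuffle_smul_mem hw (by omega)) (by omega),
    B.braidRight_braidLeft_splitAt₃ hw rfl,
    B.rTensor_shuffleMul_splitAt₃ (B.swap_smul_mem hw (by omega)) (by omega), smul_smul,
    smul_smul, (B.braidShift.swap_semiconj_right (B.braidShift.shuffle_mem_strands n p) m).eq]

lemma shuffleMul_assoc : B.shuffleMul ∘ₗ LinearMap.rTensor _ B.shuffleMul =
    B.shuffleMul ∘ₗ LinearMap.lTensor _ B.shuffleMul ∘ₗ
      (TensorProduct.assoc k _ _ _).toLinearMap := by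
  refine linearMap_ext_homog₃ fun m x hx n y hy p z hz => ?_
  have hw := mul_mem_homog (mul_mem_homog hx hy) hz
  simp only [LinearMap.comp_apply, LinearEquiv.coe_coe]
  rw [← splitAt₃_mul hx hy, B.rTensor_shuffleMul_splitAt₃ hw (by omega),
    B.shuffleMul_splitAt (B.shuffle_smul_mem hw (by omega)) rfl,
    B.lTensor_shuffleMul_splitAt₃ hw rfl,
    B.shuffleMul_splitAt (b := n + p) (B.σ_pow_shuffle_smul_mem hw (by omega)) (by omega),
    smul_smul, smul_smul, BraidShift.shuffle_assoc]

lemma shuffleMul_one_left (x : 𝕋) : B.shuffleMul (1 ⊗ₜ x) = x := by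
  refine LinearMap.congr_fun (f := B.shuffleMul ∘ₗ TensorProduct.mk k _ _ 1) (g := LinearMap.id)
    (linearMap_ext_homog fun n x hx => ?_) x
  rw [LinearMap.comp_apply, TensorProduct.mk_apply, ← splitAt_zero,
    B.shuffleMul_splitAt hx (zero_add n), BraidShift.shuffle_zero_left, one_smul,
    LinearMap.id_apply]

lemma shuffleMul_one_right (x : 𝕋) : B.shuffleMul (x ⊗ₜ 1) = x := by
  refine LinearMap.congr_fun (f := B.shuffleMul ∘ₗ (TensorProduct.mk k _ _).flip 1)
    (g := LinearMap.id) (linearMap_ext_homog fun n x hx => ?_) x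
  rw [LinearMap.comp_apply, LinearMap.flip_apply, TensorProduct.mk_apply, ← splitAt_self hx,
    B.shuffleMul_splitAt hx (add_zero n), BraidShift.shuffle_zero_right, one_smul,
    LinearMap.id_apply]

lemma tensorSwap_one_left (x : 𝕋) : B.tensorSwap (1 ⊗ₜ x) = x ⊗ₜ 1 := by
  refine LinearMap.congr_fun (f := B.tensorSwap ∘ₗ TensorProduct.mk k _ _ 1)
    (g := (TensorProduct.mk k _ _).flip 1) (linearMap_ext_homog fun n x hx => ?_) x
  rw [LinearMap.comp_apply, LinearMap.flip_apply, TensorProduct.mk_apply, TensorProduct.mk_apply,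
    ← splitAt_zero, B.tensorSwap_splitAt hx (zero_add n), BraidShift.swap_zero_left, one_smul,
    splitAt_self hx]

lemma tensorSwap_one_right (x : 𝕋) : B.tensorSwap (x ⊗ₜ 1) = 1 ⊗ₜ x := by
  refine LinearMap.congr_fun (f := B.tensorSwap ∘ₗ (TensorProduct.mk k _ _).flip 1)
    (g := TensorProduct.mk k _ _ 1) (linearMap_ext_homog fun n x hx => ?_) x
  rw [LinearMap.comp_apply, LinearMap.flip_apply, TensorProduct.mk_apply, TensorProduct.mk_apply,
    ← splitAt_self hx, B.tensorSwap_splitAt hx (add_zero n), BraidShift.swap_zero_right, one_smul,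
    splitAt_zero]

lemma tensorSwap_comul_left :
    (TensorProduct.assoc k _ _ _).symm.toLinearMap ∘ₗ
        LinearMap.lTensor _ (deconcat k V) ∘ₗ B.tensorSwap =
      braidLeft B.tensorSwap ∘ₗ braidRight B.tensorSwap ∘ₗ LinearMap.rTensor _ (deconcat k V) := by
  refine linearMap_ext_homog₂ (M := (𝕋 ⊗[k] 𝕋) ⊗[k] 𝕋) fun m x hx n y hy => ?_
  have hw := mul_mem_homog hx hy
  simp only [LinearMap.comp_apply]
  rw [← splitAt_mul hx, B.tensorSwap_splitAt hw rfl, rTensor_deconcat_splitAt hw (by omega),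
    lTensor_deconcat_splitAt (B.swap_smul_mem hw le_rfl) (add_comm n m), map_sum, map_sum, map_sum]
  refine sum_congr rfl fun p hp => ?_
  obtain rfl := mem_antidiagonal.1 hp
  rw [B.braidLeft_braidRight_splitAt₃ hw rfl, LinearEquiv.coe_coe, LinearEquiv.symm_apply_apply]

lemma tensorSwap_comul_right :
    LinearMap.rTensor _ (deconcat k V) ∘ₗ B.tensorSwap =
      braidRight B.tensorSwap ∘ₗ braidLeft B.tensorSwap ∘ₗ
        (TensorProduct.assoc k _ _ _).symm.toLinearMap ∘ₗ LinearMap.lTensor _ (deconcat k V) := by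
  refine linearMap_ext_homog₂ (M := (𝕋 ⊗[k] 𝕋) ⊗[k] 𝕋) fun m x hx n y hy => ?_
  have hw := mul_mem_homog hx hy
  simp only [LinearMap.comp_apply]
  rw [← splitAt_mul hx, B.tensorSwap_splitAt hw rfl, lTensor_deconcat_splitAt hw rfl,
    rTensor_deconcat_splitAt (B.swap_smul_mem hw le_rfl) (by omega), map_sum, map_sum, map_sum]
  refine sum_congr rfl fun p hp => ?_
  obtain rfl := mem_antidiagonal.1 hp
  rw [LinearEquiv.coe_coe, LinearEquiv.symm_apply_apply,
    B.braidRight_braidLeft_splitAt₃ hw (add_assoc _ _ _)]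

lemma tensorSwap_counit_left :
    (TensorProduct.rid k _).toLinearMap ∘ₗ LinearMap.lTensor _ (augmentation k V) ∘ₗ B.tensorSwap =
      (TensorProduct.lid k _).toLinearMap ∘ₗ LinearMap.rTensor _ (augmentation k V) := by
  refine linearMap_ext_homog₂ fun m x hx n y hy => ?_
  obtain rfl | hm := eq_or_ne m 0
  · obtain ⟨r, rfl⟩ := mem_homog_zero_iff.1 hx
    simp [← TensorProduct.smul_tmul', tensorSwap_one_left]
  · have hw := mul_mem_homog hx hy
    simp only [LinearMap.comp_apply]
    rw [← splitAt_mul hx, B.tensorSwap_splitAt hw rfl,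
      lTensor_augmentation_splitAt (B.swap_smul_mem hw le_rfl) (by omega),
      rTensor_augmentation_splitAt hw (by omega) hm, map_zero, map_zero]

lemma tensorSwap_counit_right :
    (TensorProduct.lid k _).toLinearMap ∘ₗ LinearMap.rTensor _ (augmentation k V) ∘ₗ B.tensorSwap =
      (TensorProduct.rid k _).toLinearMap ∘ₗ LinearMap.lTensor _ (augmentation k V) := by
  refine linearMap_ext_homog₂ fun m x hx n y hy => ?_
  obtain rfl | hn := eq_or_ne n 0
  · obtain ⟨r, rfl⟩ := mem_homog_zero_iff.1 hy
    simp [tensorSwap_one_right]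
  · have hw := mul_mem_homog hx hy
    simp only [LinearMap.comp_apply]
    rw [← splitAt_mul hx, B.tensorSwap_splitAt hw rfl,
      rTensor_augmentation_splitAt (B.swap_smul_mem hw le_rfl) (by omega) hn,
      lTensor_augmentation_splitAt hw (by omega), map_zero, map_zero]

lemma shuffleMul_mem {m n : ℕ} {x y : 𝕋} (hx : x ∈ homog k V m) (hy : y ∈ homog k V n) :
    B.shuffleMul (x ⊗ₜ y) ∈ homog k V (m + n) := by
  have hw := mul_mem_homog hx hy
  rw [← splitAt_mul hx, B.shuffleMul_splitAt hw rfl]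
  exact B.shuffle_smul_mem hw le_rfl

lemma augmentation_shuffleMul (x y : 𝕋) :
    augmentation k V (B.shuffleMul (x ⊗ₜ y)) = augmentation k V x * augmentation k V y := by
  refine LinearMap.congr_fun (f := augmentation k V ∘ₗ B.shuffleMul) (g := LinearMap.mul' k k ∘ₗ
    TensorProduct.map (augmentation k V) (augmentation k V)) ?_ (x ⊗ₜ y)
  refine linearMap_ext_homog₂ fun m x hx n y hy => ?_
  simp only [LinearMap.comp_apply, TensorProduct.map_tmul, LinearMap.mul'_apply]
  obtain rfl | hm := eq_or_ne m 0
  · obtain ⟨r, rfl⟩ := mem_homog_zero_iff.1 hx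
    simp [← TensorProduct.smul_tmul', shuffleMul_one_left]
  · rw [augmentation_of_pos hm hx, augmentation_of_pos (by omega) (B.shuffleMul_mem hx hy),
      zero_mul]

section

variable {a b d e : ℕ}

lemma map_shuffleMul_tmul_splitAt_tmul {x u y : 𝕋} (hx : x ∈ homog k V a)
    (hu : u ∈ homog k V (d + b)) (hy : y ∈ homog k V e) :
    TensorProduct.map B.shuffleMul B.shuffleMul ((TensorProduct.assoc k _ _ _).symm
      (x ⊗ₜ TensorProduct.assoc k _ _ _ (splitAt k V d u ⊗ₜ y))) =
    splitAt k V (a + d) (B.braidShift.shuffle a d •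
      (B.braidShift.σ ^ (a + d)) (B.braidShift.shuffle b e) • (x * (u * y))) := by
  induction hu using homog_add_induction with
  | add u u' _ _ hu hu' =>
    simp only [map_add, add_mul, mul_add, TensorProduct.add_tmul, TensorProduct.tmul_add, smul_add,
      hu, hu']
  | mul u₁ hu₁ u₂ hu₂ =>
    have hxu := mul_mem_homog hx hu₁
    have hshuffle := B.braidShift.shuffle_mem_strands a d
    rw [mul_assoc u₁, ← mul_assoc, B.σ_pow_smul_mul hxu, B.strands_smul_mul hshuffle hxu,
      splitAt_mul (B.shuffle_smul_mem hxu le_rfl), ← B.shuffleMul_splitAt hxu rfl,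
      splitAt_mul hx, ← B.shuffleMul_splitAt (mul_mem_homog hu₂ hy) rfl, splitAt_mul hu₂,
      splitAt_mul hu₁, TensorProduct.assoc_tmul, TensorProduct.assoc_symm_tmul,
      TensorProduct.map_tmul]

lemma map_shuffleMul_braidMiddle {x y : 𝕋} (hx : x ∈ homog k V (a + b))
    (hy : y ∈ homog k V (d + e)) :
    TensorProduct.map B.shuffleMul B.shuffleMul
      (braidMiddle B.tensorSwap (splitAt k V a x ⊗ₜ splitAt k V d y)) =
    splitAt k V (a + d)
      ((B.braidShift.shuffle a d * B.braidShift.cutTail (a, b) (d, e)) • (x * y)) := by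
  induction hx using homog_add_induction with
  | add x x' _ _ hx hx' => simp only [map_add, add_mul, TensorProduct.add_tmul, smul_add, hx, hx']
  | mul x₁ hx₁ x₂ hx₂ =>
    induction hy using homog_add_induction with
    | add y y' _ _ hy hy' => simp only [map_add, mul_add, TensorProduct.tmul_add, smul_add, hy, hy']
    | mul y₁ hy₁ y₂ hy₂ =>
      have hw := mul_mem_homog hx₂ hy₁
      have hswap := B.braidShift.swap_mem_strands b d
      have middle : braidMiddle B.tensorSwap ((x₁ ⊗ₜ x₂) ⊗ₜ (y₁ ⊗ₜ y₂)) =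
          (TensorProduct.assoc k _ _ _).symm (x₁ ⊗ₜ TensorProduct.assoc k _ _ _
            (splitAt k V d (B.braidShift.swap b d • (x₂ * y₁)) ⊗ₜ y₂)) := by
        rw [← B.tensorSwap_splitAt hw rfl, splitAt_mul hx₂]
        rfl
      have hu := B.swap_smul_mem hw le_rfl
      rw [add_comm b d] at hu
      rw [splitAt_mul hx₁, splitAt_mul hy₁, middle,
        B.map_shuffleMul_tmul_splitAt_tmul hx₁ hu hy₂, BraidShift.cutTail, mul_smul, mul_smul,
        mul_assoc x₁, B.σ_pow_smul_mul hx₁, ← mul_assoc x₂, B.strands_smul_mul hswap hw]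

end

lemma deconcat_shuffleMul : deconcat k V ∘ₗ B.shuffleMul =
    TensorProduct.map B.shuffleMul B.shuffleMul ∘ₗ braidMiddle B.tensorSwap ∘ₗ
      TensorProduct.map (deconcat k V) (deconcat k V) := by
  refine linearMap_ext_homog₂ fun m x hx n y hy => ?_
  have hw := mul_mem_homog hx hy
  let part (p q : ℕ × ℕ) : 𝕋 ⊗[k] 𝕋 := splitAt k V (p.1 + q.1)
    ((B.braidShift.shuffle p.1 q.1 * B.braidShift.cutTail p q) • (x * y))
  calc deconcat k V (B.shuffleMul (x ⊗ₜ y))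
      = ∑ a ∈ range (m + n + 1), splitAt k V a (B.braidShift.shuffle m n • (x * y)) := by
        rw [← splitAt_mul hx, B.shuffleMul_splitAt hw rfl,
          deconcat_apply (B.shuffle_smul_mem hw le_rfl), Nat.sum_antidiagonal_eq_sum_range_succ_mk]
    _ = ∑ a ∈ range (m + n + 1), ∑ p ∈ antidiagonal m, ∑ q ∈ antidiagonal n,
          if p.1 + q.1 = a then part p q else 0 := by
        refine sum_congr rfl fun a ha => ?_
        rw [B.braidShift.shuffle_eq_sum_cutTail (by simpa [Nat.lt_succ_iff] using ha)]
        simp only [sum_smul, map_sum, ite_smul, zero_smul, part]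
        refine sum_congr rfl fun p _ => sum_congr rfl fun q _ => ?_
        split_ifs with h
        · rw [h]
        · exact map_zero _
    _ = ∑ p ∈ antidiagonal m, ∑ q ∈ antidiagonal n, part p q := by
        refine sum_comm.trans <| sum_congr rfl fun p hp =>
          sum_comm.trans <| sum_congr rfl fun q hq => ?_
        rw [sum_ite_eq, if_pos]
        have hpm := mem_antidiagonal.1 hp
        have hqn := mem_antidiagonal.1 hq
        rw [mem_range]
        omega
    _ = TensorProduct.map B.shuffleMul B.shuffleMul (braidMiddle B.tensorSwap
          (deconcat k V x ⊗ₜ deconcat k V y)) := by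
        simp only [deconcat_apply hx, deconcat_apply hy, TensorProduct.sum_tmul,
          TensorProduct.tmul_sum, map_sum]
        rw [sum_comm]
        refine sum_congr rfl fun q hq => sum_congr rfl fun p hp => ?_
        exact (B.map_shuffleMul_braidMiddle (mem_antidiagonal.1 hp ▸ hx)
          (mem_antidiagonal.1 hq ▸ hy)).symm

end Braiding

/-! ### Graded coalgebras and antipodes -/

section Intertwining

section

variable {k : Type*} [CommSemiring k] {M M' N N' P P' Q Q' : Type*} [AddCommMonoid M] [Module k M]
  [AddCommMonoid M'] [Module k M'] [AddCommMonoid N] [Module k N] [AddCommMonoid N'] [Module k N']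
  [AddCommMonoid P] [Module k P] [AddCommMonoid P'] [Module k P'] [AddCommMonoid Q] [Module k Q]
  [AddCommMonoid Q'] [Module k Q'] {f : M →ₗ[k] N} {f' : M' →ₗ[k] N'} {c : M →ₗ[k] M'}
  {d : N →ₗ[k] N'} {g : P →ₗ[k] Q} {g' : P' →ₗ[k] Q'} {a : P →ₗ[k] P'} {b : Q →ₗ[k] Q'}

lemma map_map_of_intertwines (h : ∀ x, f' (c x) = d (f x)) (h' : ∀ y, g' (a y) = b (g y))
    (t : M ⊗[k] P) : TensorProduct.map f' g' (TensorProduct.map c a t) =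
      TensorProduct.map d b (TensorProduct.map f g t) := by
  have h : f' ∘ₗ c = d ∘ₗ f := LinearMap.ext h
  have h' : g' ∘ₗ a = b ∘ₗ g := LinearMap.ext h'
  rw [TensorProduct.map_map, TensorProduct.map_map, h, h']

lemma map_rTensor_of_intertwines (h : ∀ x, f' (c x) = d (f x)) (g : P →ₗ[k] Q) (t : M ⊗[k] P) :
    TensorProduct.map f' g (LinearMap.rTensor P c t) =
      LinearMap.rTensor Q d (TensorProduct.map f g t) :=
  map_map_of_intertwines (g := g) (g' := g) (a := .id) (b := .id) h (fun _ => rfl) t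

lemma map_lTensor_of_intertwines (h : ∀ x, f' (c x) = d (f x)) (g : P →ₗ[k] Q) (t : P ⊗[k] M) :
    TensorProduct.map g f' (LinearMap.lTensor P c t) =
      LinearMap.lTensor Q d (TensorProduct.map g f t) :=
  map_map_of_intertwines (f := g) (f' := g) (c := .id) (d := .id) (fun _ => rfl) h t

lemma apply_lid (g : P →ₗ[k] Q) (t : k ⊗[k] P) : g (TensorProduct.lid k P t) =
    TensorProduct.lid k Q (TensorProduct.map .id g t) := by
  induction t using TensorProduct.induction_on with
  | zero => simp only [map_zero]
  | tmul r x => simp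
  | add s t hs ht => simp only [map_add, hs, ht]

lemma apply_rid (g : P →ₗ[k] Q) (t : P ⊗[k] k) : g (TensorProduct.rid k P t) =
    TensorProduct.rid k Q (TensorProduct.map g .id t) := by
  induction t using TensorProduct.induction_on with
  | zero => simp only [map_zero]
  | tmul x r => simp
  | add s t hs ht => simp only [map_add, hs, ht]

end

variable {k : Type u} [Field k] {M N : Type*} [AddCommGroup M] [Module k M] [AddCommGroup N]
  [Module k N]
variable {f : M →ₗ[k] N} {c : M ⊗[k] M →ₗ[k] M ⊗[k] M} {d : N ⊗[k] N →ₗ[k] N ⊗[k] N}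

lemma map_braidLeft (h : ∀ t, TensorProduct.map f f (c t) = d (TensorProduct.map f f t))
    (t : (M ⊗[k] M) ⊗[k] M) :
    TensorProduct.map (TensorProduct.map f f) f (braidLeft c t) =
      braidLeft d (TensorProduct.map (TensorProduct.map f f) f t) :=
  map_rTensor_of_intertwines h f t

lemma map_braidRight (h : ∀ t, TensorProduct.map f f (c t) = d (TensorProduct.map f f t))
    (t : (M ⊗[k] M) ⊗[k] M) :
    TensorProduct.map (TensorProduct.map f f) f (braidRight c t) =
      braidRight d (TensorProduct.map (TensorProduct.map f f) f t) := by
  simp only [braidRight, LinearMap.comp_apply, LinearEquiv.coe_coe,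
    TensorProduct.map_map_assoc_symm, map_lTensor_of_intertwines h, TensorProduct.map_map_assoc]

lemma map_braidMiddle (h : ∀ t, TensorProduct.map f f (c t) = d (TensorProduct.map f f t))
    (t : (M ⊗[k] M) ⊗[k] (M ⊗[k] M)) :
    TensorProduct.map (TensorProduct.map f f) (TensorProduct.map f f) (braidMiddle c t) =
      braidMiddle d (TensorProduct.map (TensorProduct.map f f) (TensorProduct.map f f) t) := by
  have inner (t : M ⊗[k] (M ⊗[k] M)) : TensorProduct.map f (TensorProduct.map f f)
      (((TensorProduct.assoc k M M M).toLinearMap ∘ₗ LinearMap.rTensor M c ∘ₗ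
        (TensorProduct.assoc k M M M).symm.toLinearMap) t) =
      ((TensorProduct.assoc k N N N).toLinearMap ∘ₗ LinearMap.rTensor N d ∘ₗ
        (TensorProduct.assoc k N N N).symm.toLinearMap)
          (TensorProduct.map f (TensorProduct.map f f) t) := by
    simp only [LinearMap.comp_apply, LinearEquiv.coe_coe, TensorProduct.map_map_assoc,
      map_rTensor_of_intertwines h, TensorProduct.map_map_assoc_symm]
  rw [braidMiddle, braidMiddle]
  simp only [LinearMap.comp_apply, LinearEquiv.coe_coe, TensorProduct.map_map_assoc_symm,
    map_lTensor_of_intertwines inner, TensorProduct.map_map_assoc]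

end Intertwining

section Graded

variable {k : Type u} {R : Type w} [Field k] [AddCommGroup R] [Module k R]

lemma tensorSubmodule_le {P Q : Submodule k R} {S : Submodule k (R ⊗[k] R)} :
    tensorSubmodule P Q ≤ S ↔ ∀ x ∈ P, ∀ y ∈ Q, x ⊗ₜ y ∈ S := by
  refine ⟨fun h x hx y hy => h ⟨⟨x, hx⟩ ⊗ₜ ⟨y, hy⟩, rfl⟩, fun h => ?_⟩
  rintro _ ⟨t, rfl⟩
  induction t using TensorProduct.induction_on with
  | zero => simp
  | tmul x y => exact h _ x.2 _ y.2
  | add x y hx hy => rw [map_add]; exact add_mem hx hy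

lemma tmul_mem_tensorSubmodule {P Q : Submodule k R} {x y : R} (hx : x ∈ P) (hy : y ∈ Q) :
    x ⊗ₜ[k] y ∈ tensorSubmodule P Q := tensorSubmodule_le.1 le_rfl x hx y hy

variable {M : Type*} [AddCommGroup M] [Module k M] {𝒜 : ℕ → Submodule k R}

lemma exists_linearMap_of_isInternal (h𝒜 : DirectSum.IsInternal 𝒜) (f : ℕ → R →ₗ[k] M) :
    ∃ F : R →ₗ[k] M, ∀ n, ∀ x ∈ 𝒜 n, F x = f n x := by
  let e := LinearEquiv.ofBijective (DirectSum.coeLinearMap 𝒜) h𝒜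
  refine ⟨DirectSum.toModule k ℕ M (fun n => f n ∘ₗ (𝒜 n).subtype) ∘ₗ e.symm.toLinearMap,
    fun n x hx => ?_⟩
  have he : e.symm x = DirectSum.lof k ℕ (fun n => 𝒜 n) n ⟨x, hx⟩ :=
    e.symm_apply_eq.2 (DirectSum.coeLinearMap_lof 𝒜 n ⟨x, hx⟩).symm
  rw [LinearMap.comp_apply, LinearEquiv.coe_coe, he, DirectSum.toModule_lof]
  rfl

lemma linearMap_ext_of_isInternal (h𝒜 : DirectSum.IsInternal 𝒜) {f g : R →ₗ[k] M}
    (h : ∀ n, ∀ x ∈ 𝒜 n, f x = g x) : f = g := by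
  have htop : ⊤ ≤ LinearMap.eqLocus f g := h𝒜.submodule_iSup_eq_top ▸ iSup_le h
  exact LinearMap.ext fun x => htop trivial

lemma isInternal_comap (h𝒜 : DirectSum.IsInternal 𝒜) {f : M →ₗ[k] R} (hf : Function.Injective f)
    (htop : ⨆ n, (𝒜 n).comap f = ⊤) : DirectSum.IsInternal fun n => (𝒜 n).comap f := by
  refine (DirectSum.isInternal_submodule_iff_iSupIndep_and_iSup_eq_top _).2 ⟨fun n => ?_, htop⟩
  have hle : (⨆ (j) (_ : j ≠ n), (𝒜 j).comap f).map f ≤ ⨆ (j) (_ : j ≠ n), 𝒜 j := by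
    simp only [Submodule.map_iSup]
    exact iSup₂_mono fun j _ => Submodule.map_comap_le f (𝒜 j)
  refine Submodule.disjoint_def.2 fun x hx hx' => hf ?_
  rw [map_zero]
  exact Submodule.disjoint_def.1 (h𝒜.submodule_iSupIndep n) _ hx
    (hle (Submodule.mem_map_of_mem hx'))

/-- A family of subspaces compatible with the coproduct, as in a graded coalgebra. -/
def ComulGraded [Coalgebra k R] (𝒜 : ℕ → Submodule k R) : Prop :=
  ∀ (n : ℕ) (x : R), x ∈ 𝒜 n → Coalgebra.comul (R := k) x ∈
    ⨆ (i : ℕ) (j : ℕ) (_ : i + j = n), tensorSubmodule (𝒜 i) (𝒜 j)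

variable [Coalgebra k R]

lemma ComulGraded.comul_mem (h𝒜 : ComulGraded 𝒜) {n : ℕ} {x : R} (hx : x ∈ 𝒜 n)
    {W : Submodule k (R ⊗[k] R)}
    (hW : ∀ i j, i + j = n → ∀ a ∈ 𝒜 i, ∀ b ∈ 𝒜 j, a ⊗ₜ b ∈ W) :
    Coalgebra.comul (R := k) x ∈ W := by
  have hle : ⨆ (i : ℕ) (j : ℕ) (_ : i + j = n), tensorSubmodule (𝒜 i) (𝒜 j) ≤ W :=
    iSup_le fun i => iSup_le fun j => iSup_le fun hij => tensorSubmodule_le.2 (hW i j hij)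
  exact hle (h𝒜 n x hx)

end Graded

section Antipode

open WithConv Finset

variable {k : Type u} {R : Type w} {A : Type*} [Field k] [AddCommGroup R] [Module k R]
  [Coalgebra k R] [Ring A] [Algebra k A] {𝒜 : ℕ → Submodule k R}

namespace ComulGraded

lemma convMul_congr (h𝒜 : ComulGraded 𝒜) {f f' g g' : WithConv (R →ₗ[k] A)} {n : ℕ}
    (hf : ∀ i ≤ n, ∀ x ∈ 𝒜 i, f.ofConv x = f'.ofConv x)
    (hg : ∀ i ≤ n, ∀ x ∈ 𝒜 i, g.ofConv x = g'.ofConv x) {x : R} (hx : x ∈ 𝒜 n) :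
    (f * g).ofConv x = (f' * g').ofConv x := by
  rw [LinearMap.convMul_apply, LinearMap.convMul_apply]
  congr 1
  refine h𝒜.comul_mem (W := LinearMap.eqLocus _ _) hx fun i j hij a ha b hb => ?_
  rw [LinearMap.mem_eqLocus, TensorProduct.map_tmul, TensorProduct.map_tmul,
    hf i (by omega) a ha, hg j (by omega) b hb]

lemma convPow_apply_eq_zero (h𝒜 : ComulGraded 𝒜) {f : WithConv (R →ₗ[k] A)}
    (hf : ∀ x ∈ 𝒜 0, f.ofConv x = 0) {n i : ℕ} (hi : i < n) {x : R} (hx : x ∈ 𝒜 i) :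
    (f ^ n).ofConv x = 0 := by
  induction n generalizing i x with
  | zero => omega
  | succ n ih =>
    rw [pow_succ', LinearMap.convMul_apply]
    refine h𝒜.comul_mem (W := LinearMap.ker (LinearMap.mul' k A ∘ₗ
      TensorProduct.map f.ofConv (f ^ n).ofConv)) hx fun a b hab y hy z hz => ?_
    rw [LinearMap.mem_ker, LinearMap.comp_apply, TensorProduct.map_tmul, LinearMap.mul'_apply]
    obtain rfl | ha := eq_or_ne a 0
    · rw [hf y hy, zero_mul]
    · rw [ih (by omega) hz, mul_zero]

-- The inverse is the geometric series in `1 - f`, which is a finite sum in each degree.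
theorem isUnit_of_eq_one_on_zero (h𝒜 : ComulGraded 𝒜) (hint : DirectSum.IsInternal 𝒜)
    {f : WithConv (R →ₗ[k] A)}
    (hf : ∀ x ∈ 𝒜 0, f.ofConv x = (1 : WithConv (R →ₗ[k] A)).ofConv x) : IsUnit f := by
  have hzero : ∀ x ∈ 𝒜 0, (1 - f).ofConv x = 0 := fun x hx => by
    rw [ofConv_sub, LinearMap.sub_apply, hf x hx, sub_self]
  let T (n : ℕ) : WithConv (R →ₗ[k] A) := ∑ i ∈ range n, (1 - f) ^ i
  obtain ⟨S, hS⟩ := exists_linearMap_of_isInternal hint fun n => (T (n + 1)).ofConv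
  have S_eq_T (n i : ℕ) (hi : i ≤ n) (x : R) (hx : x ∈ 𝒜 i) :
      (toConv S).ofConv x = (T (n + 1)).ofConv x := by
    simp only [hS i x hx, T, ofConv_sum, LinearMap.sum_apply]
    refine (eventually_constant_sum (fun j hj => ?_) (Nat.succ_le_succ hi)).symm
    exact h𝒜.convPow_apply_eq_zero hzero hj hx
  have one_sub_pow_apply (n : ℕ) (x : R) (hx : x ∈ 𝒜 n) :
      (1 - (1 - f) ^ (n + 1)).ofConv x = (1 : WithConv (R →ₗ[k] A)).ofConv x := by
    rw [ofConv_sub, LinearMap.sub_apply, h𝒜.convPow_apply_eq_zero hzero n.lt_succ_self hx, sub_zero]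
  refine ⟨⟨f, toConv S, ?_, ?_⟩, rfl⟩ <;>
    refine ofConv_injective (linearMap_ext_of_isInternal hint fun n x hx => ?_)
  · rw [h𝒜.convMul_congr (fun _ _ _ _ => rfl) (S_eq_T n) hx, ← one_sub_pow_apply n x hx,
      ← mul_neg_geom_sum, sub_sub_cancel]
  · rw [h𝒜.convMul_congr (S_eq_T n) (fun _ _ _ _ => rfl) hx, ← one_sub_pow_apply n x hx,
      ← geom_sum_mul_neg, sub_sub_cancel]

end ComulGraded

theorem ComulGraded.exists_antipode {R : Type w} [Ring R] [Algebra k R] [Coalgebra k R]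
    {𝒜 : ℕ → Submodule k R} (h𝒜 : ComulGraded 𝒜) (hint : DirectSum.IsInternal 𝒜)
    (hzero : ∀ x ∈ 𝒜 0, algebraMap k R (Coalgebra.counit x) = x) :
    ∃ S : R →ₗ[k] R,
      LinearMap.mul' k R ∘ₗ LinearMap.rTensor R S ∘ₗ Coalgebra.comul =
          Algebra.linearMap k R ∘ₗ Coalgebra.counit ∧
        LinearMap.mul' k R ∘ₗ LinearMap.lTensor R S ∘ₗ Coalgebra.comul =
          Algebra.linearMap k R ∘ₗ Coalgebra.counit := by
  obtain ⟨⟨_, S, hright, hleft⟩, rfl⟩ := h𝒜.isUnit_of_eq_one_on_zero hint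
    (f := toConv LinearMap.id) fun x hx => (hzero x hx).symm
  exact ⟨S.ofConv, congrArg ofConv hleft, congrArg ofConv hright⟩

end Antipode

/-! ### The quantum symmetrizer on the tensor algebra -/

namespace QuantumShuffle

open Finset

variable {k : Type u} {V : Type v} [Field k] [AddCommGroup V] [Module k V]

local notation "𝕋" => TensorAlgebra k V

lemma proj_apply_of_mem {n : ℕ} {x : 𝕋} (hx : x ∈ homog k V n) :
    GradedAlgebra.proj (homog k V) n x = x := DirectSum.decompose_of_mem_same _ hx

lemma proj_apply_of_ne {m n : ℕ} {x : 𝕋} (hx : x ∈ homog k V m) (h : m ≠ n) :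
    GradedAlgebra.proj (homog k V) n x = 0 := DirectSum.decompose_of_mem_ne _ hx h

lemma rTensor_proj_splitAt (n : ℕ) {a N : ℕ} {w : 𝕋} (hw : w ∈ homog k V N) (h : a ≤ N) :
    LinearMap.rTensor _ (GradedAlgebra.proj (homog k V) n) (splitAt k V a w) =
      if a = n then splitAt k V a w else 0 := by
  obtain ⟨b, rfl⟩ := Nat.exists_eq_add_of_le h
  induction hw using homog_add_induction with
  | mul x hx y _ =>
    rw [splitAt_mul hx, LinearMap.rTensor_tmul]
    split_ifs with hn
    · rw [proj_apply_of_mem (hn ▸ hx)]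
    · rw [proj_apply_of_ne hx hn, TensorProduct.zero_tmul]
  | add x y _ _ hx hy => rw [map_add, map_add, hx, hy]; split_ifs <;> simp

-- A word of positive length is the product of its first letter and the remaining word.
lemma mul'_rTensor_proj_one_deconcat (x : 𝕋) :
    LinearMap.mul' k _ (LinearMap.rTensor _ (GradedAlgebra.proj (homog k V) 1) (deconcat k V x)) =
      x - augmentation k V x • 1 := by
  refine LinearMap.congr_fun (f := LinearMap.mul' k _ ∘ₗ
    LinearMap.rTensor _ (GradedAlgebra.proj (homog k V) 1) ∘ₗ deconcat k V)
    (g := LinearMap.id - (augmentation k V).smulRight 1) (linearMap_ext_homog fun n x hx => ?_) x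
  simp only [LinearMap.comp_apply, LinearMap.sub_apply, LinearMap.id_apply,
    LinearMap.smulRight_apply]
  obtain _ | n := n
  · obtain ⟨r, rfl⟩ := mem_homog_zero_iff.1 hx
    simp [deconcat_one, augmentation_one, proj_apply_of_ne one_mem_homog]
  · have hsum : LinearMap.rTensor _ (GradedAlgebra.proj (homog k V) 1) (deconcat k V x) =
        splitAt k V 1 x := by
      rw [deconcat_apply hx, map_sum, sum_eq_single (1, n)]
      · rw [rTensor_proj_splitAt 1 hx (by omega), if_pos rfl]
      · rintro ⟨a, b⟩ hp hne
        rw [rTensor_proj_splitAt 1 hx (Nat.le.intro (mem_antidiagonal.1 hp)), if_neg]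
        rintro rfl
        grind [HasAntidiagonal.mem_antidiagonal]
      · exact fun h => absurd (HasAntidiagonal.mem_antidiagonal.2 (add_comm 1 n)) h
    rw [hsum, mul'_splitAt hx (by omega), augmentation_of_pos n.succ_ne_zero hx, zero_smul,
      sub_zero]

lemma deconcat_ι (v : V) : deconcat k V (ι k v) = ι k v ⊗ₜ 1 + 1 ⊗ₜ ι k v := by
  rw [deconcat_apply (ι_mem_homog v), Nat.sum_antidiagonal_eq_sum_range_succ_mk,
    sum_range_succ, sum_range_one, splitAt_zero, splitAt_self (ι_mem_homog v), add_comm]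

theorem deconcat_eq_iff_mem_homog_one {x : 𝕋} :
    deconcat k V x = x ⊗ₜ 1 + 1 ⊗ₜ x ↔ x ∈ homog k V 1 := by
  refine ⟨fun hx => ?_, fun hx => ?_⟩
  · have haug : augmentation k V x • (1 : 𝕋) = 0 := by
      have h := LinearMap.congr_fun rTensor_augmentation_comp_deconcat x
      simpa [hx, augmentation_one] using congrArg (TensorProduct.lid k 𝕋) h
    have h := mul'_rTensor_proj_one_deconcat x
    rw [hx, haug, sub_zero, map_add, map_add, LinearMap.rTensor_tmul, LinearMap.rTensor_tmul,
      proj_apply_of_ne one_mem_homog zero_ne_one, TensorProduct.zero_tmul, map_zero, add_zero,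
      LinearMap.mul'_apply, mul_one] at h
    exact h ▸ SetLike.coe_mem (DirectSum.decompose (homog k V) x 1)
  · rw [homog, pow_one] at hx
    obtain ⟨v, rfl⟩ := hx
    exact deconcat_ι v

lemma splitAt_one_pair (t : V ⊗[k] V) :
    splitAt k V 1 (pair k V t) = TensorProduct.map (ι k) (ι k) t := by
  refine LinearMap.congr_fun (f := splitAt k V 1 ∘ₗ pair k V) (TensorProduct.ext' fun v w => ?_) t
  rw [LinearMap.comp_apply, pair_tmul, splitAt_mul (ι_mem_homog v), TensorProduct.map_tmul]

end QuantumShuffle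

namespace Braiding

open QuantumShuffle Finset

variable {k : Type u} {V : Type v} [Field k] [AddCommGroup V] [Module k V] (B : Braiding k V)

local notation "𝕋" => TensorAlgebra k V

lemma tensorSwap_map_ι (t : V ⊗[k] V) :
    B.tensorSwap (TensorProduct.map (ι k) (ι k) t) = TensorProduct.map (ι k) (ι k) (B.c t) := by
  rw [← splitAt_one_pair, B.tensorSwap_splitAt (a := 1) (b := 1) (pair_mem_homog t) rfl,
    BraidShift.swap_one_one, ← splitAt_one_pair]
  exact congrArg _ (crossing_smul_pair B.c.toLinearMap t)

/-- The quantum symmetrizer, which intertwines the concatenation product with the quantum shuffle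
product and the unshuffle coproduct with the deconcatenation coproduct. -/
def symmetrize : 𝕋 →ₗ[k] 𝕋 := glue fun n => (B.braidShift.symmetrizer n).1

/-- The unshuffle coproduct of the tensor algebra. -/
def unshuffleComul : 𝕋 →ₗ[k] 𝕋 ⊗[k] 𝕋 :=
  glue fun n => ∑ p ∈ antidiagonal n, splitAt k V p.1 ∘ₗ (B.braidShift.unshuffle p.1 p.2).1

variable {a b n N : ℕ} {w : TensorAlgebra k V}

lemma symmetrize_apply (hw : w ∈ homog k V n) :
    B.symmetrize w = B.braidShift.symmetrizer n • w := glue_apply _ hw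

lemma symmetrize_mem (hw : w ∈ homog k V n) : B.symmetrize w ∈ homog k V n := by
  rw [B.symmetrize_apply hw]
  exact B.strands_smul_mem (B.braidShift.symmetrizer_mem_strands n) le_rfl hw

lemma unshuffle_smul_mem (hw : w ∈ homog k V N) (h : a + b ≤ N) :
    B.braidShift.unshuffle a b • w ∈ homog k V N :=
  B.strands_smul_mem (B.braidShift.unshuffle_mem_strands a b) h hw

lemma symmetrizer_mul_smul_mem (hw : w ∈ homog k V N) (h : a + b = N) :
    (B.braidShift.symmetrizer a * (B.braidShift.σ ^ a) (B.braidShift.symmetrizer b)) • w ∈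
      homog k V N := by
  refine B.strands_smul_mem (mul_mem ?_ ?_) h.le hw
  · exact B.braidShift.strands_mono (Nat.le_add_right a b) (B.braidShift.symmetrizer_mem_strands a)
  · exact B.braidShift.σ_pow_mem_strands (B.braidShift.symmetrizer_mem_strands b) a

lemma map_symmetrize_splitAt (hw : w ∈ homog k V N) (h : a + b = N) :
    TensorProduct.map B.symmetrize B.symmetrize (splitAt k V a w) = splitAt k V a
      ((B.braidShift.symmetrizer a * (B.braidShift.σ ^ a) (B.braidShift.symmetrizer b)) • w) := by
  subst h
  induction hw using homog_add_induction with
  | mul x hx y hy =>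
    have hs := B.braidShift.symmetrizer_mem_strands a
    rw [mul_smul, B.σ_pow_smul_mul hx, B.strands_smul_mul hs hx,
      splitAt_mul (B.strands_smul_mem hs le_rfl hx), splitAt_mul hx, TensorProduct.map_tmul,
      B.symmetrize_apply hx, B.symmetrize_apply hy]
  | add x y _ _ hx hy => simp only [map_add, smul_add, hx, hy]

theorem symmetrize_mul (x y : 𝕋) :
    B.symmetrize (x * y) = B.shuffleMul (B.symmetrize x ⊗ₜ B.symmetrize y) := by
  refine LinearMap.congr_fun (f := B.symmetrize ∘ₗ LinearMap.mul' k _) (g := B.shuffleMul ∘ₗ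
    TensorProduct.map B.symmetrize B.symmetrize) ?_ (x ⊗ₜ y)
  refine linearMap_ext_homog₂ fun m x hx n y hy => ?_
  have hw := mul_mem_homog hx hy
  rw [LinearMap.comp_apply, LinearMap.comp_apply, LinearMap.mul'_apply, ← splitAt_mul hx,
    B.map_symmetrize_splitAt hw rfl, B.shuffleMul_splitAt (B.symmetrizer_mul_smul_mem hw rfl) rfl,
    B.symmetrize_apply hw, smul_smul, BraidShift.symmetrizer_add_eq_shuffle_mul]

lemma symmetrize_one : B.symmetrize 1 = 1 := by
  rw [B.symmetrize_apply one_mem_homog, BraidShift.symmetrizer, one_smul]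

lemma symmetrize_ι (v : V) : B.symmetrize (ι k v) = ι k v := by
  rw [B.symmetrize_apply (ι_mem_homog v), BraidShift.symmetrizer, BraidShift.shuffle_zero_right,
    BraidShift.symmetrizer, map_one, mul_one, one_smul]

theorem tensorSwap_map_symmetrize (t : 𝕋 ⊗[k] 𝕋) :
    B.tensorSwap (TensorProduct.map B.symmetrize B.symmetrize t) =
      TensorProduct.map B.symmetrize B.symmetrize (B.tensorSwap t) := by
  refine LinearMap.congr_fun (f := B.tensorSwap ∘ₗ TensorProduct.map B.symmetrize B.symmetrize)
    (g := TensorProduct.map B.symmetrize B.symmetrize ∘ₗ B.tensorSwap) ?_ t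
  refine linearMap_ext_homog₂ fun m x hx n y hy => ?_
  have hw := mul_mem_homog hx hy
  rw [LinearMap.comp_apply, LinearMap.comp_apply, ← splitAt_mul hx,
    B.map_symmetrize_splitAt hw rfl, B.tensorSwap_splitAt (B.symmetrizer_mul_smul_mem hw rfl) rfl,
    B.tensorSwap_splitAt hw rfl,
    B.map_symmetrize_splitAt (b := m) (B.swap_smul_mem hw le_rfl) (add_comm n m), smul_smul,
    smul_smul, (B.braidShift.swap_semiconj_symmetrizer m n).eq]

lemma unshuffleComul_apply (hw : w ∈ homog k V n) : B.unshuffleComul w =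
    ∑ p ∈ antidiagonal n, splitAt k V p.1 (B.braidShift.unshuffle p.1 p.2 • w) := by
  rw [unshuffleComul, glue_apply _ hw, LinearMap.sum_apply]
  rfl

theorem deconcat_symmetrize (x : 𝕋) : deconcat k V (B.symmetrize x) =
    TensorProduct.map B.symmetrize B.symmetrize (B.unshuffleComul x) := by
  refine LinearMap.congr_fun (f := deconcat k V ∘ₗ B.symmetrize)
    (g := TensorProduct.map B.symmetrize B.symmetrize ∘ₗ B.unshuffleComul) ?_ x
  refine linearMap_ext_homog fun n w hw => ?_
  rw [LinearMap.comp_apply, LinearMap.comp_apply, deconcat_apply (B.symmetrize_mem hw),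
    B.unshuffleComul_apply hw, map_sum]
  refine sum_congr rfl fun p hp => ?_
  obtain rfl := mem_antidiagonal.1 hp
  rw [B.map_symmetrize_splitAt (B.unshuffle_smul_mem hw le_rfl) rfl, smul_smul,
    B.symmetrize_apply hw, BraidShift.symmetrizer_add_eq_mul_unshuffle]

lemma proj_symmetrize (n : ℕ) (x : 𝕋) : GradedAlgebra.proj (homog k V) n (B.symmetrize x) =
    B.symmetrize (GradedAlgebra.proj (homog k V) n x) := by
  refine LinearMap.congr_fun (f := GradedAlgebra.proj (homog k V) n ∘ₗ B.symmetrize)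
    (g := B.symmetrize ∘ₗ GradedAlgebra.proj (homog k V) n) ?_ x
  refine linearMap_ext_homog fun m x hx => ?_
  rw [LinearMap.comp_apply, LinearMap.comp_apply]
  obtain rfl | h := eq_or_ne m n
  · rw [proj_apply_of_mem hx, proj_apply_of_mem (B.symmetrize_mem hx)]
  · rw [proj_apply_of_ne hx h, proj_apply_of_ne (B.symmetrize_mem hx) h, map_zero]

end Braiding

/-! ### The image of the quantum symmetrizer -/

namespace Braiding

open QuantumShuffle Finset

variable {k : Type u} {V : Type v} [Field k] [AddCommGroup V] [Module k V] (B : Braiding k V)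

local notation "𝕋" => TensorAlgebra k V

/-- The standard model of the Nichols algebra of a braided vector space: the image of the quantum
symmetrizer. It is a subalgebra and subcoalgebra of the quantum shuffle algebra, whose product is
`shuffleMul` and whose coproduct is `deconcat`. -/
def Nichols : Type (max u v) := LinearMap.range B.symmetrize

namespace Nichols

noncomputable instance : AddCommGroup B.Nichols :=
  inferInstanceAs (AddCommGroup (LinearMap.range B.symmetrize))

noncomputable instance : Module k B.Nichols :=
  inferInstanceAs (Module k (LinearMap.range B.symmetrize))

/-- The inclusion of the Nichols algebra into the quantum shuffle algebra. -/
noncomputable def incl : B.Nichols →ₗ[k] 𝕋 := (LinearMap.range B.symmetrize).subtype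

/-- The projection of the tensor algebra onto the Nichols algebra. -/
noncomputable def proj : 𝕋 →ₗ[k] B.Nichols := B.symmetrize.rangeRestrict

lemma incl_proj (x : 𝕋) : incl B (proj B x) = B.symmetrize x := rfl

lemma incl_injective : Function.Injective (incl B) := Subtype.val_injective

lemma proj_surjective : Function.Surjective (proj B) := LinearMap.surjective_rangeRestrict _

noncomputable instance : Mul B.Nichols where
  mul x y := ⟨B.shuffleMul (incl B x ⊗ₜ incl B y), by
    obtain ⟨x, rfl⟩ := proj_surjective B x
    obtain ⟨y, rfl⟩ := proj_surjective B y
    exact ⟨x * y, B.symmetrize_mul x y⟩⟩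

noncomputable instance : One B.Nichols where
  one := proj B 1

lemma incl_mul (x y : B.Nichols) : incl B (x * y) = B.shuffleMul (incl B x ⊗ₜ incl B y) := rfl

lemma incl_one : incl B 1 = 1 := B.symmetrize_one

noncomputable instance : Ring B.Nichols where
  __ := (inferInstance : AddCommGroup B.Nichols)
  __ := (inferInstance : Mul B.Nichols)
  __ := (inferInstance : One B.Nichols)
  left_distrib x y z := incl_injective B <| by
    simp only [incl_mul, map_add, TensorProduct.tmul_add]
  right_distrib x y z := incl_injective B <| by
    simp only [incl_mul, map_add, TensorProduct.add_tmul]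
  zero_mul x := incl_injective B <| by simp only [incl_mul, map_zero, TensorProduct.zero_tmul]
  mul_zero x := incl_injective B <| by simp only [incl_mul, map_zero, TensorProduct.tmul_zero]
  mul_assoc x y z := incl_injective B <|
    LinearMap.congr_fun B.shuffleMul_assoc ((incl B x ⊗ₜ incl B y) ⊗ₜ incl B z)
  one_mul x := incl_injective B <| by rw [incl_mul, incl_one, shuffleMul_one_left]
  mul_one x := incl_injective B <| by rw [incl_mul, incl_one, shuffleMul_one_right]

noncomputable instance : Algebra k B.Nichols := Algebra.ofModule
  (fun r x y => incl_injective B <| by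
    rw [incl_mul, map_smul, map_smul, incl_mul, ← TensorProduct.smul_tmul', map_smul])
  (fun r x y => incl_injective B <| by
    rw [incl_mul, map_smul, map_smul, incl_mul, TensorProduct.tmul_smul, map_smul])

lemma proj_mul (x y : 𝕋) : proj B (x * y) = proj B x * proj B y :=
  incl_injective B (B.symmetrize_mul x y)

lemma proj_one : proj B 1 = 1 := rfl

lemma incl_mul' (t : B.Nichols ⊗[k] B.Nichols) :
    incl B (LinearMap.mul' k _ t) = B.shuffleMul (TensorProduct.map (incl B) (incl B) t) :=
  LinearMap.congr_fun (f := incl B ∘ₗ LinearMap.mul' k _)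
    (g := B.shuffleMul ∘ₗ TensorProduct.map (incl B) (incl B))
    (TensorProduct.ext' fun x y => incl_mul B x y) t

/-- The inclusion of the tensor square. -/
noncomputable abbrev incl₂ : B.Nichols ⊗[k] B.Nichols →ₗ[k] 𝕋 ⊗[k] 𝕋 :=
  TensorProduct.map (incl B) (incl B)

/-- The projection to the tensor square. -/
noncomputable abbrev proj₂ : 𝕋 ⊗[k] 𝕋 →ₗ[k] B.Nichols ⊗[k] B.Nichols :=
  TensorProduct.map (proj B) (proj B)

/-- The inclusion of the tensor cube. -/
noncomputable abbrev incl₃ : (B.Nichols ⊗[k] B.Nichols) ⊗[k] B.Nichols →ₗ[k] (𝕋 ⊗[k] 𝕋) ⊗[k] 𝕋 :=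
  TensorProduct.map (incl₂ B) (incl B)

lemma incl₂_injective : Function.Injective (incl₂ B) :=
  TensorProduct.map_injective_of_flat_flat _ _ (incl_injective B) (incl_injective B)

lemma incl₃_injective : Function.Injective (incl₃ B) :=
  TensorProduct.map_injective_of_flat_flat _ _ (incl₂_injective B) (incl_injective B)

lemma proj₂_surjective : Function.Surjective (proj₂ B) :=
  TensorProduct.map_surjective (proj_surjective B) (proj_surjective B)

lemma incl₂_proj₂ (t : 𝕋 ⊗[k] 𝕋) :
    incl₂ B (proj₂ B t) = TensorProduct.map B.symmetrize B.symmetrize t :=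
  TensorProduct.map_map _ _ _ _ t

/-- The linear map underlying the braiding of the Nichols algebra. -/
noncomputable def swap : B.Nichols ⊗[k] B.Nichols →ₗ[k] B.Nichols ⊗[k] B.Nichols :=
  (B.tensorSwap ∘ₗ incl₂ B).codRestrictOfInjective (incl₂ B) (incl₂_injective B) fun t => by
    obtain ⟨t, rfl⟩ := proj₂_surjective B t
    refine ⟨proj₂ B (B.tensorSwap t), ?_⟩
    rw [LinearMap.comp_apply, incl₂_proj₂, incl₂_proj₂, tensorSwap_map_symmetrize]

lemma incl₂_swap (t : B.Nichols ⊗[k] B.Nichols) : incl₂ B (swap B t) = B.tensorSwap (incl₂ B t) :=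
  LinearMap.codRestrictOfInjective_comp_apply ..

lemma swap_proj₂ (t : 𝕋 ⊗[k] 𝕋) : swap B (proj₂ B t) = proj₂ B (B.tensorSwap t) :=
  incl₂_injective B <| by rw [incl₂_swap, incl₂_proj₂, incl₂_proj₂, tensorSwap_map_symmetrize]

lemma swap_bijective : Function.Bijective (swap B) := by
  refine ⟨fun s t h => incl₂_injective B (B.tensorSwap_bijective.1 ?_), fun t => ?_⟩
  · rw [← incl₂_swap, ← incl₂_swap, h]
  · obtain ⟨t, rfl⟩ := proj₂_surjective B t
    obtain ⟨s, rfl⟩ := B.tensorSwap_bijective.2 t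
    exact ⟨proj₂ B s, swap_proj₂ B s⟩

lemma swap_braid : braidLeft (swap B) ∘ₗ braidRight (swap B) ∘ₗ braidLeft (swap B) =
    braidRight (swap B) ∘ₗ braidLeft (swap B) ∘ₗ braidRight (swap B) := by
  refine LinearMap.ext fun t => incl₃_injective B ?_
  simp only [LinearMap.comp_apply, incl₃, map_braidLeft (incl₂_swap B),
    map_braidRight (incl₂_swap B)]
  exact LinearMap.congr_fun B.tensorSwap_braid (incl₃ B t)

/-- The braiding of the Nichols algebra. -/
noncomputable def braiding : Braiding k B.Nichols where
  c := LinearEquiv.ofBijective (swap B) (swap_bijective B)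
  braid_eq := swap_braid B

/-- The coproduct of the Nichols algebra. -/
noncomputable def comul : B.Nichols →ₗ[k] B.Nichols ⊗[k] B.Nichols :=
  (deconcat k V ∘ₗ incl B).codRestrictOfInjective (incl₂ B) (incl₂_injective B) fun x => by
    obtain ⟨x, rfl⟩ := proj_surjective B x
    refine ⟨proj₂ B (B.unshuffleComul x), ?_⟩
    rw [LinearMap.comp_apply, incl₂_proj₂, incl_proj, deconcat_symmetrize]

lemma incl₂_comul (x : B.Nichols) : incl₂ B (comul B x) = deconcat k V (incl B x) :=
  LinearMap.codRestrictOfInjective_comp_apply ..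

lemma comul_proj (x : 𝕋) : comul B (proj B x) = proj₂ B (B.unshuffleComul x) :=
  incl₂_injective B <| by rw [incl₂_comul, incl₂_proj₂, incl_proj, deconcat_symmetrize]

/-- The counit of the Nichols algebra. -/
noncomputable def counit : B.Nichols →ₗ[k] k := augmentation k V ∘ₗ incl B

lemma map_rTensor_counit (t : B.Nichols ⊗[k] B.Nichols) :
    TensorProduct.map .id (incl B) (LinearMap.rTensor _ (counit B) t) =
      LinearMap.rTensor _ (augmentation k V) (incl₂ B t) :=
  map_rTensor_of_intertwines (f := incl B) (f' := .id) (d := augmentation k V) (fun _ => rfl) _ t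

lemma map_lTensor_counit (t : B.Nichols ⊗[k] B.Nichols) :
    TensorProduct.map (incl B) .id (LinearMap.lTensor _ (counit B) t) =
      LinearMap.lTensor _ (augmentation k V) (incl₂ B t) :=
  map_lTensor_of_intertwines (f := incl B) (f' := .id) (d := augmentation k V) (fun _ => rfl) _ t

noncomputable instance : Coalgebra k B.Nichols where
  comul := comul B
  counit := counit B
  coassoc := by
    refine LinearMap.ext fun x => TensorProduct.map_injective_of_flat_flat _ _ (incl_injective B)
      (incl₂_injective B) ?_
    simp only [LinearMap.comp_apply, LinearEquiv.coe_coe]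
    rw [TensorProduct.map_map_assoc, map_rTensor_of_intertwines (incl₂_comul B),
      map_lTensor_of_intertwines (incl₂_comul B), incl₂_comul]
    exact LinearMap.congr_fun deconcat_coassoc (incl B x)
  rTensor_counit_comp_comul := by
    refine LinearMap.ext fun x => TensorProduct.map_injective_of_flat_flat .id _
      Function.injective_id (incl_injective B) ?_
    rw [LinearMap.comp_apply, map_rTensor_counit, incl₂_comul]
    exact LinearMap.congr_fun rTensor_augmentation_comp_deconcat (incl B x)
  lTensor_counit_comp_comul := by
    refine LinearMap.ext fun x => TensorProduct.map_injective_of_flat_flat _ .id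
      (incl_injective B) Function.injective_id ?_
    rw [LinearMap.comp_apply, map_lTensor_counit, incl₂_comul]
    exact LinearMap.congr_fun lTensor_augmentation_comp_deconcat (incl B x)

lemma counit_apply (x : B.Nichols) :
    Coalgebra.counit (R := k) x = augmentation k V (incl B x) := rfl

lemma counit_one : Coalgebra.counit (R := k) (1 : B.Nichols) = 1 := by
  rw [counit_apply, incl_one, augmentation_one]

/-- The homogeneous components of the Nichols algebra. -/
noncomputable def grade (n : ℕ) : Submodule k B.Nichols := (homog k V n).comap (incl B)

variable {n : ℕ}

lemma mem_grade {x : B.Nichols} : x ∈ grade B n ↔ incl B x ∈ homog k V n := Iff.rfl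

lemma proj_mem_grade {x : 𝕋} (hx : x ∈ homog k V n) : proj B x ∈ grade B n := B.symmetrize_mem hx

lemma exists_of_mem_grade {x : B.Nichols} (hx : x ∈ grade B n) :
    ∃ y ∈ homog k V n, proj B y = x := by
  obtain ⟨y, rfl⟩ := proj_surjective B x
  refine ⟨GradedAlgebra.proj (homog k V) n y, SetLike.coe_mem _, incl_injective B ?_⟩
  rw [incl_proj, ← proj_symmetrize]
  exact proj_apply_of_mem hx

lemma isInternal : DirectSum.IsInternal (grade B) := by
  have hint := DirectSum.Decomposition.isInternal (homog k V)
  refine isInternal_comap hint (incl_injective B) (top_unique ?_)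
  calc ⊤ = (⨆ n, homog k V n).map (proj B) := by
        rw [hint.submodule_iSup_eq_top, Submodule.map_top,
          LinearMap.range_eq_top.2 (proj_surjective B)]
    _ ≤ ⨆ n, grade B n := by
        rw [Submodule.map_iSup]
        exact iSup_mono fun n => Submodule.map_le_iff_le_comap.2 fun x => proj_mem_grade B

lemma proj₂_splitAt_mem {a b N : ℕ} {w : 𝕋} (hw : w ∈ homog k V N) (h : a + b = N) :
    proj₂ B (splitAt k V a w) ∈ tensorSubmodule (grade B a) (grade B b) := by
  subst h
  induction hw using homog_add_induction with
  | mul x hx y hy =>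
    rw [splitAt_mul hx, TensorProduct.map_tmul]
    exact tmul_mem_tensorSubmodule (proj_mem_grade B hx) (proj_mem_grade B hy)
  | add x y _ _ hx hy => rw [map_add, map_add]; exact add_mem hx hy

lemma comulGraded : ComulGraded (grade B) := by
  intro n x hx
  obtain ⟨y, hy, rfl⟩ := exists_of_mem_grade B hx
  change comul B (proj B y) ∈ _
  rw [comul_proj, B.unshuffleComul_apply hy, map_sum]
  refine sum_mem fun p hp => ?_
  have hpn := mem_antidiagonal.1 hp
  exact Submodule.mem_iSup_of_mem p.1 <| Submodule.mem_iSup_of_mem p.2 <|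
    Submodule.mem_iSup_of_mem hpn <| proj₂_splitAt_mem B (B.unshuffle_smul_mem hy hpn.le) hpn

lemma swap_mem {i j : ℕ} {t : B.Nichols ⊗[k] B.Nichols}
    (ht : t ∈ tensorSubmodule (grade B i) (grade B j)) :
    swap B t ∈ tensorSubmodule (grade B j) (grade B i) := by
  suffices h : tensorSubmodule (grade B i) (grade B j) ≤
      (tensorSubmodule (grade B j) (grade B i)).comap (swap B) from h ht
  refine tensorSubmodule_le.2 fun x hx y hy => ?_
  obtain ⟨x, hx', rfl⟩ := exists_of_mem_grade B hx
  obtain ⟨y, hy', rfl⟩ := exists_of_mem_grade B hy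
  have hw := mul_mem_homog hx' hy'
  rw [Submodule.mem_comap, ← TensorProduct.map_tmul, swap_proj₂, ← splitAt_mul hx',
    B.tensorSwap_splitAt hw rfl]
  exact proj₂_splitAt_mem B (B.swap_smul_mem hw le_rfl) (add_comm j i)

lemma grade_zero : grade B 0 = LinearMap.range (Algebra.linearMap k B.Nichols) := by
  ext x
  rw [mem_grade, mem_homog_zero_iff]
  refine exists_congr fun a => ?_
  rw [Algebra.linearMap_apply, Algebra.algebraMap_eq_smul_one, ← (incl_injective B).eq_iff,
    map_smul, incl_one, eq_comm]

lemma range_proj_comp_ι : LinearMap.range (proj B ∘ₗ ι k) = grade B 1 := by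
  ext x
  refine ⟨?_, fun hx => ?_⟩
  · rintro ⟨v, rfl⟩
    exact proj_mem_grade B (ι_mem_homog v)
  · rw [mem_grade, homog, pow_one] at hx
    obtain ⟨v, hv⟩ := hx
    exact ⟨v, incl_injective B (by rw [← hv, LinearMap.comp_apply, incl_proj, symmetrize_ι])⟩

lemma proj_comp_ι_injective : Function.Injective (proj B ∘ₗ ι k) := by
  intro v w hvw
  have h := congrArg (incl B) hvw
  rw [LinearMap.comp_apply, LinearMap.comp_apply, incl_proj, incl_proj, symmetrize_ι,
    symmetrize_ι] at h
  exact TensorAlgebra.ι_leftInverse.injective h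

lemma comul_eq_iff_mem_grade_one {x : B.Nichols} :
    Coalgebra.comul (R := k) x = x ⊗ₜ[k] 1 + 1 ⊗ₜ[k] x ↔ x ∈ grade B 1 := by
  rw [mem_grade, ← deconcat_eq_iff_mem_homog_one, ← (incl₂_injective B).eq_iff]
  refine Eq.congr (incl₂_comul B x) ?_
  rw [map_add, TensorProduct.map_tmul, TensorProduct.map_tmul, incl_one]

lemma adjoin_grade_one : Algebra.adjoin k (grade B 1 : Set B.Nichols) = ⊤ := by
  refine top_unique fun x _ => ?_
  obtain ⟨x, rfl⟩ := proj_surjective B x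
  induction x using induction_cons with
  | one => rw [proj_one]; exact one_mem _
  | smul a x hx => rw [map_smul]; exact Subalgebra.smul_mem _ (hx trivial) a
  | add x y hx hy => rw [map_add]; exact add_mem (hx trivial) (hy trivial)
  | cons v x hx =>
    rw [proj_mul]
    exact mul_mem (Algebra.subset_adjoin (proj_mem_grade B (ι_mem_homog v))) (hx trivial)

lemma swap_mul_left : swap B ∘ₗ LinearMap.rTensor _ (LinearMap.mul' k _) =
    LinearMap.lTensor _ (LinearMap.mul' k _) ∘ₗ (TensorProduct.assoc k _ _ _).toLinearMap ∘ₗ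
      braidLeft (swap B) ∘ₗ braidRight (swap B) := by
  refine LinearMap.ext fun t => incl₂_injective B ?_
  simp only [LinearMap.comp_apply, LinearEquiv.coe_coe]
  rw [incl₂_swap, map_rTensor_of_intertwines (incl_mul' B),
    map_lTensor_of_intertwines (incl_mul' B), TensorProduct.map_map_assoc,
    map_braidLeft (incl₂_swap B), map_braidRight (incl₂_swap B)]
  exact LinearMap.congr_fun B.tensorSwap_mul_left (incl₃ B t)

lemma swap_mul_right : swap B ∘ₗ LinearMap.lTensor _ (LinearMap.mul' k _) ∘ₗ
      (TensorProduct.assoc k _ _ _).toLinearMap =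
    LinearMap.rTensor _ (LinearMap.mul' k _) ∘ₗ braidRight (swap B) ∘ₗ braidLeft (swap B) := by
  refine LinearMap.ext fun t => incl₂_injective B ?_
  simp only [LinearMap.comp_apply, LinearEquiv.coe_coe]
  rw [incl₂_swap, map_rTensor_of_intertwines (incl_mul' B),
    map_lTensor_of_intertwines (incl_mul' B), TensorProduct.map_map_assoc,
    map_braidRight (incl₂_swap B), map_braidLeft (incl₂_swap B)]
  exact LinearMap.congr_fun B.tensorSwap_mul_right (incl₃ B t)

lemma swap_one_left (x : B.Nichols) : swap B (1 ⊗ₜ x) = x ⊗ₜ 1 := incl₂_injective B <| by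
  rw [incl₂_swap, TensorProduct.map_tmul, TensorProduct.map_tmul, incl_one, tensorSwap_one_left]

lemma swap_one_right (x : B.Nichols) : swap B (x ⊗ₜ 1) = 1 ⊗ₜ x := incl₂_injective B <| by
  rw [incl₂_swap, TensorProduct.map_tmul, TensorProduct.map_tmul, incl_one, tensorSwap_one_right]

lemma swap_comul_left : (TensorProduct.assoc k _ _ _).symm.toLinearMap ∘ₗ
      LinearMap.lTensor _ (comul B) ∘ₗ swap B =
    braidLeft (swap B) ∘ₗ braidRight (swap B) ∘ₗ LinearMap.rTensor _ (comul B) := by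
  refine LinearMap.ext fun t => incl₃_injective B ?_
  simp only [LinearMap.comp_apply, LinearEquiv.coe_coe]
  rw [TensorProduct.map_map_assoc_symm, map_lTensor_of_intertwines (incl₂_comul B), incl₂_swap,
    map_braidLeft (incl₂_swap B), map_braidRight (incl₂_swap B),
    map_rTensor_of_intertwines (incl₂_comul B)]
  exact LinearMap.congr_fun B.tensorSwap_comul_left (incl₂ B t)

lemma swap_comul_right : LinearMap.rTensor _ (comul B) ∘ₗ swap B =
    braidRight (swap B) ∘ₗ braidLeft (swap B) ∘ₗ
      (TensorProduct.assoc k _ _ _).symm.toLinearMap ∘ₗ LinearMap.lTensor _ (comul B) := by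
  refine LinearMap.ext fun t => incl₃_injective B ?_
  simp only [LinearMap.comp_apply, LinearEquiv.coe_coe]
  rw [map_rTensor_of_intertwines (incl₂_comul B), incl₂_swap, map_braidRight (incl₂_swap B),
    map_braidLeft (incl₂_swap B), TensorProduct.map_map_assoc_symm,
    map_lTensor_of_intertwines (incl₂_comul B)]
  exact LinearMap.congr_fun B.tensorSwap_comul_right (incl₂ B t)

lemma swap_counit_left :
    (TensorProduct.rid k _).toLinearMap ∘ₗ LinearMap.lTensor _ (counit B) ∘ₗ swap B =
      (TensorProduct.lid k _).toLinearMap ∘ₗ LinearMap.rTensor _ (counit B) := by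
  refine LinearMap.ext fun t => incl_injective B ?_
  simp only [LinearMap.comp_apply, LinearEquiv.coe_coe]
  rw [apply_rid, map_lTensor_counit, incl₂_swap, apply_lid, map_rTensor_counit]
  exact LinearMap.congr_fun B.tensorSwap_counit_left (incl₂ B t)

lemma swap_counit_right :
    (TensorProduct.lid k _).toLinearMap ∘ₗ LinearMap.rTensor _ (counit B) ∘ₗ swap B =
      (TensorProduct.rid k _).toLinearMap ∘ₗ LinearMap.lTensor _ (counit B) := by
  refine LinearMap.ext fun t => incl_injective B ?_
  simp only [LinearMap.comp_apply, LinearEquiv.coe_coe]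
  rw [apply_lid, map_rTensor_counit, incl₂_swap, apply_rid, map_lTensor_counit]
  exact LinearMap.congr_fun B.tensorSwap_counit_right (incl₂ B t)

lemma comul_mul : comul B ∘ₗ LinearMap.mul' k _ =
    TensorProduct.map (LinearMap.mul' k _) (LinearMap.mul' k _) ∘ₗ
      braidMiddle (swap B) ∘ₗ TensorProduct.map (comul B) (comul B) := by
  refine LinearMap.ext fun t => incl₂_injective B ?_
  simp only [LinearMap.comp_apply]
  rw [incl₂_comul, incl_mul', map_map_of_intertwines (incl_mul' B) (incl_mul' B),
    map_braidMiddle (incl₂_swap B), map_map_of_intertwines (incl₂_comul B) (incl₂_comul B)]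
  exact LinearMap.congr_fun B.deconcat_shuffleMul (incl₂ B t)

lemma comul_one : comul B 1 = 1 ⊗ₜ 1 := incl₂_injective B <| by
  rw [incl₂_comul, TensorProduct.map_tmul, incl_one, deconcat_one]

lemma counit_mul (x y : B.Nichols) : Coalgebra.counit (R := k) (x * y) =
    Coalgebra.counit (R := k) x * Coalgebra.counit (R := k) y := by
  simp only [counit_apply, incl_mul, augmentation_shuffleMul]

lemma algebraMap_counit {x : B.Nichols} (hx : x ∈ grade B 0) :
    algebraMap k B.Nichols (Coalgebra.counit x) = x := by
  rw [grade_zero] at hx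
  obtain ⟨a, rfl⟩ := hx
  rw [Algebra.linearMap_apply, Algebra.algebraMap_eq_smul_one a, map_smul, counit_one, smul_eq_mul,
    mul_one, Algebra.algebraMap_eq_smul_one]

/-- The Nichols algebra of a braided vector space as a braided Hopf algebra. -/
noncomputable def braidedHopfAlgebra : BraidedHopfAlgebra k B.Nichols where
  toBraiding := braiding B
  mul_left := swap_mul_left B
  mul_right := swap_mul_right B
  one_left := swap_one_left B
  one_right := swap_one_right B
  comul_left := swap_comul_left B
  comul_right := swap_comul_right B
  counit_left := swap_counit_left B
  counit_right := swap_counit_right B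
  comul_mul := comul_mul B
  comul_one := comul_one B
  counit_mul := counit_mul B
  counit_one := counit_one B
  exists_antipode := (comulGraded B).exists_antipode (isInternal B) fun _ => algebraMap_counit B

theorem isNicholsAlgebra :
    IsNicholsAlgebra B (braidedHopfAlgebra B) (grade B) (proj B ∘ₗ ι k) where
  isInternal := isInternal B
  mul_mem _ _ _ _ hx hy := B.shuffleMul_mem hx hy
  comul_mem := comulGraded B
  counit_eq_zero _ _ hn hx := augmentation_of_pos hn hx
  braiding_mem _ _ _ ht := swap_mem B ht
  degree_zero := grade_zero B
  injective := proj_comp_ι_injective B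
  range_eq := range_proj_comp_ι B
  braiding_eq t := by
    rw [TensorProduct.map_comp, LinearMap.comp_apply, LinearMap.comp_apply, ← tensorSwap_map_ι]
    exact swap_proj₂ B _
  primitive_iff _ := comul_eq_iff_mem_grade_one B
  adjoin_eq := adjoin_grade_one B

end Nichols

end Braiding

/-! ### The braided derivation of a Nichols algebra -/

section Functionals

variable {k M N : Type*} [Field k] [AddCommGroup M] [Module k M] [AddCommGroup N] [Module k N]

/-- The contraction `M ⊗ N → N` of the left tensor factor with a functional `φ` on `M`. -/
def evalLeft (φ : Module.Dual k M) : M ⊗[k] N →ₗ[k] N :=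
  (TensorProduct.lid k N).toLinearMap ∘ₗ LinearMap.rTensor N φ

/-- The contraction `M ⊗ N → M` of the right tensor factor with a functional `ψ` on `N`. -/
def evalRight (ψ : Module.Dual k N) : M ⊗[k] N →ₗ[k] M :=
  (TensorProduct.rid k M).toLinearMap ∘ₗ LinearMap.lTensor M ψ

@[simp] lemma evalLeft_tmul (φ : Module.Dual k M) (x : M) (y : N) :
    evalLeft φ (x ⊗ₜ y) = φ x • y := by simp [evalLeft]

@[simp] lemma evalRight_tmul (ψ : Module.Dual k N) (x : M) (y : N) :
    evalRight ψ (x ⊗ₜ y) = ψ y • x := by simp [evalRight]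

lemma eq_zero_of_evalLeft {t : M ⊗[k] N} (h : ∀ φ : Module.Dual k M, evalLeft φ t = 0) :
    t = 0 := by
  classical
  rw [← (TensorProduct.equivFinsuppOfBasisLeft (Module.Basis.ofVectorSpace k M)).map_eq_zero_iff]
  ext i
  rw [TensorProduct.equivFinsuppOfBasisLeft_apply]
  exact h _

lemma eq_zero_of_evalRight {t : M ⊗[k] N} (h : ∀ ψ : Module.Dual k N, evalRight ψ t = 0) :
    t = 0 := by
  classical
  rw [← (TensorProduct.equivFinsuppOfBasisRight (Module.Basis.ofVectorSpace k N)).map_eq_zero_iff]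
  ext i
  rw [TensorProduct.equivFinsuppOfBasisRight_apply]
  exact h _

lemma evalLeft_lTensor {P : Type*} [AddCommGroup P] [Module k P] (φ : Module.Dual k M)
    (f : N →ₗ[k] P) (t : M ⊗[k] N) :
    evalLeft φ (LinearMap.lTensor M f t) = f (evalLeft φ t) :=
  LinearMap.congr_fun (f := evalLeft φ ∘ₗ LinearMap.lTensor M f) (g := f ∘ₗ evalLeft φ)
    (TensorProduct.ext' fun x y => by simp) t

lemma evalRight_rTensor {P : Type*} [AddCommGroup P] [Module k P] (ψ : Module.Dual k N)
    (f : M →ₗ[k] P) (t : M ⊗[k] N) :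
    evalRight ψ (LinearMap.rTensor N f t) = f (evalRight ψ t) :=
  LinearMap.congr_fun (f := evalRight ψ ∘ₗ LinearMap.rTensor N f) (g := f ∘ₗ evalRight ψ)
    (TensorProduct.ext' fun x y => by simp) t

lemma apply_evalLeft (φ : Module.Dual k M) (ψ : Module.Dual k N) (t : M ⊗[k] N) :
    ψ (evalLeft φ t) = φ (evalRight ψ t) :=
  LinearMap.congr_fun (f := ψ ∘ₗ evalLeft φ) (g := φ ∘ₗ evalRight ψ)
    (TensorProduct.ext' fun x y => by simp [mul_comm]) t

variable [Coalgebra k M]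

lemma evalLeft_counit_comul (x : M) :
    evalLeft Coalgebra.counit (Coalgebra.comul (R := k) x) = x := by
  simp [evalLeft, Coalgebra.rTensor_counit_comul]

lemma evalRight_counit_comul (x : M) :
    evalRight Coalgebra.counit (Coalgebra.comul (R := k) x) = x := by
  simp [evalRight, Coalgebra.lTensor_counit_comul]

lemma counit_evalLeft_comul (φ : Module.Dual k M) (x : M) :
    Coalgebra.counit (evalLeft φ (Coalgebra.comul (R := k) x)) = φ x := by
  rw [apply_evalLeft, evalRight_counit_comul]

lemma comul_eq_of_forall_evalLeft {e y : M} (hε : Coalgebra.counit (R := k) y = 0)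
    (hy : ∀ φ : Module.Dual k M, evalLeft φ (Coalgebra.comul (R := k) y) - φ e • y =
      Coalgebra.counit (R := k) (evalLeft φ (Coalgebra.comul (R := k) y) - φ e • y) • e) :
    Coalgebra.comul (R := k) y = y ⊗ₜ[k] e + e ⊗ₜ[k] y := by
  refine sub_eq_zero.1 (eq_zero_of_evalLeft fun φ => ?_)
  have hφ := hy φ
  rw [map_sub, map_smul, hε, smul_zero, sub_zero, counit_evalLeft_comul] at hφ
  rw [map_sub, map_add, evalLeft_tmul, evalLeft_tmul, ← hφ]
  abel

end Functionals

section DegreeLT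

variable {k : Type u} {R : Type w} [Field k] [AddCommGroup R] [Module k R]
  {𝒜 : ℕ → Submodule k R} {n : ℕ}

/-- The subspace of the elements all of whose components have degree less than `n`. -/
def degreeLT (𝒜 : ℕ → Submodule k R) (n : ℕ) : Submodule k R := ⨆ i, ⨆ (_ : i < n), 𝒜 i

lemma degreeLT_le {S : Submodule k R} : degreeLT 𝒜 n ≤ S ↔ ∀ i < n, 𝒜 i ≤ S := by
  simp only [degreeLT, iSup_le_iff]

lemma le_degreeLT {i : ℕ} (h : i < n) : 𝒜 i ≤ degreeLT 𝒜 n := degreeLT_le.1 le_rfl i h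

lemma eq_zero_of_mem_degreeLT_zero {x : R} (hx : x ∈ degreeLT 𝒜 0) : x = 0 := by
  simpa [degreeLT] using hx

lemma exists_mem_degreeLT (h : ⨆ i, 𝒜 i = ⊤) (x : R) : ∃ n, x ∈ degreeLT 𝒜 n := by
  have hmono : Monotone (degreeLT 𝒜) := fun m n hmn =>
    degreeLT_le.2 fun i hi => le_degreeLT (hi.trans_le hmn)
  refine Submodule.iSup_induction 𝒜 (motive := fun x => ∃ n, x ∈ degreeLT 𝒜 n)
    (h ▸ Submodule.mem_top : x ∈ ⨆ i, 𝒜 i) (fun i x hx => ⟨i + 1, le_degreeLT i.lt_succ_self hx⟩)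
    ⟨0, zero_mem _⟩ ?_
  rintro x y ⟨m, hm⟩ ⟨n, hn⟩
  exact ⟨max m n, add_mem (hmono (le_max_left m n) hm) (hmono (le_max_right m n) hn)⟩

lemma ComulGraded.comul_mem_of_degreeLT [Coalgebra k R] (h𝒜 : ComulGraded 𝒜) {x : R}
    (hx : x ∈ degreeLT 𝒜 n) {W : Submodule k (R ⊗[k] R)}
    (hW : ∀ i j, i + j < n → ∀ a ∈ 𝒜 i, ∀ b ∈ 𝒜 j, a ⊗ₜ b ∈ W) :
    Coalgebra.comul (R := k) x ∈ W := by
  have hle : degreeLT 𝒜 n ≤ W.comap Coalgebra.comul := degreeLT_le.2 fun m hm x hx =>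
    h𝒜.comul_mem hx fun i j hij => hW i j (hij.trans_lt hm)
  exact hle hx

end DegreeLT

namespace BraidedHopfAlgebra

variable {k : Type u} {R : Type w} [Field k] [Ring R] [Algebra k R] [Coalgebra k R]
  (H : BraidedHopfAlgebra k R)

lemma mul'_braidMiddle_tmul_one (x : R) (t : R ⊗[k] R) :
    TensorProduct.map (LinearMap.mul' k R) (LinearMap.mul' k R)
        (braidMiddle H.c.toLinearMap ((x ⊗ₜ 1) ⊗ₜ t)) =
      LinearMap.rTensor R (LinearMap.mulLeft k x) t := by
  induction t using TensorProduct.induction_on with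
  | zero => simp only [TensorProduct.tmul_zero, map_zero]
  | tmul a b => simp [braidMiddle, H.one_left]
  | add s t hs ht => simp only [TensorProduct.tmul_add, map_add, hs, ht]

lemma mul'_braidMiddle_one_tmul (x a b : R) :
    TensorProduct.map (LinearMap.mul' k R) (LinearMap.mul' k R)
        (braidMiddle H.c.toLinearMap ((1 ⊗ₜ x) ⊗ₜ (a ⊗ₜ b))) =
      LinearMap.lTensor R (LinearMap.mulRight k b) (H.c (x ⊗ₜ a)) := by
  simp only [braidMiddle, LinearMap.comp_apply, LinearEquiv.coe_coe, TensorProduct.assoc_tmul,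
    LinearMap.lTensor_tmul, TensorProduct.assoc_symm_tmul, LinearMap.rTensor_tmul]
  generalize H.c (x ⊗ₜ a) = t
  induction t using TensorProduct.induction_on with
  | zero => simp only [TensorProduct.zero_tmul, TensorProduct.tmul_zero, map_zero]
  | tmul a b => simp
  | add s t hs ht => simp only [TensorProduct.add_tmul, TensorProduct.tmul_add, map_add, hs, ht]

end BraidedHopfAlgebra

namespace IsNicholsAlgebra

variable {k : Type u} {V : Type v} {R : Type w} [Field k] [AddCommGroup V] [Module k V] [Ring R]
  [Algebra k R] [Coalgebra k R] {B : Braiding k V} {H : BraidedHopfAlgebra k R}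
  {𝒜 : ℕ → Submodule k R} {ι : V →ₗ[k] R} (h : IsNicholsAlgebra B H 𝒜 ι)

include h

lemma comulGraded : ComulGraded 𝒜 := h.comul_mem

lemma ι_mem (v : V) : ι v ∈ 𝒜 1 := h.range_eq ▸ LinearMap.mem_range_self ι v

lemma one_mem : (1 : R) ∈ 𝒜 0 := h.degree_zero ▸ ⟨1, map_one (algebraMap k R)⟩

lemma exists_smul_one {x : R} (hx : x ∈ 𝒜 0) : ∃ a : k, x = a • 1 := by
  rw [h.degree_zero] at hx
  obtain ⟨a, rfl⟩ := hx
  exact ⟨a, Algebra.algebraMap_eq_smul_one a⟩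

lemma comul_ι (v : V) : Coalgebra.comul (R := k) (ι v) = ι v ⊗ₜ 1 + 1 ⊗ₜ ι v :=
  (h.primitive_iff _).2 (h.ι_mem v)

lemma exists_degreeOne :
    ∃ p : R →ₗ[k] V, (∀ v, p (ι v) = v) ∧ ∀ n ≠ 1, ∀ x ∈ 𝒜 n, p x = 0 := by
  obtain ⟨g, hg⟩ := LinearMap.exists_leftInverse_of_injective ι (LinearMap.ker_eq_bot.2 h.injective)
  obtain ⟨p, hp⟩ := exists_linearMap_of_isInternal h.isInternal fun n => if n = 1 then g else 0
  refine ⟨p, fun v => ?_, fun n hn x hx => ?_⟩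
  · rw [hp 1 _ (h.ι_mem v), if_pos rfl]
    exact LinearMap.congr_fun hg v
  · rw [hp n x hx, if_neg hn, LinearMap.zero_apply]

/-- The projection of a Nichols algebra onto its degree one component, identified with `V`. -/
noncomputable def degreeOne : R →ₗ[k] V := Classical.choose h.exists_degreeOne

lemma degreeOne_ι (v : V) : h.degreeOne (ι v) = v :=
  (Classical.choose_spec h.exists_degreeOne).1 v

lemma degreeOne_of_mem {n : ℕ} (hn : n ≠ 1) {x : R} (hx : x ∈ 𝒜 n) : h.degreeOne x = 0 :=
  (Classical.choose_spec h.exists_degreeOne).2 n hn x hx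

lemma degreeOne_one : h.degreeOne 1 = 0 := h.degreeOne_of_mem zero_ne_one h.one_mem

lemma degreeOne_ι_mul (v : V) (x : R) :
    h.degreeOne (ι v * x) = Coalgebra.counit (R := k) x • v := by
  refine LinearMap.congr_fun (f := h.degreeOne ∘ₗ LinearMap.mulLeft k (ι v))
    (g := LinearMap.toSpanSingleton k V v ∘ₗ Coalgebra.counit)
    (linearMap_ext_of_isInternal h.isInternal fun n x hx => ?_) x
  simp only [LinearMap.comp_apply, LinearMap.mulLeft_apply, LinearMap.toSpanSingleton_apply]
  obtain rfl | hn := eq_or_ne n 0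
  · obtain ⟨a, rfl⟩ := h.exists_smul_one hx
    rw [mul_smul_comm, mul_one, map_smul, h.degreeOne_ι, map_smul, H.counit_one, smul_eq_mul,
      mul_one]
  · rw [h.degreeOne_of_mem (by omega) (h.mul_mem 1 n _ _ (h.ι_mem v) hx),
      h.counit_eq_zero n x hn hx, zero_smul]

lemma lTensor_degreeOne_mulRight {t : R ⊗[k] R} (ht : t ∈ tensorSubmodule ⊤ (𝒜 1)) (b : R) :
    LinearMap.lTensor R h.degreeOne (LinearMap.lTensor R (LinearMap.mulRight k b) t) =
      Coalgebra.counit (R := k) b • LinearMap.lTensor R h.degreeOne t := by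
  have hle : tensorSubmodule ⊤ (𝒜 1) ≤ LinearMap.eqLocus
      (LinearMap.lTensor R h.degreeOne ∘ₗ LinearMap.lTensor R (LinearMap.mulRight k b))
      (Coalgebra.counit (R := k) b • LinearMap.lTensor R h.degreeOne) := by
    refine tensorSubmodule_le.2 fun x _ y hy => ?_
    obtain ⟨v, rfl⟩ : y ∈ LinearMap.range ι := by rwa [h.range_eq]
    simp [LinearMap.mem_eqLocus, h.degreeOne_ι_mul, h.degreeOne_ι]
  exact hle ht

lemma c_ι_mem (v : V) (x : R) : H.c (ι v ⊗ₜ x) ∈ tensorSubmodule ⊤ (𝒜 1) := by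
  have hle : ⊤ ≤ (tensorSubmodule ⊤ (𝒜 1)).comap
      (H.c.toLinearMap ∘ₗ TensorProduct.mk k R R (ι v)) := by
    refine h.isInternal.submodule_iSup_eq_top.ge.trans (iSup_le fun n x hx => ?_)
    have hle : tensorSubmodule (𝒜 n) (𝒜 1) ≤ tensorSubmodule ⊤ (𝒜 1) :=
      tensorSubmodule_le.2 fun x _ y hy => tmul_mem_tensorSubmodule trivial hy
    exact hle (h.braiding_mem 1 n _ (tmul_mem_tensorSubmodule (h.ι_mem v) hx))
  exact hle trivial

/-- The braided derivation `R → R ⊗ V` of a Nichols algebra: the component of the coproduct in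
`R ⊗ V`. Its contractions with functionals on `V` are the skew derivations of `R`. -/
noncomputable def derivation : R →ₗ[k] R ⊗[k] V :=
  LinearMap.lTensor R h.degreeOne ∘ₗ Coalgebra.comul

lemma derivation_apply (x : R) :
    h.derivation x = LinearMap.lTensor R h.degreeOne (Coalgebra.comul x) := rfl

lemma derivation_one : h.derivation 1 = 0 := by
  rw [derivation_apply, H.comul_one, LinearMap.lTensor_tmul, degreeOne_one, TensorProduct.tmul_zero]

lemma derivation_ι (v : V) : h.derivation (ι v) = 1 ⊗ₜ v := by
  rw [derivation_apply, h.comul_ι, map_add, LinearMap.lTensor_tmul, LinearMap.lTensor_tmul,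
    degreeOne_one, degreeOne_ι, TensorProduct.tmul_zero, zero_add]

lemma lTensor_degreeOne_braidMiddle (v : V) (t : R ⊗[k] R) :
    LinearMap.lTensor R h.degreeOne (TensorProduct.map (LinearMap.mul' k R) (LinearMap.mul' k R)
        (braidMiddle H.c.toLinearMap ((1 ⊗ₜ ι v) ⊗ₜ t))) =
      LinearMap.lTensor R h.degreeOne (H.c (ι v ⊗ₜ evalRight Coalgebra.counit t)) := by
  induction t using TensorProduct.induction_on with
  | zero => simp only [TensorProduct.tmul_zero, map_zero]
  | tmul a b => rw [H.mul'_braidMiddle_one_tmul, h.lTensor_degreeOne_mulRight (h.c_ι_mem v a),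
      evalRight_tmul, TensorProduct.tmul_smul, map_smul, map_smul]
  | add s t hs ht => simp only [TensorProduct.tmul_add, map_add, hs, ht]

theorem derivation_ι_mul (v : V) (x : R) : h.derivation (ι v * x) =
    LinearMap.rTensor V (LinearMap.mulLeft k (ι v)) (h.derivation x) +
      LinearMap.lTensor R h.degreeOne (H.c (ι v ⊗ₜ x)) := by
  have comul_ι_mul : Coalgebra.comul (R := k) (ι v * x) =
      TensorProduct.map (LinearMap.mul' k R) (LinearMap.mul' k R)
        (braidMiddle H.c.toLinearMap (Coalgebra.comul (ι v) ⊗ₜ Coalgebra.comul x)) :=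
    LinearMap.congr_fun H.comul_mul (ι v ⊗ₜ x)
  rw [derivation_apply, comul_ι_mul, h.comul_ι, TensorProduct.add_tmul, map_add, map_add, map_add,
    H.mul'_braidMiddle_tmul_one, lTensor_degreeOne_braidMiddle, evalRight_counit_comul,
    derivation_apply, ← LinearMap.comp_apply, LinearMap.lTensor_comp_rTensor,
    ← LinearMap.rTensor_comp_lTensor, LinearMap.comp_apply]

lemma lTensor_derivation_comul (x : R) : LinearMap.lTensor R h.derivation
    (Coalgebra.comul (R := k) x) = TensorProduct.assoc k R R V
      (LinearMap.rTensor V (Coalgebra.comul (R := k)) (h.derivation x)) := by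
  have comm (t : R ⊗[k] R) : LinearMap.lTensor (R ⊗[k] R) h.degreeOne
      (LinearMap.rTensor R Coalgebra.comul t) =
        LinearMap.rTensor V Coalgebra.comul (LinearMap.lTensor R h.degreeOne t) := by
    rw [← LinearMap.comp_apply, LinearMap.lTensor_comp_rTensor, ← LinearMap.rTensor_comp_lTensor,
      LinearMap.comp_apply]
  rw [derivation_apply, ← comm, LinearMap.lTensor_tensor, derivation, LinearMap.lTensor_comp,
    LinearMap.comp_apply, ← Coalgebra.coassoc_apply]
  simp only [LinearMap.comp_apply, LinearEquiv.coe_coe, LinearEquiv.apply_symm_apply]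

lemma derivation_evalLeft_comul (φ : Module.Dual k R) {x : R} (hx : h.derivation x = 0) :
    h.derivation (evalLeft φ (Coalgebra.comul (R := k) x)) = 0 := by
  rw [← evalLeft_lTensor, h.lTensor_derivation_comul, hx, map_zero, map_zero, map_zero]

lemma evalLeft_comul_mem (φ : Module.Dual k R) {n : ℕ} {x : R} (hx : x ∈ degreeLT 𝒜 (n + 1)) :
    evalLeft φ (Coalgebra.comul (R := k) x) - φ 1 • x ∈ degreeLT 𝒜 n := by
  let L : R ⊗[k] R →ₗ[k] R := evalLeft φ - φ 1 • evalLeft Coalgebra.counit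
  have hL : Coalgebra.comul (R := k) x ∈ (degreeLT 𝒜 n).comap L := by
    refine h.comulGraded.comul_mem_of_degreeLT hx fun i j hij a ha b hb => ?_
    obtain rfl | hi := eq_or_ne i 0
    · obtain ⟨r, rfl⟩ := h.exists_smul_one ha
      have : L ((r • 1) ⊗ₜ b) = 0 := by simp [L, H.counit_one, smul_smul, mul_comm]
      rw [Submodule.mem_comap, this]
      exact zero_mem _
    · have : L (a ⊗ₜ b) = φ a • b := by simp [L, h.counit_eq_zero i a hi ha]
      rw [Submodule.mem_comap, this]
      exact Submodule.smul_mem _ _ (le_degreeLT (by omega) hb)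
  rwa [Submodule.mem_comap, LinearMap.sub_apply, LinearMap.smul_apply,
    evalLeft_counit_comul] at hL

lemma evalRight_derivation_mem (ψ : Module.Dual k V) {n : ℕ} {x : R}
    (hx : x ∈ degreeLT 𝒜 (n + 1)) : evalRight ψ (h.derivation x) ∈ degreeLT 𝒜 n := by
  refine h.comulGraded.comul_mem_of_degreeLT (W := (degreeLT 𝒜 n).comap
    (evalRight ψ ∘ₗ LinearMap.lTensor R h.degreeOne)) hx fun i j hij a ha b hb => ?_
  rw [Submodule.mem_comap, LinearMap.comp_apply, LinearMap.lTensor_tmul, evalRight_tmul]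
  obtain rfl | hj := eq_or_ne j 1
  · exact Submodule.smul_mem _ _ (le_degreeLT (by omega) ha)
  · rw [h.degreeOne_of_mem hj hb, map_zero, zero_smul]
    exact zero_mem _

-- By induction on the degree all contractions of `Δ y - y ⊗ 1 - 1 ⊗ y` vanish for `y = x - ε x`,
-- so `y` is primitive, hence of degree one, where the derivation is injective.
theorem eq_counit_of_derivation_eq_zero {x : R} (hx : h.derivation x = 0) :
    x = Coalgebra.counit (R := k) x • 1 := by
  obtain ⟨n, hn⟩ := exists_mem_degreeLT h.isInternal.submodule_iSup_eq_top x
  induction n generalizing x with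
  | zero => rw [eq_zero_of_mem_degreeLT_zero hn, map_zero, zero_smul]
  | succ n ih =>
    obtain ⟨y, hy⟩ : ∃ y, y = x - Coalgebra.counit (R := k) x • 1 := ⟨_, rfl⟩
    have y_mem : y ∈ degreeLT 𝒜 (n + 1) := by
      rw [hy]
      exact sub_mem hn (Submodule.smul_mem _ _ (le_degreeLT n.succ_pos h.one_mem))
    have derivation_y : h.derivation y = 0 := by
      rw [hy, map_sub, hx, map_smul, h.derivation_one, smul_zero, sub_zero]
    have counit_y : Coalgebra.counit (R := k) y = 0 := by
      rw [hy, map_sub, map_smul, H.counit_one, smul_eq_mul, mul_one, sub_self]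
    have primitive_y := comul_eq_of_forall_evalLeft counit_y fun φ =>
      ih (by rw [map_sub, map_smul, derivation_y, smul_zero, sub_zero,
        h.derivation_evalLeft_comul φ derivation_y]) (h.evalLeft_comul_mem φ y_mem)
    obtain ⟨v, rfl⟩ : y ∈ LinearMap.range ι := h.range_eq ▸ (h.primitive_iff y).1 primitive_y
    have v_eq_zero : v = 0 := by
      simpa [h.derivation_ι, H.counit_one] using
        congrArg (evalLeft (Coalgebra.counit (R := k))) derivation_y
    rw [v_eq_zero, map_zero] at hy
    exact sub_eq_zero.1 hy.symm

theorem eq_bot_of_derivation_stable {K : Submodule k R}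
    (hε : ∀ x ∈ K, Coalgebra.counit (R := k) x = 0)
    (hK : ∀ x ∈ K, ∀ ψ : Module.Dual k V, evalRight ψ (h.derivation x) ∈ K) : K = ⊥ := by
  have eq_zero (n : ℕ) : ∀ x ∈ K, x ∈ degreeLT 𝒜 n → x = 0 := by
    induction n with
    | zero => exact fun x _ hx => eq_zero_of_mem_degreeLT_zero hx
    | succ n ih =>
      intro x hxK hx
      have derivation_x : h.derivation x = 0 := eq_zero_of_evalRight fun ψ =>
        ih _ (hK x hxK ψ) (h.evalRight_derivation_mem ψ hx)
      rw [h.eq_counit_of_derivation_eq_zero derivation_x, hε x hxK, zero_smul]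
  refine eq_bot_iff.2 fun x hx => ?_
  obtain ⟨n, hn⟩ := exists_mem_degreeLT h.isInternal.submodule_iSup_eq_top x
  exact eq_zero n x hx hn

end IsNicholsAlgebra

/-! ### Uniqueness and automorphisms -/

namespace BraidedHopfAlgebra

variable {k : Type u} {R : Type w} [Field k] [Ring R] [Algebra k R] [Coalgebra k R]
  (H : BraidedHopfAlgebra k R)

lemma c_mul_tmul (x y z : R) : H.c ((x * y) ⊗ₜ z) =
    LinearMap.lTensor R (LinearMap.mul' k R) (TensorProduct.assoc k R R R
      (LinearMap.rTensor R (H.c.toLinearMap ∘ₗ TensorProduct.mk k R R x) (H.c (y ⊗ₜ z)))) := by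
  have braidLeft_assoc_symm (t : R ⊗[k] R) :
      braidLeft H.c.toLinearMap ((TensorProduct.assoc k R R R).symm (x ⊗ₜ t)) =
        LinearMap.rTensor R (H.c.toLinearMap ∘ₗ TensorProduct.mk k R R x) t :=
    LinearMap.congr_fun (f := braidLeft H.c.toLinearMap ∘ₗ
      (TensorProduct.assoc k R R R).symm.toLinearMap ∘ₗ TensorProduct.mk k R (R ⊗[k] R) x)
      (g := LinearMap.rTensor R (H.c.toLinearMap ∘ₗ TensorProduct.mk k R R x))
      (TensorProduct.ext' fun _ _ => rfl) t
  rw [← braidLeft_assoc_symm]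
  exact LinearMap.congr_fun H.mul_left ((x ⊗ₜ y) ⊗ₜ z)

lemma c_tmul_mul (x y z : R) : H.c (x ⊗ₜ (y * z)) =
    LinearMap.rTensor R (LinearMap.mul' k R) ((TensorProduct.assoc k R R R).symm
      (LinearMap.lTensor R (H.c.toLinearMap ∘ₗ (TensorProduct.mk k R R).flip z)
        (H.c (x ⊗ₜ y)))) := by
  have braidRight_tmul (t : R ⊗[k] R) : braidRight H.c.toLinearMap (t ⊗ₜ z) =
      (TensorProduct.assoc k R R R).symm
        (LinearMap.lTensor R (H.c.toLinearMap ∘ₗ (TensorProduct.mk k R R).flip z) t) :=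
    LinearMap.congr_fun
      (f := braidRight H.c.toLinearMap ∘ₗ (TensorProduct.mk k (R ⊗[k] R) R).flip z)
      (g := (TensorProduct.assoc k R R R).symm.toLinearMap ∘ₗ
        LinearMap.lTensor R (H.c.toLinearMap ∘ₗ (TensorProduct.mk k R R).flip z))
      (TensorProduct.ext' fun _ _ => rfl) t
  rw [← braidRight_tmul]
  exact LinearMap.congr_fun H.mul_right ((x ⊗ₜ y) ⊗ₜ z)

lemma comul_mul_apply (x y : R) : Coalgebra.comul (R := k) (x * y) =
    TensorProduct.map (LinearMap.mul' k R) (LinearMap.mul' k R)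
      (braidMiddle H.c.toLinearMap (Coalgebra.comul x ⊗ₜ Coalgebra.comul y)) :=
  LinearMap.congr_fun H.comul_mul (x ⊗ₜ y)

variable {H}

lemma aut_map_one (f : H.Aut) : (f : R ≃ₗ[k] R) 1 = 1 := by
  obtain ⟨x, hx⟩ := (f : R ≃ₗ[k] R).surjective 1
  have map_x_mul_one := f.2.1 x 1
  rwa [mul_one, hx, one_mul, eq_comm] at map_x_mul_one

end BraidedHopfAlgebra

namespace QuantumShuffle

variable {k : Type u} {V : Type v} {A A' : Type*} [CommSemiring k] [AddCommMonoid V] [Module k V]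
  [Semiring A] [Algebra k A] [Semiring A'] [Algebra k A']

lemma algHom_lift_apply {f : A →ₐ[k] A'} {j : V →ₗ[k] A} {j' : V →ₗ[k] A'}
    (hf : ∀ v, f (j v) = j' v) (t : TensorAlgebra k V) :
    f (TensorAlgebra.lift k j t) = TensorAlgebra.lift k j' t := by
  have comp_lift : f.comp (TensorAlgebra.lift k j) = TensorAlgebra.lift k j' := by
    ext v
    simp [hf]
  exact DFunLike.congr_fun comp_lift t

lemma algHom_mul'_apply (f : A →ₐ[k] A') (t : A ⊗[k] A) : f.toLinearMap (LinearMap.mul' k A t) =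
    LinearMap.mul' k A' (TensorProduct.map f.toLinearMap f.toLinearMap t) :=
  LinearMap.congr_fun (AlgHom.comp_mul' f) t

end QuantumShuffle

namespace IsNicholsAlgebra

open QuantumShuffle

open TensorAlgebra (lift)

variable {k : Type u} {V : Type v} {R : Type w} [Field k] [AddCommGroup V] [Module k V] [Ring R]
  [Algebra k R] [Coalgebra k R] {B : Braiding k V} {H : BraidedHopfAlgebra k R}
  {𝒜 : ℕ → Submodule k R} {ι : V →ₗ[k] R}

section Lift

variable (h : IsNicholsAlgebra B H 𝒜 ι)

include h

lemma lift_surjective : Function.Surjective (lift k ι) := by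
  rw [← AlgHom.range_eq_top, TensorAlgebra.range_lift, ← LinearMap.coe_range, h.range_eq,
    h.adjoin_eq]

theorem induction_ι_mul {C : R → Prop} (one : C 1) (smul : ∀ (a : k) x, C x → C (a • x))
    (add : ∀ x y, C x → C y → C (x + y)) (ι_mul : ∀ v x, C x → C (ι v * x)) (x : R) : C x := by
  obtain ⟨t, rfl⟩ := h.lift_surjective x
  induction t using induction_cons with
  | one => rwa [map_one]
  | smul a t ht => rw [map_smul]; exact smul a _ ht
  | add s t hs ht => rw [map_add]; exact add _ _ hs ht
  | cons v t ht => rw [map_mul, TensorAlgebra.lift_ι_apply]; exact ι_mul v _ ht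

lemma counit_lift (t : TensorAlgebra k V) :
    Coalgebra.counit (R := k) (lift k ι t) = augmentation k V t := by
  induction t using induction_cons with
  | one => rw [map_one, H.counit_one, augmentation_one]
  | smul a t ht => rw [map_smul, map_smul, map_smul, ht]
  | add s t hs ht => rw [map_add, map_add, map_add, hs, ht]
  | cons v t _ =>
    rw [map_mul, TensorAlgebra.lift_ι_apply, H.counit_mul,
      h.counit_eq_zero 1 _ one_ne_zero (h.ι_mem v), zero_mul, augmentation_cons]

/-- If `U v` represents the braiding of a vector `v` with a tensor `t`, as an element of
`T(V) ⊗ V`, then `braidCons U (c (v ⊗ w))` represents the braiding of `v` with `w * t`. -/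
def braidCons (U : V →ₗ[k] TensorAlgebra k V ⊗[k] V) : V ⊗[k] V →ₗ[k] TensorAlgebra k V ⊗[k] V :=
  LinearMap.rTensor V (cons k V) ∘ₗ
    (TensorProduct.assoc k V (TensorAlgebra k V) V).symm.toLinearMap ∘ₗ LinearMap.lTensor V U

lemma map_braidCons {t : TensorAlgebra k V} {U : V →ₗ[k] TensorAlgebra k V ⊗[k] V}
    (hU : ∀ v, TensorProduct.map (lift k ι).toLinearMap ι (U v) = H.c (ι v ⊗ₜ lift k ι t))
    (v w : V) : TensorProduct.map (lift k ι).toLinearMap ι (braidCons U (B.c (v ⊗ₜ w))) =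
      H.c (ι v ⊗ₜ lift k ι (TensorAlgebra.ι k w * t)) := by
  have lift_cons (z : V ⊗[k] TensorAlgebra k V) : (lift k ι).toLinearMap (cons k V z) =
      LinearMap.mul' k R (TensorProduct.map ι (lift k ι).toLinearMap z) :=
    LinearMap.congr_fun (f := (lift k ι).toLinearMap ∘ₗ cons k V)
      (g := LinearMap.mul' k R ∘ₗ TensorProduct.map ι (lift k ι).toLinearMap)
      (TensorProduct.ext' fun v x => by simp) z
  have c_ι_ι : H.c (ι v ⊗ₜ ι w) = TensorProduct.map ι ι (B.c (v ⊗ₜ w)) := h.braiding_eq (v ⊗ₜ w)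
  rw [map_mul, TensorAlgebra.lift_ι_apply, H.c_tmul_mul, c_ι_ι, braidCons, LinearMap.comp_apply,
    LinearMap.comp_apply, map_rTensor_of_intertwines lift_cons, LinearEquiv.coe_coe,
    TensorProduct.map_map_assoc_symm, map_lTensor_of_intertwines
      (d := H.c.toLinearMap ∘ₗ (TensorProduct.mk k R R).flip (lift k ι t)) hU]

lemma rTensor_lift_derivation_cons {t : TensorAlgebra k V} {u y : TensorAlgebra k V ⊗[k] V} {v : V}
    (hu : LinearMap.rTensor V (lift k ι).toLinearMap u = h.derivation (lift k ι t))
    (hy : TensorProduct.map (lift k ι).toLinearMap ι y = H.c (ι v ⊗ₜ lift k ι t)) :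
    LinearMap.rTensor V (lift k ι).toLinearMap
        (LinearMap.rTensor V (LinearMap.mulLeft k (TensorAlgebra.ι k v)) u + y) =
      h.derivation (lift k ι (TensorAlgebra.ι k v * t)) := by
  have lift_mulLeft : (lift k ι).toLinearMap ∘ₗ LinearMap.mulLeft k (TensorAlgebra.ι k v) =
      LinearMap.mulLeft k (ι v) ∘ₗ (lift k ι).toLinearMap := LinearMap.ext fun x => by simp
  have degreeOne_comp_ι : h.degreeOne ∘ₗ ι = .id := LinearMap.ext h.degreeOne_ι
  rw [map_mul, TensorAlgebra.lift_ι_apply, h.derivation_ι_mul, ← hu, ← hy, map_add,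
    ← LinearMap.rTensor_comp_apply, lift_mulLeft, LinearMap.rTensor_comp_apply,
    ← LinearMap.comp_apply (LinearMap.lTensor _ _), LinearMap.lTensor_comp_map, degreeOne_comp_ι]
  rfl

end Lift

section Comparison

variable {R' : Type*} [Ring R'] [Algebra k R'] [Coalgebra k R'] {H' : BraidedHopfAlgebra k R'}
  {𝒜' : ℕ → Submodule k R'} {ι' : V →ₗ[k] R'} (h : IsNicholsAlgebra B H 𝒜 ι)
  (h' : IsNicholsAlgebra B H' 𝒜' ι')

include h h'

lemma exists_lift_c (t : TensorAlgebra k V) : ∃ U : V →ₗ[k] TensorAlgebra k V ⊗[k] V,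
    (∀ v, TensorProduct.map (lift k ι).toLinearMap ι (U v) = H.c (ι v ⊗ₜ lift k ι t)) ∧
      ∀ v, TensorProduct.map (lift k ι').toLinearMap ι' (U v) = H'.c (ι' v ⊗ₜ lift k ι' t) := by
  induction t using induction_cons with
  | one =>
    exact ⟨TensorProduct.mk k _ _ 1, fun v => by simp [H.one_right],
      fun v => by simp [H'.one_right]⟩
  | smul a x hx =>
    obtain ⟨U, hU, hU'⟩ := hx
    exact ⟨a • U, fun v => by simp [hU], fun v => by simp [hU']⟩
  | add x y hx hy =>
    obtain ⟨U, hU, hU'⟩ := hx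
    obtain ⟨W, hW, hW'⟩ := hy
    exact ⟨U + W, fun v => by simp [hU, hW, TensorProduct.tmul_add],
      fun v => by simp [hU', hW', TensorProduct.tmul_add]⟩
  | cons w x hx =>
    obtain ⟨U, hU, hU'⟩ := hx
    exact ⟨braidCons U ∘ₗ B.c.toLinearMap ∘ₗ (TensorProduct.mk k V V).flip w,
      fun v => h.map_braidCons hU v w, fun v => h'.map_braidCons hU' v w⟩

lemma exists_lift_derivation (t : TensorAlgebra k V) : ∃ u : TensorAlgebra k V ⊗[k] V,
    LinearMap.rTensor V (lift k ι).toLinearMap u = h.derivation (lift k ι t) ∧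
      LinearMap.rTensor V (lift k ι').toLinearMap u = h'.derivation (lift k ι' t) := by
  induction t using induction_cons with
  | one => exact ⟨0, by simp [h.derivation_one], by simp [h'.derivation_one]⟩
  | smul a x hx =>
    obtain ⟨u, hu, hu'⟩ := hx
    exact ⟨a • u, by simp [hu], by simp [hu']⟩
  | add x y hx hy =>
    obtain ⟨u, hu, hu'⟩ := hx
    obtain ⟨w, hw, hw'⟩ := hy
    exact ⟨u + w, by simp [hu, hw], by simp [hu', hw']⟩
  | cons v x hx =>
    obtain ⟨u, hu, hu'⟩ := hx
    obtain ⟨U, hU, hU'⟩ := exists_lift_c h h' x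
    exact ⟨_, h.rTensor_lift_derivation_cons hu (hU v), h'.rTensor_lift_derivation_cons hu' (hU' v)⟩

-- The image in `R'` of the kernel of `T(V) → R` is a subspace of the augmentation ideal that is
-- stable under the skew derivations.
theorem ker_lift_le : RingHom.ker (lift k ι) ≤ RingHom.ker (lift k ι') := by
  suffices ((LinearMap.ker (lift k ι).toLinearMap).map (lift k ι').toLinearMap) = ⊥ from
    fun t ht => LinearMap.le_ker_iff_map.2 this ht
  refine h'.eq_bot_of_derivation_stable ?_ ?_
  · rintro _ ⟨t, ht, rfl⟩
    have lift_t : lift k ι t = 0 := ht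
    rw [AlgHom.toLinearMap_apply, h'.counit_lift, ← h.counit_lift, lift_t, map_zero]
  · rintro _ ⟨t, ht, rfl⟩ ψ
    have lift_t : lift k ι t = 0 := ht
    obtain ⟨u, hu, hu'⟩ := exists_lift_derivation h h' t
    refine ⟨evalRight ψ u, ?_, ?_⟩
    · rw [SetLike.mem_coe, LinearMap.mem_ker, ← evalRight_rTensor, hu, lift_t, map_zero, map_zero]
    · rw [← evalRight_rTensor, hu', AlgHom.toLinearMap_apply]

theorem exists_algEquiv : ∃ f : R ≃ₐ[k] R', ∀ v, f (ι v) = ι' v := by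
  let e := Ideal.quotientKerAlgEquivOfSurjective h.lift_surjective
  let e' := Ideal.quotientKerAlgEquivOfSurjective h'.lift_surjective
  have ker_eq := (ker_lift_le h h').antisymm (ker_lift_le h' h)
  refine ⟨e.symm.trans ((Ideal.quotientEquivAlgOfEq k ker_eq).trans e'), fun v => ?_⟩
  have e_symm : e.symm (ι v) = Ideal.Quotient.mk _ (TensorAlgebra.ι k v) := by
    rw [AlgEquiv.symm_apply_eq]
    exact (TensorAlgebra.lift_ι_apply ι v).symm
  rw [AlgEquiv.trans_apply, e_symm]
  exact TensorAlgebra.lift_ι_apply ι' v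

variable {f : R →ₐ[k] R'} (hf : ∀ v, f (ι v) = ι' v)

include hf

lemma map_c_ι (v : V) (y : R) : TensorProduct.map f.toLinearMap f.toLinearMap (H.c (ι v ⊗ₜ y)) =
    H'.c (ι' v ⊗ₜ f y) := by
  obtain ⟨t, rfl⟩ := h.lift_surjective y
  obtain ⟨U, hU, hU'⟩ := exists_lift_c h h' t
  rw [← hU, algHom_lift_apply hf, ← hU', TensorProduct.map_map]
  congr 2
  · exact LinearMap.ext (algHom_lift_apply hf)
  · exact LinearMap.ext hf

theorem map_c (t : R ⊗[k] R) : TensorProduct.map f.toLinearMap f.toLinearMap (H.c t) =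
    H'.c (TensorProduct.map f.toLinearMap f.toLinearMap t) := by
  suffices ∀ x y, TensorProduct.map f.toLinearMap f.toLinearMap (H.c (x ⊗ₜ y)) =
      H'.c (f x ⊗ₜ f y) from
    LinearMap.congr_fun (f := TensorProduct.map f.toLinearMap f.toLinearMap ∘ₗ H.c.toLinearMap)
      (g := H'.c.toLinearMap ∘ₗ TensorProduct.map f.toLinearMap f.toLinearMap)
      (TensorProduct.ext' this) t
  intro x
  induction x using h.induction_ι_mul with
  | one => intro y; simp [H.one_left, H'.one_left]
  | smul a x hx => intro y; simp only [map_smul, ← TensorProduct.smul_tmul', hx]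
  | add x z hx hz => intro y; simp only [map_add, TensorProduct.add_tmul, hx, hz]
  | ι_mul v x hx =>
    intro y
    rw [H.c_mul_tmul, map_mul, hf, H'.c_mul_tmul, ← hx,
      map_lTensor_of_intertwines (algHom_mul'_apply f), TensorProduct.map_map_assoc,
      map_rTensor_of_intertwines (f := f.toLinearMap)
        (d := H'.c.toLinearMap ∘ₗ TensorProduct.mk k R' R' (ι' v)) (map_c_ι h h' hf v)]

theorem map_comul (x : R) : TensorProduct.map f.toLinearMap f.toLinearMap
    (Coalgebra.comul (R := k) x) = Coalgebra.comul (R := k) (f x) := by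
  induction x using h.induction_ι_mul with
  | one => simp [H.comul_one, H'.comul_one]
  | smul a x hx => simp only [map_smul, hx]
  | add x y hx hy => simp only [map_add, hx, hy]
  | ι_mul v x hx =>
    rw [map_mul f, hf, H.comul_mul_apply, H'.comul_mul_apply,
      map_map_of_intertwines (algHom_mul'_apply f) (algHom_mul'_apply f),
      map_braidMiddle (c := H.c.toLinearMap) (d := H'.c.toLinearMap) (map_c h h' hf),
      TensorProduct.map_tmul, hx, h.comul_ι, h'.comul_ι]
    simp [hf]

end Comparison

section Automorphisms

variable (h : IsNicholsAlgebra B H 𝒜 ι)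

include h

lemma comp_GL (g : B.GL) : IsNicholsAlgebra B H 𝒜 (ι ∘ₗ (g : V ≃ₗ[k] V).toLinearMap) where
  isInternal := h.isInternal
  mul_mem := h.mul_mem
  comul_mem := h.comul_mem
  counit_eq_zero := h.counit_eq_zero
  braiding_mem := h.braiding_mem
  degree_zero := h.degree_zero
  injective := h.injective.comp (g : V ≃ₗ[k] V).injective
  range_eq := by rw [LinearMap.range_comp_of_range_eq_top _ (g : V ≃ₗ[k] V).range, h.range_eq]
  braiding_eq t := by
    rw [TensorProduct.map_comp, LinearMap.comp_apply, LinearMap.comp_apply, h.braiding_eq, g.2]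
  primitive_iff := h.primitive_iff
  adjoin_eq := h.adjoin_eq

-- A Nichols algebra of `(V, c)` along `ι` is also one along `ι ∘ g`, so uniqueness gives an
-- automorphism of `R` carrying `ι` to `ι ∘ g`.
theorem exists_aut (g : B.GL) :
    ∃ f : H.Aut, ∀ v, (f : R ≃ₗ[k] R) (ι v) = ι ((g : V ≃ₗ[k] V) v) := by
  obtain ⟨f, hf⟩ := exists_algEquiv h (h.comp_GL g)
  exact ⟨⟨f.toLinearEquiv, map_mul f, map_comul h (h.comp_GL g) (f := f.toAlgHom) hf,
    map_c h (h.comp_GL g) (f := f.toAlgHom) hf⟩, hf⟩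

lemma exists_linearMap_aut (f : H.Aut) :
    ∃ g : V →ₗ[k] V, ∀ v, (f : R ≃ₗ[k] R) (ι v) = ι (g v) := by
  have f_ι_mem (v : V) : (f : R ≃ₗ[k] R) (ι v) ∈ LinearMap.range ι := by
    rw [h.range_eq, ← h.primitive_iff, ← f.2.2.1, h.comul_ι, map_add, TensorProduct.map_tmul,
      TensorProduct.map_tmul, LinearEquiv.coe_coe, BraidedHopfAlgebra.aut_map_one]
  exact ⟨((f : R ≃ₗ[k] R).toLinearMap ∘ₗ ι).codRestrictOfInjective ι h.injective f_ι_mem, fun v =>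
    (LinearMap.codRestrictOfInjective_comp_apply ((f : R ≃ₗ[k] R).toLinearMap ∘ₗ ι) ι
      h.injective f_ι_mem v).symm⟩

lemma exists_linearEquiv_aut (f : H.Aut) :
    ∃ g : V ≃ₗ[k] V, ∀ v, (f : R ≃ₗ[k] R) (ι v) = ι (g v) := by
  obtain ⟨g, hg⟩ := h.exists_linearMap_aut f
  obtain ⟨g', hg'⟩ := h.exists_linearMap_aut f⁻¹
  refine ⟨LinearEquiv.ofLinearMap g g' (LinearMap.ext fun v => h.injective ?_)
    (LinearMap.ext fun v => h.injective ?_), hg⟩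
  · rw [LinearMap.comp_apply, ← hg, ← hg']
    exact (f : R ≃ₗ[k] R).apply_symm_apply _
  · rw [LinearMap.comp_apply, ← hg', ← hg]
    exact (f : R ≃ₗ[k] R).symm_apply_apply _

theorem exists_restrict (f : H.Aut) :
    ∃ g : B.GL, ∀ v, (f : R ≃ₗ[k] R) (ι v) = ι ((g : V ≃ₗ[k] V) v) := by
  obtain ⟨g, hg⟩ := h.exists_linearEquiv_aut f
  refine ⟨⟨g, fun t => TensorProduct.map_injective_of_flat_flat _ _ h.injective h.injective ?_⟩, hg⟩
  have map_ι_map (t : V ⊗[k] V) :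
      TensorProduct.map ι ι (TensorProduct.map g.toLinearMap g.toLinearMap t) =
        TensorProduct.map (f : R ≃ₗ[k] R).toLinearMap (f : R ≃ₗ[k] R).toLinearMap
          (TensorProduct.map ι ι t) :=
    map_map_of_intertwines (fun v => (hg v).symm) (fun v => (hg v).symm) t
  rw [map_ι_map, ← h.braiding_eq, ← h.braiding_eq, map_ι_map, f.2.2.2]

lemma aut_ext {f f' : H.Aut} (hff : ∀ v, (f : R ≃ₗ[k] R) (ι v) = (f' : R ≃ₗ[k] R) (ι v)) :
    f = f' := by
  refine Subtype.ext (LinearEquiv.ext fun x => ?_)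
  induction x using h.induction_ι_mul with
  | one => rw [BraidedHopfAlgebra.aut_map_one, BraidedHopfAlgebra.aut_map_one]
  | smul a x hx => rw [map_smul, map_smul, hx]
  | add x y hx hy => rw [map_add, map_add, hx, hy]
  | ι_mul v x hx => rw [f.2.1, f'.2.1, hx, hff]

theorem exists_mulEquiv : ∃ Φ : B.GL ≃* H.Aut, ∀ (g : B.GL) (v : V),
    (Φ g : R ≃ₗ[k] R) (ι v) = ι ((g : V ≃ₗ[k] V) v) := by
  choose Φ hΦ using h.exists_aut
  choose Ψ hΨ using h.exists_restrict
  refine ⟨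
    { toFun := Φ
      invFun := Ψ
      left_inv := fun g => Subtype.ext <| LinearEquiv.ext fun v => h.injective <| by
        rw [← hΨ, hΦ]
      right_inv := fun f => h.aut_ext fun v => by rw [hΦ, hΨ]
      map_mul' := fun g g' => h.aut_ext fun v => ?_ }, hΦ⟩
  calc (Φ (g * g') : R ≃ₗ[k] R) (ι v) = ι ((g : V ≃ₗ[k] V) ((g' : V ≃ₗ[k] V) v)) := hΦ _ _
    _ = (Φ g : R ≃ₗ[k] R) ((Φ g' : R ≃ₗ[k] R) (ι v)) := by rw [hΦ, hΦ]

end Automorphisms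

end IsNicholsAlgebra

theorem theorem1p2 {k : Type u} {V : Type v} [Field k] [AddCommGroup V] [Module k V]
    (B : Braiding k V) :
    (∃ (R : Type (max u v)) (_ : Ring R) (_ : Algebra k R) (_ : Coalgebra k R)
      (H : BraidedHopfAlgebra k R) (𝒜 : ℕ → Submodule k R) (ι : V →ₗ[k] R),
      IsNicholsAlgebra B H 𝒜 ι) ∧
    ∀ (R : Type w) [Ring R] [Algebra k R] [Coalgebra k R]
      (H : BraidedHopfAlgebra k R) (𝒜 : ℕ → Submodule k R) (ι : V →ₗ[k] R),
      IsNicholsAlgebra B H 𝒜 ι →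
        ∃ Φ : B.GL ≃* H.Aut, ∀ (g : B.GL) (v : V),
          (Φ g : R ≃ₗ[k] R) (ι v) = ι ((g : V ≃ₗ[k] V) v) := by
  refine ⟨⟨B.Nichols, inferInstance, inferInstance, inferInstance,
    Braiding.Nichols.braidedHopfAlgebra B, Braiding.Nichols.grade B,
    Braiding.Nichols.proj B ∘ₗ TensorAlgebra.ι k, Braiding.Nichols.isNicholsAlgebra B⟩, ?_⟩
  intro R _ _ _ H 𝒜 ι h
  exact h.exists_mulEquiv
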